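/- **Setting.** Let $I$ be the finite vertex set of a finite quiver, possibly with loops and multiple arrows; let $h_{ij}$ be the number of arrows $i\to j$ for $i\ne j$ and $h_i$ the number of loops at $i$. Put $a_{ii}=2-2h_i$, $a_{ij}=-h_{ij}-h_{ji}$ for $i\neq j$, and $I^+=\{i: a_{ii}=2\}$, $I^0=\{i: a_{ii}=0\}$, $I^-=\{i: a_{ii}<0\}$, $I^{\le 0}=I^0\cup I^-$. Let $\nu\in\mathbb N[I]$ have height $n$, and let $\mathrm{Seq}(\nu)$ be the set of sequences $\mathbf i=i_1\cdots i_n$ in $I$ with $i_1+\cdots+i_n=\nu$; the permutation $s_k$ exchanges the $k$-th and $(k+1)$-st entries. **The algebra.** $R(\nu)$ is the $\mathbb Z$-graded unital $\mathbb C$-algebra with generators $1_{\mathbf i}$ (degree $0$), $x_{k,\mathbf i}$ ($1\le k\le n$, degree $2$), $\tau_{k,\mathbf i}$ ($1\le k<n$, degree $-a_{i_k,i_{k+1}}$), $\mathbf i\in \mathrm{Seq}(\nu)$, and the following relations, where $x_k=\sum_{\mathbf i}x_{k,\mathbf i}$ and $\tau_k=\sum_{\mathbf i}\tau_{k,\mathbf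 i}$. - $1_{\mathbf i}1_{\mathbf j}=\delta_{\mathbf i\mathbf j}1_{\mathbf i}$, $\sum_{\mathbf i}1_{\mathbf i}=1$, $x_{k,\mathbf i}=1_{\mathbf i}x_{k,\mathbf i}=x_{k,\mathbf i}1_{\mathbf i}$, $\tau_{k,\mathbf i}=1_{s_k\mathbf i}\tau_{k,\mathbf i}=\tau_{k,\mathbf i}1_{\mathbf i}$, $x_kx_l=x_lx_k$, $\tau_k\tau_l=\tau_l\tau_k$ if $|k-l|>1$, and $\tau_kx_l=x_l\tau_k$ if $l\ne k,k+1$. - $\tau_k^2 1_{\mathbf i}$ equals $0$ if $i_k=i_{k+1}\in I^+$; it equals $(-1)^{a_{ii}/2}(x_k-x_{k+1})^{-a_{ii}}1_{\mathbf i}$ if $i_k=i_{k+1}=i\in I^{\le0}$; and it equals $Q_{i_ki_{k+1}}(x_k,x_{k+1})1_{\mathbf i}$ if $i_k\ne i_{k+1}$, where $Q_{ij}(u,v)=(-1)^{h_{ij}}(u-v)^{-a_{ij}}$. - $(\tau_kx_k-x_{k+1}\tau_k)1_{\mathbf i}=(x_k\tau_k-\tau_kx_{k+1})1_{\mathbf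 i}$, and the common value is $1_{\mathbf i}$ if $i_k=i_{k+1}\in I^+$; otherwise both differences are $0$. - $(\tau_k\tau_{k+1}\tau_k-\tau_{k+1}\tau_k\tau_{k+1})1_{\mathbf i}$ equals $\frac{Q_{ij}(x_k,x_{k+1})-Q_{ij}(x_{k+2},x_{k+1})}{x_k-x_{k+2}}1_{\mathbf i}$ if $i_k=i_{k+2}=i\in I^+$, $i_{k+1}=j\ne i$ and $a_{ij}<0$; otherwise it is $0$. **Grothendieck group.** $G_0(R(\nu))$ is the Grothendieck group of the category of finite-dimensional graded $R(\nu)$-modules (with degree-preserving maps). It is a $\mathbb Z[q,q^{-1}]$-module by $q[M]=[M\{1\}]$, where $(M\{m\})_d=M_{d-m}$. Put $G_0(R(\nu))_{\mathbb Q(q)}=\mathbb Q(q)\otimes_{\mathbb Z[q,q^{-1}]}G_0(R(\nu))$. **Characters.** Let $\underline\nu$ be the finite set of sequences whose members are elements $i\in I^+\sqcup I^-$ or pairs $(i,m)$ with $i\in I^0$, $m>0$, such that replacing each $(i,m)$ by $i\cdots i$ ($m$ times) gives an element of $\mathrm{Seq}(\nu)$. For $\mathbf i\in\underline\nu$ with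 expanded sequence $\bar{\mathbf i}$, let $1_{\mathbf i}\in R(\nu)$ be the degree-$0$ idempotent obtained from $1_{\bar{\mathbf i}}$ by placing on the strands of each pair $(i,m)$ the symmetrizer $e_{i,m}=\frac1{m!}\sum_{\omega\in S_m}\tau_\omega$, where $\tau_\omega$ is the product of the $\tau_k$ along a reduced expression of $\omega$ (on these strands the $\tau_k$ satisfy the relations of the symmetric group). The character of a finite-dimensional graded $R(\nu)$-module $M$ is $$\mathrm{Ch}\,M=\sum_{\mathbf i\in\underline\nu}\Big(\sum_{d\in\mathbb Z}\dim_{\mathbb C}(1_{\mathbf i}M)_d\,q^d\Big)\,\mathbf i\ \in\ \mathbb Z[q,q^{-1}]\underline\nu .$$ It is additive on short exact sequences and satisfies $\mathrm{Ch}(M\{1\})=q\,\mathrm{Ch}\,M$, so it induces a $\mathbb Q(q)$-linear map $\mathrm{Ch}\colon G_0(R(\nu))_{\mathbb Q(q)}\to\mathbb Q(q)\underline\nu$. **Theorem.** The map $\mathrm{Ch}\colon G_0(R(\nu))_{\mathbb Q(q)}\to\mathbb Q(q)\underline\nu$ is injective. Equivalently, the characters of gr-irreducible $R(\nu)$-modules,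 any two of which are non-isomorphic even after a degree shift, are $\mathbb Q(q)$-linearly independent. -/

import Mathlib

open scoped LaurentPolynomial TensorProduct

universe u w v

noncomputable section

namespace KLR

/-! ### Sequences

A finite quiver with vertex set `I` is recorded by the numbers `h i j` of its arrows `i ⟶ j`
(so `h i i` is the number of loops at `i`). Positions in sequences are numbered from `0`. -/

/-- The symmetric Borcherds-Cartan matrix of the quiver:
`a_ii = 2 - 2 h_i`, `a_ij = - h_ij - h_ji` for `i ≠ j`. -/
def cartan {I : Type*} (h : I → I → ℕ) (i j : I) : ℤ :=
  open Classical in if i = j then 2 - 2 * (h i i : ℤ) else -(h i j : ℤ) - (h j i : ℤ)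

/-- `Seq(ν)`: the sequences `i₁ i₂ … iₙ` in `I` with `i₁ + ⋯ + iₙ = ν` in `ℕ[I]`, `n = ht(ν)`. -/
abbrev Seq {I : Type*} (ν : I →₀ ℕ) : Type _ :=
  {i : Fin ν.degree → I // ∑ k, Finsupp.single (i k) 1 = ν}

instance {I : Type*} [Finite I] (ν : I →₀ ℕ) : Fintype (Seq ν) := Fintype.ofFinite _

/-- `s_k i`: the sequence `i` with the entries at positions `k` and `k + 1` exchanged. -/
def Seq.swap {I : Type*} {ν : I →₀ ℕ} (k : ℕ) (hk : k + 1 < ν.degree) (i : Seq ν) : Seq ν :=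
  ⟨i.1 ∘ Equiv.swap ⟨k, by omega⟩ ⟨k + 1, hk⟩, by
    refine Eq.trans ?_ i.2
    exact Equiv.sum_comp (Equiv.swap (⟨k, _⟩ : Fin ν.degree) ⟨k + 1, hk⟩)
      (fun l => Finsupp.single (i.1 l) 1)⟩

/-! ### The algebra `R(ν)` -/

/-- The generators `1_i`, `x_{k,i}`, `τ_{k,i}` of `R(ν)`. -/
inductive Gen {I : Type*} (ν : I →₀ ℕ) : Type _
  | e (i : Seq ν) : Gen ν
  | x (k : Fin ν.degree) (i : Seq ν) : Gen ν
  | τ (k : ℕ) (hk : k + 1 < ν.degree) (i : Seq ν) : Gen ν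

/-- `deg 1_i = 0`, `deg x_{k,i} = 2`, `deg τ_{k,i} = - a_{i_k, i_{k+1}}`. -/
def Gen.deg {I : Type*} (h : I → I → ℕ) {ν : I →₀ ℕ} : Gen ν → ℤ
  | .e _ => 0
  | .x _ _ => 2
  | .τ k hk i => - cartan h (i.1 ⟨k, by omega⟩) (i.1 ⟨k + 1, hk⟩)

/-- `H_i(u,v) = (-1)^{a_ii / 2} (u - v)^{-a_ii}`, used for `h i i ≥ 1`; here `a_ii / 2 = 1 - h_i`. -/
def Hpoly {I : Type*} (h : I → I → ℕ) (i : I) {A : Type*} [Ring A] (u v : A) : A :=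
  (-1) ^ (h i i - 1) * (u - v) ^ (2 * (h i i - 1))

/-- `Q_ij(u,v) = (-1)^{h_ij} (u - v)^{-a_ij}` for `i ≠ j`. -/
def Qpoly {I : Type*} (h : I → I → ℕ) (i j : I) {A : Type*} [Ring A] (u v : A) : A :=
  (-1) ^ h i j * (u - v) ^ (h i j + h j i)

/-- The polynomial `(Q_ij(u,v) - Q_ij(w,v)) / (u - w)`. -/
def Qquot {I : Type*} (h : I → I → ℕ) (i j : I) {A : Type*} [Ring A] (u v w : A) : A :=
  (-1) ^ h i j * ∑ a ∈ Finset.range (h i j + h j i),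
    (u - v) ^ a * (w - v) ^ (h i j + h j i - 1 - a)

/-- `Qquot` is the asserted quotient. -/
theorem Qquot_mul {I : Type*} (h : I → I → ℕ) (i j : I) {A : Type*} [CommRing A] (u v w : A) :
    Qquot h i j u v w * (u - w) = Qpoly h i j u v - Qpoly h i j w v := by
  have := geom_sum₂_mul (u - v) (w - v) (h i j + h j i)
  rw [sub_sub_sub_cancel_right] at this
  rw [Qquot, Qpoly, Qpoly, mul_assoc, this, mul_sub]

section Free

variable {I : Type*} [Finite I] {ν : I →₀ ℕ}

/-- The generator `1_i` in the free algebra. -/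
def fe (i : Seq ν) : FreeAlgebra ℂ (Gen ν) := FreeAlgebra.ι ℂ (Gen.e i)

/-- `x_k = ∑_i x_{k,i}` in the free algebra. -/
def fx (k : Fin ν.degree) : FreeAlgebra ℂ (Gen ν) := ∑ i : Seq ν, FreeAlgebra.ι ℂ (Gen.x k i)

/-- `τ_k = ∑_i τ_{k,i}` in the free algebra. -/
def ft (k : ℕ) (hk : k + 1 < ν.degree) : FreeAlgebra ℂ (Gen ν) :=
  ∑ i : Seq ν, FreeAlgebra.ι ℂ (Gen.τ k hk i)

end Free

/-- The defining relations of `R(ν)`. The first ten constructors express that elements are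
braid-like diagrams multiplied by vertical stacking (bottom to top is right to left), up to
isotopy; the remaining ones are the local relations. A relation on the strands starting at the
positions `k, k + 1, …` of the bottom sequence `i` is multiplied on the right by `1_i`. -/
inductive Rel {I : Type*} [Finite I] (h : I → I → ℕ) (ν : I →₀ ℕ) :
    FreeAlgebra ℂ (Gen ν) → FreeAlgebra ℂ (Gen ν) → Prop
  | e_mul_self (i : Seq ν) : Rel h ν (fe i * fe i) (fe i)
  | e_mul_e (i j : Seq ν) (hij : i ≠ j) : Rel h ν (fe i * fe j) 0
  | sum_e : Rel h ν (∑ i : Seq ν, fe i) 1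
  | e_mul_x (k : Fin ν.degree) (i : Seq ν) :
      Rel h ν (fe i * FreeAlgebra.ι ℂ (Gen.x k i)) (FreeAlgebra.ι ℂ (Gen.x k i))
  | x_mul_e (k : Fin ν.degree) (i : Seq ν) :
      Rel h ν (FreeAlgebra.ι ℂ (Gen.x k i) * fe i) (FreeAlgebra.ι ℂ (Gen.x k i))
  | e_mul_τ (k : ℕ) (hk : k + 1 < ν.degree) (i : Seq ν) :
      Rel h ν (fe (i.swap k hk) * FreeAlgebra.ι ℂ (Gen.τ k hk i)) (FreeAlgebra.ι ℂ (Gen.τ k hk i))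
  | τ_mul_e (k : ℕ) (hk : k + 1 < ν.degree) (i : Seq ν) :
      Rel h ν (FreeAlgebra.ι ℂ (Gen.τ k hk i) * fe i) (FreeAlgebra.ι ℂ (Gen.τ k hk i))
  | x_comm (k l : Fin ν.degree) : Rel h ν (fx k * fx l) (fx l * fx k)
  | τ_comm (k l : ℕ) (hk : k + 1 < ν.degree) (hl : l + 1 < ν.degree) (hkl : k + 1 < l) :
      Rel h ν (ft k hk * ft l hl) (ft l hl * ft k hk)
  | τ_x_comm (k : ℕ) (hk : k + 1 < ν.degree) (l : Fin ν.degree)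
      (hl : l.1 ≠ k) (hl' : l.1 ≠ k + 1) : Rel h ν (ft k hk * fx l) (fx l * ft k hk)
  | τ_sq_real (k : ℕ) (hk : k + 1 < ν.degree) (i : Seq ν)
      (heq : i.1 ⟨k, by omega⟩ = i.1 ⟨k + 1, hk⟩)
      (hreal : h (i.1 ⟨k, by omega⟩) (i.1 ⟨k, by omega⟩) = 0) :
      Rel h ν (ft k hk * ft k hk * fe i) 0
  | τ_sq_imag (k : ℕ) (hk : k + 1 < ν.degree) (i : Seq ν)
      (heq : i.1 ⟨k, by omega⟩ = i.1 ⟨k + 1, hk⟩)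
      (himag : h (i.1 ⟨k, by omega⟩) (i.1 ⟨k, by omega⟩) ≠ 0) :
      Rel h ν (ft k hk * ft k hk * fe i)
        (Hpoly h (i.1 ⟨k, by omega⟩) (fx ⟨k, by omega⟩) (fx ⟨k + 1, hk⟩) * fe i)
  | τ_sq_ne (k : ℕ) (hk : k + 1 < ν.degree) (i : Seq ν)
      (hne : i.1 ⟨k, by omega⟩ ≠ i.1 ⟨k + 1, hk⟩) :
      Rel h ν (ft k hk * ft k hk * fe i)
        (Qpoly h (i.1 ⟨k, by omega⟩) (i.1 ⟨k + 1, hk⟩)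
          (fx ⟨k, by omega⟩) (fx ⟨k + 1, hk⟩) * fe i)
  | τ_x_real (k : ℕ) (hk : k + 1 < ν.degree) (i : Seq ν)
      (hreal : i.1 ⟨k, by omega⟩ = i.1 ⟨k + 1, hk⟩ ∧
        h (i.1 ⟨k, by omega⟩) (i.1 ⟨k, by omega⟩) = 0) :
      Rel h ν ((ft k hk * fx ⟨k, by omega⟩ - fx ⟨k + 1, hk⟩ * ft k hk) * fe i) (fe i)
  | x_τ_real (k : ℕ) (hk : k + 1 < ν.degree) (i : Seq ν)
      (hreal : i.1 ⟨k, by omega⟩ = i.1 ⟨k + 1, hk⟩ ∧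
        h (i.1 ⟨k, by omega⟩) (i.1 ⟨k, by omega⟩) = 0) :
      Rel h ν ((fx ⟨k, by omega⟩ * ft k hk - ft k hk * fx ⟨k + 1, hk⟩) * fe i) (fe i)
  | τ_x_slide (k : ℕ) (hk : k + 1 < ν.degree) (i : Seq ν)
      (hother : ¬ (i.1 ⟨k, by omega⟩ = i.1 ⟨k + 1, hk⟩ ∧
        h (i.1 ⟨k, by omega⟩) (i.1 ⟨k, by omega⟩) = 0)) :
      Rel h ν (ft k hk * fx ⟨k, by omega⟩ * fe i) (fx ⟨k + 1, hk⟩ * ft k hk * fe i)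
  | x_τ_slide (k : ℕ) (hk : k + 1 < ν.degree) (i : Seq ν)
      (hother : ¬ (i.1 ⟨k, by omega⟩ = i.1 ⟨k + 1, hk⟩ ∧
        h (i.1 ⟨k, by omega⟩) (i.1 ⟨k, by omega⟩) = 0)) :
      Rel h ν (fx ⟨k, by omega⟩ * ft k hk * fe i) (ft k hk * fx ⟨k + 1, hk⟩ * fe i)
  | braid_real (k : ℕ) (hk : k + 1 + 1 < ν.degree) (i : Seq ν)
      (hreal : i.1 ⟨k, by omega⟩ = i.1 ⟨k + 2, hk⟩ ∧ i.1 ⟨k, by omega⟩ ≠ i.1 ⟨k + 1, by omega⟩ ∧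
        h (i.1 ⟨k, by omega⟩) (i.1 ⟨k, by omega⟩) = 0 ∧
        cartan h (i.1 ⟨k, by omega⟩) (i.1 ⟨k + 1, by omega⟩) < 0) :
      Rel h ν
        ((ft k (by omega) * ft (k + 1) hk * ft k (by omega)
          - ft (k + 1) hk * ft k (by omega) * ft (k + 1) hk) * fe i)
        (Qquot h (i.1 ⟨k, by omega⟩) (i.1 ⟨k + 1, by omega⟩)
          (fx ⟨k, by omega⟩) (fx ⟨k + 1, by omega⟩) (fx ⟨k + 2, hk⟩) * fe i)
  | braid (k : ℕ) (hk : k + 1 + 1 < ν.degree) (i : Seq ν)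
      (hother : ¬ (i.1 ⟨k, by omega⟩ = i.1 ⟨k + 2, hk⟩ ∧
        i.1 ⟨k, by omega⟩ ≠ i.1 ⟨k + 1, by omega⟩ ∧
        h (i.1 ⟨k, by omega⟩) (i.1 ⟨k, by omega⟩) = 0 ∧
        cartan h (i.1 ⟨k, by omega⟩) (i.1 ⟨k + 1, by omega⟩) < 0)) :
      Rel h ν
        (ft k (by omega) * ft (k + 1) hk * ft k (by omega) * fe i)
        (ft (k + 1) hk * ft k (by omega) * ft (k + 1) hk * fe i)

/-- The KLR-algebra `R(ν)` of the quiver. -/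
def R {I : Type*} [Finite I] (h : I → I → ℕ) (ν : I →₀ ℕ) : Type _ := RingQuot (Rel h ν)

section Algebra

variable {I : Type*} [Finite I] (h : I → I → ℕ) (ν : I →₀ ℕ)

instance : Ring (R h ν) := inferInstanceAs (Ring (RingQuot (Rel h ν)))

instance : Algebra ℂ (R h ν) := inferInstanceAs (Algebra ℂ (RingQuot (Rel h ν)))

/-- The quotient map from the free algebra. -/
def mk : FreeAlgebra ℂ (Gen ν) →ₐ[ℂ] R h ν := RingQuot.mkAlgHom ℂ (Rel h ν)

/-- The image of a generator in `R(ν)`. -/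
def gen (g : Gen ν) : R h ν := mk h ν (FreeAlgebra.ι ℂ g)

/-- The idempotent `1_i`, `i ∈ Seq(ν)`. -/
def e (i : Seq ν) : R h ν := gen h ν (Gen.e i)

/-- `τ_k = ∑_i τ_{k,i}`; it is put to `0` if there is no position `k + 1`. -/
def T (k : ℕ) : R h ν :=
  if hk : k + 1 < ν.degree then ∑ i : Seq ν, gen h ν (Gen.τ k hk i) else 0

/-- The homogeneous component `R(ν)_d`: the span of the words of degree `d` in the generators. -/
def grading (d : ℤ) : Submodule ℂ (R h ν) :=
  Submodule.span ℂ {r | ∃ w : List (Gen ν),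
    (w.map (Gen.deg h)).sum = d ∧ (w.map (gen h ν)).prod = r}

end Algebra

/-! ### Symmetrizers -/

section Sym

variable {A : Type*} [Ring A]

/-- `∑_{j=0}^{r} t_{a+j} t_{a+j+1} ⋯ t_{a+r-1}`: the sum over the minimal representatives of the
left cosets of the symmetric group on the `r` letters `a, …, a+r-1` in the one on the `r + 1`
letters `a, …, a+r`. -/
def cosetSum (t : ℕ → A) (a r : ℕ) : A :=
  ∑ j ∈ Finset.range (r + 1), ((List.range' (a + j) (r - j)).map t).prod

/-- The sum of all `t_w`, where `w` runs over the symmetric group on the `m` letters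
`a, …, a+m-1` and `t_w` is the product of the `t_k` along a reduced expression of `w` in the
adjacent transpositions `s_k = (k, k+1)`. The reduced expression used is the one
`w = c_{m-1} c_{m-2} ⋯ c_1` with `c_r` of the form `s_{a+j} s_{a+j+1} ⋯ s_{a+r-1}`. -/
def symSum (t : ℕ → A) (a : ℕ) : ℕ → A
  | 0 => 1
  | r + 1 => cosetSum t a r * symSum t a r

/-- `e_{m₁} ⊗ e_{m₂} ⊗ ⋯` with `e_m = (1 / m!) ∑_{w ∈ S_m} t_w`, the blocks of consecutive letters
of lengths `m₁, m₂, …` starting at the letter `a`. -/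
def blockIdem [Algebra ℂ A] (t : ℕ → A) : ℕ → List ℕ → A
  | _, [] => 1
  | a, m :: l => ((m.factorial : ℂ)⁻¹ • symSum t a m) * blockIdem t (a + m) l

end Sym

section SymFacts

variable {A : Type*} [Ring A] {t : ℕ → A}

theorem cosetSum_zero (a : ℕ) : cosetSum t a 0 = 1 := by simp [cosetSum]

theorem cosetSum_succ (a r : ℕ) :
    cosetSum t a (r + 1) = 1 + cosetSum t a r * t (a + r) := by
  rw [cosetSum, Finset.sum_range_succ, add_comm, cosetSum, Finset.sum_mul]
  congr 1
  · simp
  · refine Finset.sum_congr rfl fun j hj => ?_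
    have hj' : j ≤ r := by simpa [Nat.lt_succ_iff] using hj
    rw [Nat.sub_add_comm hj', List.range'_concat, List.map_append, List.prod_append]
    simp [add_assoc, Nat.add_sub_cancel' hj']

theorem cosetSum_commute {x : A} {a r : ℕ}
    (H : ∀ j, a ≤ j → j < a + r → Commute x (t j)) : Commute x (cosetSum t a r) := by
  induction r with
  | zero => rw [cosetSum_zero]; exact Commute.one_right x
  | succ r ih =>
    rw [cosetSum_succ]
    exact (Commute.one_right x).add_right
      ((ih fun j h1 h2 => H j h1 (by omega)).mul_right (H _ (by omega) (by omega)))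

theorem symSum_commute {x : A} {a m : ℕ}
    (H : ∀ j, a ≤ j → j + 1 < a + m → Commute x (t j)) : Commute x (symSum t a m) := by
  induction m with
  | zero => exact Commute.one_right x
  | succ r ih =>
    exact (cosetSum_commute fun j h1 h2 => H j h1 (by omega)).mul_right
      (ih fun j h1 h2 => H j h1 (by omega))

theorem cosetSum_fix {a : ℕ} (S : AddSubgroup A)
    (comm : ∀ k l, k + 1 < l → t k * t l = t l * t k) :
    ∀ (r : ℕ) (_ : ∀ k, a ≤ k → k < a + r → ∀ Z ∈ S, t k * Z ∈ S)
      (_ : ∀ k, a ≤ k → k < a + r → ∀ Z ∈ S, t k * (t k * Z) = Z)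
      (_ : ∀ k, a ≤ k → k + 1 < a + r → ∀ Z ∈ S,
        t k * (t (k + 1) * (t k * Z)) = t (k + 1) * (t k * (t (k + 1) * Z)))
      (Y : A) (_ : Y ∈ S) (_ : ∀ k, a ≤ k → k + 1 < a + r → t k * Y = Y),
      ∀ k, a ≤ k → k < a + r → t k * (cosetSum t a r * Y) = cosetSum t a r * Y := by
  intro r
  induction r with
  | zero => intro _ _ _ Y _ _ k h1 h2; omega
  | succ r ih =>
    intro hS hinv hbr Y hY hfix k h1 h2
    have hZ : t (a + r) * Y ∈ S := hS _ (by omega) (by omega) Y hY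
    have hZfix : ∀ k, a ≤ k → k + 1 < a + r → t k * (t (a + r) * Y) = t (a + r) * Y := by
      intro k h1 h2
      rw [← mul_assoc, comm k (a + r) h2, mul_assoc, hfix k h1 (by omega)]
    rw [cosetSum_succ, add_mul, one_mul, mul_assoc, mul_add]
    rcases Nat.lt_or_ge k (a + r) with hk | hk
    · rw [ih (fun k h1 h2 => hS k h1 (by omega)) (fun k h1 h2 => hinv k h1 (by omega))
        (fun k h1 h2 => hbr k h1 (by omega)) _ hZ hZfix k h1 hk, hfix k h1 (by omega)]
    · obtain rfl : k = a + r := by omega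
      cases r with
      | zero =>
        rw [cosetSum_zero, one_mul, hinv _ h1 h2 Y hY, add_comm]
      | succ r =>
        have hc : Commute (t (a + (r + 1))) (cosetSum t a r) :=
          cosetSum_commute fun j _ _ => (comm j _ (by omega)).symm
        rw [cosetSum_succ, add_mul, one_mul, mul_add, hinv _ h1 h2 Y hY, mul_assoc,
          ← mul_assoc _ (cosetSum t a r), hc.eq, mul_assoc,
          show a + (r + 1) = a + r + 1 by omega,
          ← hbr (a + r) (by omega) (by omega) Y hY, hfix (a + r) (by omega) (by omega)]
        abel

theorem cosetSum_mem {a r : ℕ} (S : AddSubgroup A)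
    (hS : ∀ k, a ≤ k → k < a + r → ∀ Z ∈ S, t k * Z ∈ S) {Y : A} (hY : Y ∈ S) :
    cosetSum t a r * Y ∈ S := by
  induction r generalizing Y with
  | zero => simpa [cosetSum_zero] using hY
  | succ r ih =>
    rw [cosetSum_succ, add_mul, one_mul, mul_assoc]
    exact S.add_mem hY (ih (fun k h1 h2 => hS k h1 (by omega)) (hS _ (by omega) (by omega) _ hY))

theorem symSum_mem {a m : ℕ} (S : AddSubgroup A)
    (hS : ∀ k, a ≤ k → k + 1 < a + m → ∀ Z ∈ S, t k * Z ∈ S) {Y : A} (hY : Y ∈ S) :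
    symSum t a m * Y ∈ S := by
  induction m with
  | zero => simpa [symSum] using hY
  | succ r ih =>
    rw [symSum, mul_assoc]
    exact cosetSum_mem S (fun k h1 h2 => hS k h1 (by omega))
      (ih fun k h1 h2 => hS k h1 (by omega))

theorem cosetSum_eigen {a r : ℕ} {Z : A} (H : ∀ k, a ≤ k → k < a + r → t k * Z = Z) :
    cosetSum t a r * Z = ((r + 1 : ℕ) : A) * Z := by
  induction r with
  | zero => simp [cosetSum_zero]
  | succ r ih =>
    rw [cosetSum_succ, add_mul, mul_assoc, H _ (by omega) (by omega),
      ih fun k h1 h2 => H k h1 (by omega)]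
    push_cast
    simp only [add_mul, one_mul]
    abel

theorem symSum_eigen {a m : ℕ} {Z : A} (H : ∀ k, a ≤ k → k + 1 < a + m → t k * Z = Z) :
    symSum t a m * Z = (m.factorial : A) * Z := by
  induction m with
  | zero => simp [symSum]
  | succ r ih =>
    rw [symSum, mul_assoc, ih fun k h1 h2 => H k h1 (by omega), ← mul_assoc,
      ← (Nat.cast_commute r.factorial _).eq, mul_assoc,
      cosetSum_eigen fun k h1 h2 => H k h1 (by omega), ← mul_assoc, ← Nat.cast_mul,
      mul_comm, Nat.factorial_succ]

theorem symSum_fix {a m : ℕ} (S : AddSubgroup A)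
    (comm : ∀ k l, k + 1 < l → t k * t l = t l * t k)
    (hS : ∀ k, a ≤ k → k + 1 < a + m → ∀ Z ∈ S, t k * Z ∈ S)
    (hinv : ∀ k, a ≤ k → k + 1 < a + m → ∀ Z ∈ S, t k * (t k * Z) = Z)
    (hbr : ∀ k, a ≤ k → k + 2 < a + m → ∀ Z ∈ S,
        t k * (t (k + 1) * (t k * Z)) = t (k + 1) * (t k * (t (k + 1) * Z)))
    {Y : A} (hY : Y ∈ S) :
    ∀ k, a ≤ k → k + 1 < a + m → t k * (symSum t a m * Y) = symSum t a m * Y := by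
  induction m with
  | zero => intro k h1 h2; omega
  | succ r ih =>
    intro k h1 h2
    rw [symSum, mul_assoc]
    refine cosetSum_fix S comm r (fun k h1 h2 => hS k h1 (by omega))
      (fun k h1 h2 => hinv k h1 (by omega)) (fun k h1 h2 => hbr k h1 (by omega)) _
      (symSum_mem S (fun k h1 h2 => hS k h1 (by omega)) hY) ?_ k h1 (by omega)
    exact ih (fun k h1 h2 => hS k h1 (by omega)) (fun k h1 h2 => hinv k h1 (by omega))
      (fun k h1 h2 => hbr k h1 (by omega))

/-- `k` and `k + 1` lie in the same block. -/
def InBlock : ℕ → List ℕ → ℕ → Prop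
  | _, [], _ => False
  | a, m :: l, k => (a ≤ k ∧ k + 1 < a + m) ∨ InBlock (a + m) l k

theorem InBlock.le {a : ℕ} {l : List ℕ} {k : ℕ} (hk : InBlock a l k) : a ≤ k := by
  induction l generalizing a with
  | nil => exact hk.elim
  | cons m l ih =>
    rcases hk with hk | hk
    · exact hk.1
    · have := ih hk; omega

variable [Algebra ℂ A]

theorem blockIdem_mem (S : Submodule ℂ A) {a : ℕ} {l : List ℕ}
    (hS : ∀ k, InBlock a l k → ∀ Z ∈ S, t k * Z ∈ S) {Y : A} (hY : Y ∈ S) :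
    blockIdem t a l * Y ∈ S := by
  induction l generalizing a with
  | nil => simpa [blockIdem] using hY
  | cons m l ih =>
    rw [blockIdem, mul_assoc, smul_mul_assoc]
    exact S.smul_mem _ (symSum_mem S.toAddSubgroup (fun k h1 h2 => hS k (Or.inl ⟨h1, h2⟩))
      (ih fun k hk => hS k (Or.inr hk)))

theorem blockIdem_eigen {a : ℕ} {l : List ℕ} {Z : A}
    (H : ∀ k, InBlock a l k → t k * Z = Z) : blockIdem t a l * Z = Z := by
  induction l generalizing a with
  | nil => simp [blockIdem]
  | cons m l ih =>
    rw [blockIdem, mul_assoc, ih fun k hk => H k (Or.inr hk), smul_mul_assoc,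
      symSum_eigen fun k h1 h2 => H k (Or.inl ⟨h1, h2⟩), ← nsmul_eq_mul,
      ← Nat.cast_smul_eq_nsmul ℂ, smul_smul, inv_mul_cancel₀ (by exact_mod_cast m.factorial_ne_zero),
      one_smul]

theorem blockIdem_fix (S : Submodule ℂ A)
    (comm : ∀ k l, k + 1 < l → t k * t l = t l * t k) {a : ℕ} {l : List ℕ}
    (hS : ∀ k, InBlock a l k → ∀ Z ∈ S, t k * Z ∈ S)
    (hinv : ∀ k, InBlock a l k → ∀ Z ∈ S, t k * (t k * Z) = Z)
    (hbr : ∀ k, InBlock a l k → InBlock a l (k + 1) → ∀ Z ∈ S,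
        t k * (t (k + 1) * (t k * Z)) = t (k + 1) * (t k * (t (k + 1) * Z)))
    {Y : A} (hY : Y ∈ S) :
    ∀ k, InBlock a l k → t k * (blockIdem t a l * Y) = blockIdem t a l * Y := by
  induction l generalizing a with
  | nil => intro k hk; exact hk.elim
  | cons m l ih =>
    intro k hk
    have hm : blockIdem t (a + m) l * Y ∈ S := blockIdem_mem S (fun k hk => hS k (Or.inr hk)) hY
    rw [blockIdem, mul_assoc, smul_mul_assoc, mul_smul_comm]
    congr 1
    rcases hk with hk | hk
    · exact symSum_fix S.toAddSubgroup comm (fun k h1 h2 => hS k (Or.inl ⟨h1, h2⟩))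
        (fun k h1 h2 => hinv k (Or.inl ⟨h1, h2⟩))
        (fun k h1 h2 => hbr k (Or.inl ⟨h1, by omega⟩) (Or.inl ⟨by omega, by omega⟩))
        hm k hk.1 hk.2
    · have hc : Commute (t k) (symSum t a m) := symSum_commute fun j h1 h2 =>
        (comm j k (by have := hk.le; omega)).symm
      rw [← mul_assoc, hc.eq, mul_assoc, ih (fun k hk => hS k (Or.inr hk))
        (fun k hk => hinv k (Or.inr hk)) (fun k h1 h2 => hbr k (Or.inr h1) (Or.inr h2)) k hk]

end SymFacts

/-! ### Sequences with parameters -/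

/-- `𝕀 = I⁺ ⊔ I⁻ ⊔ (I⁰ × ℤ_{>0})`; an element `i` of `I⁺ ⊔ I⁻` is written as `(i, 1)`. -/
abbrev ParIndex {I : Type*} (h : I → I → ℕ) : Type _ :=
  {p : I × ℕ // 0 < p.2 ∧ (h p.1 p.1 ≠ 1 → p.2 = 1)}

/-- The expanded sequence: each `(i, n)` is replaced by `i … i` (`n` times). -/
def expand {I : Type*} {h : I → I → ℕ} (l : List (ParIndex h)) : List I :=
  l.flatMap fun p => List.replicate p.1.2 p.1.1

theorem sum_expand {I : Type*} {h : I → I → ℕ} (l : List (ParIndex h)) :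
    ((expand l).map fun i => (Finsupp.single i 1 : I →₀ ℕ)).sum
      = (l.map fun p => Finsupp.single p.1.1 p.1.2).sum := by
  induction l with
  | nil => rfl
  | cons p l ih =>
    simp only [expand, List.flatMap_cons, List.map_append, List.sum_append, List.map_cons,
      List.sum_cons, List.map_replicate, List.sum_replicate] at ih ⊢
    rw [ih]; simp

/-- `\underline{ν}`: the sequences of type `ν` with parameters in `I⁰`. -/
abbrev ParSeq {I : Type*} (h : I → I → ℕ) (ν : I →₀ ℕ) : Type _ :=
  {l : List (ParIndex h) // ((expand l).map fun i => Finsupp.single i 1).sum = ν}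

theorem ParSeq.length_expand {I : Type*} {h : I → I → ℕ} {ν : I →₀ ℕ} (l : ParSeq h ν) :
    (expand l.1).length = ν.degree := by
  conv_rhs => rw [← l.2]
  rw [map_list_sum]
  simp [Function.comp_def]

/-- The expanded sequence as an element of `Seq(ν)`. -/
def ParSeq.toSeq {I : Type*} {h : I → I → ℕ} {ν : I →₀ ℕ} (l : ParSeq h ν) : Seq ν :=
  ⟨fun k => (expand l.1).get (k.cast l.length_expand.symm), by
    refine Eq.trans ?_ l.2
    rw [← Fin.sum_univ_fun_getElem (expand l.1) fun i => Finsupp.single i 1]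
    exact Fintype.sum_equiv (finCongr l.length_expand.symm) _ _ fun _ => rfl⟩

/-- The element `1_i` of `R(ν)` for `i ∈ \underline{ν}`, that is,
`1_{j₁ … j_p} ⊗ e_{i₁,n₁} ⊗ 1_{k₁ … } ⊗ e_{i₂,n₂} ⊗ ⋯`, with `e_{i,n} = (1 / n!) ∑_{w ∈ S_n} τ_w`
placed on the strands of the block `(i,n)`. -/
def parIdem {I : Type*} [Finite I] {h : I → I → ℕ} {ν : I →₀ ℕ} (l : ParSeq h ν) : R h ν :=
  blockIdem (T h ν) 0 (l.1.map fun p => p.1.2) * e h ν l.toSeq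

section ParIdem

theorem InBlock.expand {I : Type*} {h : I → I → ℕ} (l : List (ParIndex h)) {a k : ℕ}
    (hk : InBlock a (l.map fun p => p.1.2) k) :
    ∃ i : I, h i i = 1 ∧ (expand l)[k - a]? = some i ∧ (expand l)[k + 1 - a]? = some i := by
  induction l generalizing a with
  | nil => exact hk.elim
  | cons p l ih =>
    simp only [KLR.expand, List.flatMap_cons]
    have hk : (a ≤ k ∧ k + 1 < a + p.1.2) ∨ InBlock (a + p.1.2) (l.map fun p => p.1.2) k := hk
    rcases hk with hk | hk
    · refine ⟨p.1.1, ?_, ?_, ?_⟩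
      · by_contra hne
        have := p.2.2 hne
        omega
      · rw [List.getElem?_append_left (by rw [List.length_replicate]; omega),
          List.getElem?_replicate, if_pos (by omega)]
      · rw [List.getElem?_append_left (by rw [List.length_replicate]; omega),
          List.getElem?_replicate, if_pos (by omega)]
    · have hle := hk.le
      obtain ⟨i, h1, h2, h3⟩ := ih hk
      refine ⟨i, h1, ?_, ?_⟩
      · rw [List.getElem?_append_right (by rw [List.length_replicate]; omega),
          List.length_replicate, Nat.sub_sub]
        exact h2
      · rw [List.getElem?_append_right (by rw [List.length_replicate]; omega),
          List.length_replicate, Nat.sub_sub]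
        exact h3

variable {I : Type*} {h : I → I → ℕ} {ν : I →₀ ℕ}

theorem ParSeq.inBlock (l : ParSeq h ν) {k : ℕ} (hk : InBlock 0 (l.1.map fun p => p.1.2) k) :
    ∃ hk' : k + 1 < ν.degree,
      l.toSeq.1 ⟨k, by omega⟩ = l.toSeq.1 ⟨k + 1, hk'⟩ ∧
      h (l.toSeq.1 ⟨k, by omega⟩) (l.toSeq.1 ⟨k, by omega⟩) = 1 := by
  obtain ⟨i, h1, h2, h3⟩ := hk.expand
  simp only [Nat.sub_zero] at h2 h3
  rw [List.getElem?_eq_some_iff] at h2 h3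
  obtain ⟨h2', h2⟩ := h2
  obtain ⟨h3', h3⟩ := h3
  have e1 : l.toSeq.1 ⟨k, l.length_expand ▸ h2'⟩ = i := h2
  have e2 : l.toSeq.1 ⟨k + 1, l.length_expand ▸ h3'⟩ = i := h3
  exact ⟨l.length_expand ▸ h3', e1.trans e2.symm, by rw [e1]; exact h1⟩

theorem Seq.swap_swap (k : ℕ) (hk : k + 1 < ν.degree) (i : Seq ν) :
    (i.swap k hk).swap k hk = i := by
  apply Subtype.ext
  funext l
  simp [Seq.swap]

theorem Seq.swap_eq_self {k : ℕ} {hk : k + 1 < ν.degree} {i : Seq ν}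
    (hi : i.1 ⟨k, by omega⟩ = i.1 ⟨k + 1, hk⟩) : i.swap k hk = i := by
  apply Subtype.ext
  funext l
  simp only [Seq.swap, Function.comp_apply, Equiv.swap_apply_def]
  split_ifs with h1 h2
  · rw [h1, hi]
  · rw [h2, hi]
  · rfl

variable [Finite I]

theorem rel_eq {a b : FreeAlgebra ℂ (Gen ν)} (hab : Rel h ν a b) : mk h ν a = mk h ν b :=
  RingQuot.mkAlgHom_rel ℂ hab

theorem mk_fe (i : Seq ν) : mk h ν (fe i) = e h ν i := rfl

theorem mk_ft (k : ℕ) (hk : k + 1 < ν.degree) : mk h ν (ft k hk) = T h ν k := by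
  rw [T, dif_pos hk, ft, map_sum]; rfl

theorem e_mul_self (i : Seq ν) : e h ν i * e h ν i = e h ν i := by
  simpa only [map_mul, mk_fe] using rel_eq (Rel.e_mul_self (h := h) i)

theorem e_mul_e {i j : Seq ν} (hij : i ≠ j) : e h ν i * e h ν j = 0 := by
  simpa only [map_mul, mk_fe, map_zero] using rel_eq (Rel.e_mul_e (h := h) i j hij)

theorem e_mul_τ (k : ℕ) (hk : k + 1 < ν.degree) (i : Seq ν) :
    e h ν (i.swap k hk) * gen h ν (Gen.τ k hk i) = gen h ν (Gen.τ k hk i) := by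
  have := rel_eq (Rel.e_mul_τ (h := h) k hk i)
  rwa [map_mul, mk_fe] at this

theorem τ_mul_e (k : ℕ) (hk : k + 1 < ν.degree) (i : Seq ν) :
    gen h ν (Gen.τ k hk i) * e h ν i = gen h ν (Gen.τ k hk i) := by
  have := rel_eq (Rel.τ_mul_e (h := h) k hk i)
  rwa [map_mul, mk_fe] at this

theorem T_mul_e (k : ℕ) (hk : k + 1 < ν.degree) (i : Seq ν) :
    T h ν k * e h ν i = gen h ν (Gen.τ k hk i) := by
  rw [T, dif_pos hk, Finset.sum_mul, Finset.sum_eq_single i, τ_mul_e]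
  · intro j _ hj
    rw [← τ_mul_e, mul_assoc, e_mul_e hj, mul_zero]
  · intro hi; exact absurd (Finset.mem_univ _) hi

theorem e_mul_T (k : ℕ) (hk : k + 1 < ν.degree) (i : Seq ν) :
    e h ν (i.swap k hk) * T h ν k = gen h ν (Gen.τ k hk i) := by
  rw [T, dif_pos hk, Finset.mul_sum, Finset.sum_eq_single i, e_mul_τ]
  · intro j _ hj
    rw [← e_mul_τ, ← mul_assoc, e_mul_e, zero_mul]
    intro hij
    apply hj
    rw [← Seq.swap_swap k hk j, ← hij, Seq.swap_swap]
  · intro hi; exact absurd (Finset.mem_univ _) hi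

theorem T_comm (k l : ℕ) (hkl : k + 1 < l) : T h ν k * T h ν l = T h ν l * T h ν k := by
  by_cases hl : l + 1 < ν.degree
  · have hk : k + 1 < ν.degree := by omega
    have := rel_eq (Rel.τ_comm (h := h) k l hk hl hkl)
    rwa [map_mul, map_mul, mk_ft, mk_ft] at this
  · simp [T, hl]

theorem grading_mul {c d : ℤ} {a b : R h ν} (ha : a ∈ grading h ν c) (hb : b ∈ grading h ν d) :
    a * b ∈ grading h ν (c + d) := by
  have : grading h ν c * grading h ν d ≤ grading h ν (c + d) := by
    rw [grading, grading, Submodule.span_mul_span]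
    apply Submodule.span_mono
    rintro _ ⟨_, ⟨w, rfl, rfl⟩, _, ⟨w', rfl, rfl⟩, rfl⟩
    exact ⟨w ++ w', by simp, by simp⟩
  exact this (Submodule.mul_mem_mul ha hb)

theorem gen_mem_grading (g : Gen ν) : gen h ν g ∈ grading h ν (g.deg h) :=
  Submodule.subset_span ⟨[g], by simp, by simp⟩

/-- The properties of `1_i` that are needed for the well-definedness of the character map. -/
theorem parIdem_mem_and_mul_self (l : ParSeq h ν) :
    parIdem l ∈ grading h ν 0 ∧ parIdem l * parIdem l = parIdem l := by
  obtain ⟨E, hE⟩ : ∃ E, E = e h ν l.toSeq := ⟨_, rfl⟩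
  obtain ⟨ms, hms⟩ : ∃ ms, ms = l.1.map fun p => p.1.2 := ⟨_, rfl⟩
  have hP : parIdem l = blockIdem (T h ν) 0 ms * E := by rw [hE, hms, parIdem]
  have hEE : E * E = E := by rw [hE, e_mul_self]
  have hEdeg : E ∈ grading h ν 0 := by rw [hE]; exact gen_mem_grading (Gen.e l.toSeq)
  have hTE : ∀ k, InBlock 0 ms k → T h ν k * E = E * T h ν k := by
    intro k hk
    obtain ⟨hk', h1, -⟩ := l.inBlock (hms ▸ hk)
    rw [hE, T_mul_e k hk', ← e_mul_T, Seq.swap_eq_self h1]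
  have hTdeg : ∀ k, InBlock 0 ms k → T h ν k * E ∈ grading h ν 0 := by
    intro k hk
    obtain ⟨hk', h1, h2⟩ := l.inBlock (hms ▸ hk)
    rw [hE, T_mul_e k hk']
    have := gen_mem_grading (h := h) (Gen.τ k hk' l.toSeq)
    rwa [Gen.deg, ← h1, cartan, if_pos rfl, h2, show -(2 - 2 * ((1 : ℕ) : ℤ)) = 0 by norm_num]
      at this
  have hsq : ∀ k, InBlock 0 ms k → T h ν k * T h ν k * E = E := by
    intro k hk
    obtain ⟨hk', h1, h2⟩ := l.inBlock (hms ▸ hk)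
    have := rel_eq (Rel.τ_sq_imag (h := h) k hk' l.toSeq h1 (by rw [h2]; norm_num))
    rw [map_mul, map_mul, mk_ft, mk_fe, Hpoly, h2] at this
    simpa [mk_fe, ← hE] using this
  have hbr : ∀ k, InBlock 0 ms k → InBlock 0 ms (k + 1) →
      T h ν k * T h ν (k + 1) * T h ν k * E = T h ν (k + 1) * T h ν k * T h ν (k + 1) * E := by
    intro k hk hk1
    obtain ⟨hk', h1, h2⟩ := l.inBlock (hms ▸ hk)
    obtain ⟨hk1', -, -⟩ := l.inBlock (hms ▸ hk1)
    have := rel_eq (Rel.braid (h := h) k hk1' l.toSeq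
      (fun H => by rw [h2] at H; exact one_ne_zero H.2.2.1))
    simpa only [map_mul, mk_ft, mk_fe, ← hE] using this
  -- the elements of degree `0` with `E * Z = Z`
  let S : Submodule ℂ (R h ν) :=
    grading h ν 0 ⊓ LinearMap.eqLocus (LinearMap.mulLeft ℂ E) LinearMap.id
  have memS : ∀ {Z}, Z ∈ S ↔ Z ∈ grading h ν 0 ∧ E * Z = Z := Iff.rfl
  have hS : ∀ k, InBlock 0 ms k → ∀ Z ∈ S, T h ν k * Z ∈ S := by
    intro k hk Z hZ
    have hZ' := memS.1 hZ
    refine memS.2 ⟨?_, ?_⟩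
    · rw [← hZ'.2, ← mul_assoc]
      simpa using grading_mul (hTdeg k hk) hZ'.1
    · rw [← mul_assoc, ← hTE k hk, mul_assoc, hZ'.2]
  have hES : E ∈ S := memS.2 ⟨hEdeg, hEE⟩
  have hB : blockIdem (T h ν) 0 ms * E ∈ S := blockIdem_mem S hS hES
  rw [hP]
  refine ⟨(memS.1 hB).1, ?_⟩
  rw [mul_assoc, (memS.1 hB).2]
  refine blockIdem_eigen (blockIdem_fix S T_comm hS ?_ ?_ hES)
  · intro k hk Z hZ
    rw [← (memS.1 hZ).2, ← mul_assoc, ← mul_assoc, hsq k hk]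
  · intro k hk hk1 Z hZ
    rw [← (memS.1 hZ).2]
    simp only [← mul_assoc]
    rw [hbr k hk hk1]

end ParIdem

/-! ### Graded modules, Grothendieck group, characters -/

/-- A finite-dimensional graded `R(ν)`-module. -/
structure GrMod {I : Type u} [Finite I] (h : I → I → ℕ) (ν : I →₀ ℕ) where
  carrier : Type w
  [addCommGroup : AddCommGroup carrier]
  [moduleC : Module ℂ carrier]
  [moduleR : Module (R h ν) carrier]
  [isScalarTower : IsScalarTower ℂ (R h ν) carrier]
  [finite : Module.Finite ℂ carrier]
  /-- The homogeneous components. -/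
  gr : ℤ → Submodule ℂ carrier
  isInternal : DirectSum.IsInternal gr
  smul_mem : ∀ (d n : ℤ), ∀ r ∈ grading h ν d, ∀ m ∈ gr n, r • m ∈ gr (d + n)

attribute [instance] GrMod.addCommGroup GrMod.moduleC GrMod.moduleR GrMod.isScalarTower
  GrMod.finite

namespace GrMod

variable {I : Type u} [Finite I] {h : I → I → ℕ} {ν : I →₀ ℕ}

/-- The shifted module `M{m}`, with `(M{m})_n = M_{n-m}`. -/
def shift (M : GrMod.{u, w} h ν) (m : ℤ) : GrMod.{u, w} h ν where
  carrier := M.carrier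
  gr n := M.gr (n - m)
  isInternal := by
    have hM := M.isInternal
    rw [DirectSum.isInternal_submodule_iff_iSupIndep_and_iSup_eq_top] at hM ⊢
    refine ⟨hM.1.comp (sub_left_injective (b := m)), ?_⟩
    rw [← hM.2]
    exact (Equiv.subRight m).iSup_comp (g := M.gr)
  smul_mem d n r hr x hx := by
    have := M.smul_mem d (n - m) r hr x hx
    rwa [← add_sub_assoc] at this

/-- Isomorphism of graded modules (by a degree-preserving map). -/
def Iso (M N : GrMod.{u, w} h ν) : Prop :=
  ∃ f : M.carrier ≃ₗ[R h ν] N.carrier, ∀ n x, x ∈ M.gr n ↔ f x ∈ N.gr n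

/-- A submodule is graded if it is the sum of its intersections with the homogeneous components. -/
def IsGraded (M : GrMod.{u, w} h ν) (N : Submodule (R h ν) M.carrier) : Prop :=
  N.restrictScalars ℂ = ⨆ n, N.restrictScalars ℂ ⊓ M.gr n

/-- gr-irreducible: non-zero, without graded submodules other than `0` and the whole module. -/
def IsGrIrreducible (M : GrMod.{u, w} h ν) : Prop :=
  Nontrivial M.carrier ∧ ∀ N : Submodule (R h ν) M.carrier, M.IsGraded N → N = ⊥ ∨ N = ⊤

/-- A short exact sequence `0 → M' → M → M'' → 0` with degree-preserving maps exists. -/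
def ShortExact (M' M M'' : GrMod.{u, w} h ν) : Prop :=
  ∃ (f : M'.carrier →ₗ[R h ν] M.carrier) (g : M.carrier →ₗ[R h ν] M''.carrier),
    (∀ n, ∀ x ∈ M'.gr n, f x ∈ M.gr n) ∧ (∀ n, ∀ x ∈ M.gr n, g x ∈ M''.gr n) ∧
    Function.Injective f ∧ Function.Exact f g ∧ Function.Surjective g

/-- The subspace `1_i M`, `i ∈ \underline{ν}`. -/
def idemSpace (M : GrMod.{u, w} h ν) (i : ParSeq h ν) : Submodule ℂ M.carrier :=
  LinearMap.range (Algebra.lsmul ℂ ℂ M.carrier (parIdem i))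

/-- The graded dimension `∑_n dim(V ∩ M_n) q^n` of a graded subspace `V` of `M`. -/
def gdim (M : GrMod.{u, w} h ν) (V : Submodule ℂ M.carrier) : ℤ[T;T⁻¹] :=
  ∑ᶠ n : ℤ, LaurentPolynomial.C (Module.finrank ℂ ↥(V ⊓ M.gr n) : ℤ) * LaurentPolynomial.T n

/-- The coefficients of the character `Ch M = ∑_i Dim(1_i M) i`. -/
def char (M : GrMod.{u, w} h ν) (i : ParSeq h ν) : ℤ[T;T⁻¹] := M.gdim (M.idemSpace i)

end GrMod

section Facts

variable {I : Type u} [Finite I] {h : I → I → ℕ} {ν : I →₀ ℕ}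

theorem parIdem_smul_mem (M : GrMod.{u, w} h ν) (i : ParSeq h ν) {n : ℤ} {x : M.carrier}
    (hx : x ∈ M.gr n) : parIdem i • x ∈ M.gr n := by
  simpa using M.smul_mem 0 n _ (parIdem_mem_and_mul_self i).1 x hx

theorem mem_idemSpace (M : GrMod.{u, w} h ν) (i : ParSeq h ν) {x : M.carrier} :
    x ∈ M.idemSpace i ↔ parIdem i • x = x := by
  constructor
  · rintro ⟨y, rfl⟩
    change parIdem i • (parIdem i • y) = parIdem i • y
    rw [smul_smul, (parIdem_mem_and_mul_self i).2]
  · intro hx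
    exact ⟨x, hx⟩

theorem finite_support (M : GrMod.{u, w} h ν) (V : Submodule ℂ M.carrier) :
    (Function.support fun n : ℤ => LaurentPolynomial.C (Module.finrank ℂ ↥(V ⊓ M.gr n) : ℤ) *
      LaurentPolynomial.T n).Finite := by
  have hind := M.isInternal.submodule_iSupIndep
  refine (WellFoundedGT.finite_ne_bot_of_iSupIndep hind).subset fun n hn => ?_
  intro hbot
  apply hn
  simp only []
  rw [hbot, inf_bot_eq, finrank_bot]
  simp

/-- Degree-preserving maps commute with the projections to the homogeneous components. -/
theorem exists_component {M N : GrMod.{u, w} h ν} (g : M.carrier →ₗ[R h ν] N.carrier)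
    (hg : ∀ n, ∀ x ∈ M.gr n, g x ∈ N.gr n) (n : ℤ) (x : M.carrier) (hx : g x ∈ N.gr n) :
    ∃ y ∈ M.gr n, g y = g x := by
  classical
  let _ := M.isInternal.chooseDecomposition
  let _ := N.isInternal.chooseDecomposition
  refine ⟨DirectSum.decompose M.gr x n, SetLike.coe_mem _, ?_⟩
  have key : ∀ (z : M.carrier) (m : ℤ),
      (DirectSum.decompose N.gr (g z) m : N.carrier) = g (DirectSum.decompose M.gr z m) := by
    intro z m
    induction z using DirectSum.Decomposition.inductionOn M.gr with
    | zero => simp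
    | @homogeneous d z =>
      by_cases hdm : d = m
      · subst hdm
        rw [DirectSum.decompose_of_mem_same _ (hg _ _ z.2), DirectSum.decompose_coe,
          DirectSum.of_eq_same]
      · rw [DirectSum.decompose_of_mem_ne _ (hg _ _ z.2) hdm,
          DirectSum.decompose_of_mem_ne _ z.2 hdm, map_zero]
    | add a b ha hb => simp [map_add, DirectSum.decompose_add, ha, hb]
  rw [← key, DirectSum.decompose_of_mem_same _ hx]

theorem char_add {M' M M'' : GrMod.{u, w} h ν} (H : M'.ShortExact M M'') :
    M.char = M'.char + M''.char := by
  obtain ⟨f, g, hf, hg, hinj, hex, hsurj⟩ := H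
  funext i
  have key : ∀ n : ℤ, Module.finrank ℂ ↥(M.idemSpace i ⊓ M.gr n) =
      Module.finrank ℂ ↥(M'.idemSpace i ⊓ M'.gr n) +
        Module.finrank ℂ ↥(M''.idemSpace i ⊓ M''.gr n) := by
    intro n
    let f' : ↥(M'.idemSpace i ⊓ M'.gr n) →ₗ[ℂ] ↥(M.idemSpace i ⊓ M.gr n) :=
      (f.restrictScalars ℂ).restrict fun x hx => by
        refine ⟨(mem_idemSpace M i).2 ?_, hf n x hx.2⟩
        change parIdem i • f x = f x
        rw [← map_smul, (mem_idemSpace M' i).1 hx.1]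
    let g' : ↥(M.idemSpace i ⊓ M.gr n) →ₗ[ℂ] ↥(M''.idemSpace i ⊓ M''.gr n) :=
      (g.restrictScalars ℂ).restrict fun x hx => by
        refine ⟨(mem_idemSpace M'' i).2 ?_, hg n x hx.2⟩
        change parIdem i • g x = g x
        rw [← map_smul, (mem_idemSpace M i).1 hx.1]
    have hf' : Function.Injective f' := fun x y hxy =>
      Subtype.ext (hinj (congrArg Subtype.val hxy))
    have hg' : Function.Surjective g' := by
      rintro ⟨y, hy1, hy2⟩
      obtain ⟨x, rfl⟩ := hsurj y
      obtain ⟨z, hz, hzx⟩ := exists_component g hg n x hy2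
      refine ⟨⟨parIdem i • z, ⟨z, rfl⟩, parIdem_smul_mem M i hz⟩, Subtype.ext ?_⟩
      change g (parIdem i • z) = g x
      rw [map_smul, hzx, (mem_idemSpace M'' i).1 hy1]
    have hfg : LinearMap.range f' = LinearMap.ker g' := by
      apply le_antisymm
      · rintro _ ⟨x, rfl⟩
        exact Subtype.ext (hex.apply_apply_eq_zero x.1)
      · rintro ⟨x, hx1, hx2⟩ hx
        obtain ⟨y, rfl⟩ := (hex x).1 (congrArg Subtype.val hx)
        obtain ⟨z, hz, hzy⟩ := exists_component f hf n y hx2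
        refine ⟨⟨parIdem i • z, ⟨z, rfl⟩, parIdem_smul_mem M' i hz⟩, Subtype.ext ?_⟩
        change f (parIdem i • z) = f y
        rw [map_smul, hzy, (mem_idemSpace M i).1 hx1]
    have h1 := LinearMap.finrank_range_add_finrank_ker g'
    rw [LinearMap.range_eq_top.2 hg', finrank_top, ← hfg, LinearMap.finrank_range_of_inj hf'] at h1
    omega
  rw [Pi.add_apply, GrMod.char, GrMod.char, GrMod.char, GrMod.gdim, GrMod.gdim, GrMod.gdim,
    ← finsum_add_distrib (finite_support _ _) (finite_support _ _)]
  refine finsum_congr fun n => ?_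
  rw [key n, Nat.cast_add, map_add, add_mul]

theorem char_shift (M : GrMod.{u, w} h ν) :
    (M.shift 1).char = (LaurentPolynomial.T 1 : ℤ[T;T⁻¹]) • M.char := by
  funext i
  rw [Pi.smul_apply, smul_eq_mul, GrMod.char, GrMod.char, GrMod.gdim, GrMod.gdim,
    ← finsum_comp_equiv (Equiv.addRight (1 : ℤ)), mul_finsum' _ _ (finite_support _ _)]
  refine finsum_congr fun n => ?_
  have : (M.shift 1).gr (n + 1) = M.gr n := congrArg M.gr (add_sub_cancel_right n 1)
  rw [Equiv.coe_addRight, LaurentPolynomial.T_add, this]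
  change LaurentPolynomial.C (Module.finrank ℂ ↥(M.idemSpace i ⊓ M.gr n) : ℤ) * _ = _
  ring

end Facts

section Grothendieck

variable {I : Type u} [Finite I] (h : I → I → ℕ) (ν : I →₀ ℕ)

/-- The relations `[M] = [M'] + [M'']` for short exact sequences and `[M{1}] = q [M]`. -/
def G0rel : Submodule ℤ[T;T⁻¹] (GrMod.{u, w} h ν →₀ ℤ[T;T⁻¹]) :=
  Submodule.span ℤ[T;T⁻¹]
    ({x | ∃ M' M M'' : GrMod.{u, w} h ν, M'.ShortExact M M'' ∧
        x = Finsupp.single M 1 - Finsupp.single M' 1 - Finsupp.single M'' 1} ∪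
     {x | ∃ M : GrMod.{u, w} h ν,
        x = Finsupp.single (M.shift 1) 1 - Finsupp.single M (LaurentPolynomial.T 1)})

/-- The Grothendieck group `G₀(R(ν))` of the finite-dimensional graded `R(ν)`-modules, as a
`ℤ[q,q⁻¹]`-module with `q [M] = [M{1}]`. -/
def G0 : Type _ := (GrMod.{u, w} h ν →₀ ℤ[T;T⁻¹]) ⧸ G0rel.{u, w} h ν

instance : AddCommGroup (G0.{u, w} h ν) :=
  inferInstanceAs (AddCommGroup ((GrMod.{u, w} h ν →₀ ℤ[T;T⁻¹]) ⧸ G0rel.{u, w} h ν))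

instance : Module ℤ[T;T⁻¹] (G0.{u, w} h ν) :=
  inferInstanceAs (Module ℤ[T;T⁻¹] ((GrMod.{u, w} h ν →₀ ℤ[T;T⁻¹]) ⧸ G0rel.{u, w} h ν))

/-- The class `[M]`. -/
def cls {h : I → I → ℕ} {ν : I →₀ ℕ} (M : GrMod.{u, w} h ν) : G0.{u, w} h ν :=
  Submodule.Quotient.mk (Finsupp.single M 1)

theorem G0rel_le : G0rel.{u, w} h ν ≤
    LinearMap.ker (Finsupp.linearCombination ℤ[T;T⁻¹] (GrMod.char (h := h) (ν := ν))) := by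
  rw [G0rel, Submodule.span_le]
  rintro _ (⟨M', M, M'', H, rfl⟩ | ⟨M, rfl⟩)
  · simp [char_add H]
  · simp [char_shift M]

/-- The character map `Ch : G₀(R(ν)) → ℤ[q,q⁻¹]\underline{ν}` with `[M] ↦ Ch M`. -/
def ch : G0.{u, w} h ν →ₗ[ℤ[T;T⁻¹]] (ParSeq h ν → ℤ[T;T⁻¹]) :=
  (G0rel.{u, w} h ν).liftQ (Finsupp.linearCombination ℤ[T;T⁻¹] GrMod.char) (G0rel_le h ν)

/-- `ℤ[q,q⁻¹] ⊆ ℚ(q)`. -/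
instance algebraRatFunc : Algebra ℤ[T;T⁻¹] (RatFunc ℚ) :=
  (LaurentPolynomial.eval₂ (Int.castRingHom (RatFunc ℚ))
    (Units.mk0 RatFunc.X RatFunc.X_ne_zero)).toAlgebra

/-- The character map `Ch : G₀(R(ν))_{ℚ(q)} → ℚ(q)\underline{ν}`, where
`G₀(R(ν))_{ℚ(q)} = ℚ(q) ⊗_{ℤ[q,q⁻¹]} G₀(R(ν))`. As `\underline{ν}` is a finite set, the free
module on it is the module of all functions on it. -/
def chQ : (RatFunc ℚ ⊗[ℤ[T;T⁻¹]] G0.{u, w} h ν) →ₗ[RatFunc ℚ] (ParSeq h ν → RatFunc ℚ) :=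
  LinearMap.liftBaseChange (RatFunc ℚ)
    ((Algebra.linearMap ℤ[T;T⁻¹] (RatFunc ℚ)).compLeft (ParSeq h ν) ∘ₗ ch.{u, w} h ν)

end Grothendieck

end KLR

end

noncomputable section

namespace KLR

/-! ### Words in the adjacent transpositions -/

section Words

variable {Z : List ℕ → Prop}

/-! The coefficients of a character are the graded traces of the idempotents `1_i`, and the graded
trace of a module is a twisted trace: `φ(ab) = q^d φ(ba)` for `a` of degree `d`. Two facts carry the
theorem. (A) A twisted trace that vanishes on all `1_i`, `i ∈ \underline{ν}`, is zero
(`IsTwistedTrace.eq_zero`). (B) The graded traces of gr-irreducible modules, pairwise non-isomorphic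
up to shift, are linearly independent (`GrMod.eq_zero_of_sum_gradedTrace`). A relation between
characters, cleared of denominators, is a combination of graded traces that vanishes on all `1_i`;
by (A) it vanishes on `R(ν)`, by (B) its coefficients are zero. As the classes of gr-irreducible
modules span the Grothendieck group, injectivity follows.

For (A), filter `R(ν)` by the number of crossings. Modulo fewer crossings the `τ_k` satisfy `τ_k² =
0`, far commutation and the braid relation, and they permute the `x_j`; the trace property adds
rotation of words. The combinatorics of `word_induction` then leaves the elements `τ_u x^l 1_i` with
`u` increasing. If the monomial `x^l` is non-trivial, carrying it around `τ_u` until the permutation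
of `u` has restored it multiplies the value by a positive power of `q`, so the value is zero. If
`x^l = 1` and `u` moves `i`, orthogonality of idempotents gives zero. If `u` fixes `i`, each of its
letters exchanges two equal entries. When one of these entries `c` is not in `I⁰`, the crossings of
colour `c` form a factor of non-zero degree that commutes with the rest, and again the value is
zero. When all are in `I⁰`, the crossings have degree `0` and obey the relations of the symmetric
group exactly. The sequence is cut into blocks whose inner positions are the letters of `u`. The
corresponding symmetrizer expands into words on which the trace is either `0` or its value at `τ_u`,
and a Coxeter word occurs, so vanishing on `1_i` forces vanishing at `τ_u`.

For (B), the homogeneous components of a gr-irreducible module are zero or simple over the degree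
zero part of `R(ν)`, and a non-zero map between two of them extends to an isomorphism of the modules
up to shift. The density theorem then isolates a single component. -/

theorem word_comm_letter
    (comm : ∀ u v k l, k + 1 < l → (Z (u ++ k :: l :: v) ↔ Z (u ++ l :: k :: v)))
    (u v t : List ℕ) (k : ℕ) (hk : ∀ y ∈ t, k + 1 < y) :
    Z (u ++ k :: (t ++ v)) ↔ Z (u ++ (t ++ k :: v)) := by
  induction t generalizing u with
  | nil => rfl
  | cons y t ih =>
    rw [List.cons_append, comm _ _ _ _ (hk y (by simp))]
    have := ih (u ++ [y]) fun z hz => hk z (by simp [hz])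
    simpa using this

theorem word_comm_block
    (comm : ∀ u v k l, k + 1 < l → (Z (u ++ k :: l :: v) ↔ Z (u ++ l :: k :: v)))
    (u v b t : List ℕ) (hb : ∀ x ∈ b, ∀ y ∈ t, x + 1 < y) :
    Z (u ++ (b ++ (t ++ v))) ↔ Z (u ++ (t ++ (b ++ v))) := by
  induction b generalizing u with
  | nil => rfl
  | cons x b ih =>
    have h1 := ih (u ++ [x]) fun z hz => hb z (by simp [hz])
    have h2 := word_comm_letter comm u (b ++ v) t x (hb x (by simp))
    simp only [List.append_assoc, List.cons_append, List.nil_append] at h1 h2 ⊢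
    rw [h1, h2]

/-- Modulo far commutation, braid moves and words containing a square, a word in the letters
`0, …, J` contains the letter `J` at most once. -/
theorem word_top_letter
    (comm : ∀ u v k l, k + 1 < l → (Z (u ++ k :: l :: v) ↔ Z (u ++ l :: k :: v)))
    (braid : ∀ u v k, Z (u ++ k :: (k + 1) :: k :: v) ↔ Z (u ++ (k + 1) :: k :: (k + 1) :: v))
    (sq : ∀ u v k, Z (u ++ k :: k :: v)) (J : ℕ) :
    ∀ (u v y : List ℕ), (∀ x ∈ y, x < J + 1) →
      (∀ a b : List ℕ, (∀ x ∈ a, x < J) → (∀ x ∈ b, x < J) → Z (u ++ (a ++ J :: (b ++ v)))) →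
      (∀ a : List ℕ, (∀ x ∈ a, x < J) → Z (u ++ (a ++ v))) → Z (u ++ (y ++ v)) := by
  induction J with
  | zero =>
    intro u v y hy h1 h0
    match y, hy with
    | [], _ => exact h0 [] (by simp)
    | [x], hy =>
      obtain rfl : x = 0 := by simpa using hy x
      exact h1 [] [] (by simp) (by simp)
    | x :: x' :: y, hy =>
      obtain rfl : x = 0 := by simpa using hy x
      obtain rfl : x' = 0 := by simpa using hy x'
      exact sq _ _ _
  | succ J ih =>
    intro u v y
    obtain ⟨n, hn⟩ : ∃ n, n = y.count (J + 1) := ⟨_, rfl⟩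
    induction n using Nat.strong_induction_on generalizing y with
    | _ n ihn =>
      intro hy h1 h0
      have small : ∀ {l : List ℕ}, (∀ x ∈ l, x < J + 1 + 1) → J + 1 ∉ l → ∀ x ∈ l, x < J + 1 := by
        intro l h h' x hx
        have := h x hx
        have : x ≠ J + 1 := fun H => h' (H ▸ hx)
        omega
      by_cases hm : J + 1 ∈ y
      swap
      · exact h0 y (small hy hm)
      obtain ⟨a, c, rfl, ha⟩ := List.eq_append_cons_of_mem hm
      by_cases hm' : J + 1 ∈ c
      swap
      · have := h1 a c (small (fun x hx => hy x (by simp [hx])) ha)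
          (small (fun x hx => hy x (by simp [hx])) hm')
        simpa using this
      obtain ⟨b, c, rfl, hb⟩ := List.eq_append_cons_of_mem hm'
      -- Here `b` lies between the first two occurrences of `J + 1`, and by the induction on `J` it
      -- may be taken to contain `J` at most once. All smaller letters commute with `J + 1`. With
      -- one `J`, the pattern `J+1, J, J+1` becomes `J, J+1, J`, which lowers the count; with none,
      -- a square appears.
      have key := ih (u ++ (a ++ [J + 1])) ((J + 1) :: (c ++ v)) b
        (small (fun x hx => hy x (by simp [hx])) hb) ?_ ?_
      · simpa using key
      · intro b1 b2 hb1 hb2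
        have e2 := word_comm_block comm (u ++ a) (J :: (J + 1) :: (b2 ++ (c ++ v))) b1 [J + 1]
          (by simpa using hb1)
        have e3 := word_comm_block comm (u ++ (a ++ ((J + 1) :: (b1 ++ [J])))) (c ++ v) b2 [J + 1]
          (by simpa using hb2)
        have e4 := braid (u ++ (a ++ b1)) (b2 ++ (c ++ v)) J
        have e5 := ihn _ ?_ (a ++ (b1 ++ (J :: (J + 1) :: J :: (b2 ++ c)))) rfl ?_ h1 h0
        · simp only [List.append_assoc, List.cons_append, List.nil_append] at e2 e3 e4 e5 ⊢
          rw [e3, ← e2, ← e4]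
          exact e5
        · have z1 : List.count (J + 1) b1 = 0 :=
            List.count_eq_zero.2 fun H => by have := hb1 _ H; omega
          have z2 : List.count (J + 1) b2 = 0 :=
            List.count_eq_zero.2 fun H => by have := hb2 _ H; omega
          rw [hn]
          simp [List.count_append, z1, z2]
        · intro x hx
          simp only [List.mem_append, List.mem_cons] at hx
          rcases hx with hx | hx | hx | hx | hx | hx | hx
          · exact hy x (by simp [hx])
          · have := hb1 x hx; omega
          · omega
          · omega
          · omega
          · have := hb2 x hx; omega
          · exact hy x (by simp [hx])
      · intro b1 hb1
        have e3 := word_comm_block comm (u ++ (a ++ [J + 1])) (c ++ v) b1 [J + 1]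
          (by simpa using hb1)
        have e4 := sq (u ++ a) (b1 ++ (c ++ v)) (J + 1)
        simp only [List.append_assoc, List.cons_append, List.nil_append] at e3 e4 ⊢
        rw [e3]
        exact e4

/-- A property of words that is invariant under cyclic rotation, far commutation and braid moves
holds for all words if it holds for those containing a square and for the increasing ones. -/
theorem word_induction
    (rot : ∀ u k, Z (u ++ [k]) → Z (k :: u))
    (comm : ∀ u v k l, k + 1 < l → (Z (u ++ k :: l :: v) ↔ Z (u ++ l :: k :: v)))
    (braid : ∀ u v k, Z (u ++ k :: (k + 1) :: k :: v) ↔ Z (u ++ (k + 1) :: k :: (k + 1) :: v))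
    (sq : ∀ u v k, Z (u ++ k :: k :: v))
    (sorted : ∀ u : List ℕ, u.Pairwise (· < ·) → Z u) (y : List ℕ) : Z y := by
  have rot' : ∀ c b, Z (b ++ c) → Z (c ++ b) := by
    intro c
    induction c using List.reverseRecOn with
    | nil => intro b hb; simpa using hb
    | append_singleton c k ih =>
      intro b hb
      have := ih (k :: b) (rot _ _ (by simpa using hb))
      simpa using this
  -- The increasing tail `t` is the part already sorted; lowering `J` moves the letters of `y` into
  -- it one at a time, from the largest down.
  have main : ∀ (J : ℕ) (y t : List ℕ), (∀ x ∈ y, x < J) → (∀ x ∈ t, J ≤ x) →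
      t.Pairwise (· < ·) → Z (y ++ t) := by
    intro J
    induction J with
    | zero =>
      intro y t hy ht hs
      match y, hy with
      | [], _ => exact sorted t hs
      | x :: y, hy => exact absurd (hy x (by simp)) (by omega)
    | succ J ih =>
      intro y t hy ht hs
      refine word_top_letter comm braid sq J [] t y hy ?_ ?_
      · intro a b ha hb
        -- In `a J b t` every letter of `b` is at most `J - 1` and every letter of `t` at least `J +
        -- 1`. Hence `b` moves to the right end and is rotated to the front, which makes `J :: t`
        -- the new tail.
        have e := word_comm_block comm (a ++ [J]) [] b t fun x hx y hy => by
          have := hb x hx; have := ht y hy; omega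
        have e' := rot' (a ++ J :: t) b (by
          have := ih (b ++ a) (J :: t) ?_ ?_ ?_
          · simpa using this
          · intro x hx
            rcases List.mem_append.1 hx with hx | hx
            exacts [hb x hx, ha x hx]
          · intro x hx
            rcases List.mem_cons.1 hx with rfl | hx
            · exact le_rfl
            · have := ht x hx; omega
          · exact List.pairwise_cons.2 ⟨fun x hx => ht x hx, hs⟩)
        simp only [List.append_assoc, List.cons_append, List.nil_append, List.append_nil] at e e' ⊢
        exact e.2 e'
      · intro a ha
        exact ih a t ha (fun x hx => by have := ht x hx; omega) hs
  obtain ⟨J, hJ⟩ : ∃ J, ∀ x ∈ y, x < J :=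
    ⟨y.sum + 1, fun x hx => Nat.lt_succ_of_le (List.single_le_sum (by simp) x hx)⟩
  simpa using main J y [] hJ (by simp) List.Pairwise.nil

end Words

/-! ### The filtration of `R(ν)` by the number of crossings -/

section Prelim

variable {I : Type*} {h : I → I → ℕ} (ν : I →₀ ℕ)

/-- The adjacent transposition exchanging the positions `k` and `k + 1`. -/
def adjSwap (k : ℕ) : Equiv.Perm (Fin ν.degree) :=
  if hk : k + 1 < ν.degree then Equiv.swap ⟨k, by omega⟩ ⟨k + 1, hk⟩ else 1

/-- The permutation of the positions given by a word. -/
def wordPerm (ν : I →₀ ℕ) (u : List ℕ) : Equiv.Perm (Fin ν.degree) := (u.map (adjSwap ν)).prod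

variable {ν}

theorem adjSwap_adjSwap (k : ℕ) (j : Fin ν.degree) : adjSwap ν k (adjSwap ν k j) = j := by
  unfold adjSwap
  split_ifs
  · exact Equiv.swap_apply_self _ _ _
  · rfl

/-- The action of the adjacent transpositions on `Seq(ν)`. -/
def act (k : ℕ) (i : Seq ν) : Seq ν := if hk : k + 1 < ν.degree then i.swap k hk else i

theorem act_act (k : ℕ) (i : Seq ν) : act k (act k i) = i := by
  unfold act
  split_ifs
  · exact Seq.swap_swap _ _ _
  · rfl

theorem Hpoly_mem {A : Type*} [Ring A] [Algebra ℂ A] (P : Subalgebra ℂ A) (i : I) {x y : A}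
    (hx : x ∈ P) (hy : y ∈ P) : Hpoly h i x y ∈ P :=
  P.mul_mem (P.pow_mem (neg_mem P.one_mem) _) (P.pow_mem (P.sub_mem hx hy) _)

theorem Qpoly_mem {A : Type*} [Ring A] [Algebra ℂ A] (P : Subalgebra ℂ A) (i j : I) {x y : A}
    (hx : x ∈ P) (hy : y ∈ P) : Qpoly h i j x y ∈ P :=
  P.mul_mem (P.pow_mem (neg_mem P.one_mem) _) (P.pow_mem (P.sub_mem hx hy) _)

theorem Qquot_mem {A : Type*} [Ring A] [Algebra ℂ A] (P : Subalgebra ℂ A) (i j : I) {x y z : A}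
    (hx : x ∈ P) (hy : y ∈ P) (hz : z ∈ P) : Qquot h i j x y z ∈ P :=
  P.mul_mem (P.pow_mem (neg_mem P.one_mem) _) (P.sum_mem fun _ _ =>
    P.mul_mem (P.pow_mem (P.sub_mem hx hy) _) (P.pow_mem (P.sub_mem hz hy) _))

end Prelim

section Filtration

variable {I : Type*} [Finite I] (h : I → I → ℕ) (ν : I →₀ ℕ)

/-- `x_k = ∑_i x_{k,i}`. -/
def X (k : Fin ν.degree) : R h ν := mk h ν (fx k)

/-- The subalgebra generated by the `x_k` and the `1_i`. -/
def polySubalgebra : Subalgebra ℂ (R h ν) :=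
  Algebra.adjoin ℂ (Set.range (X h ν) ∪ Set.range (e h ν))

/-- The product of the `τ_k` along a word. -/
def Tw (u : List ℕ) : R h ν := (u.map (T h ν)).prod

/-- The monomial in the `x_k` given by a list of positions. -/
def Xw (l : List (Fin ν.degree)) : R h ν := (l.map (X h ν)).prod

/-- The span of the elements with less than `m` crossings. -/
def crossingFiltration (m : ℕ) : Submodule ℂ (R h ν) :=
  Submodule.span ℂ {r | ∃ u : List ℕ, u.length < m ∧ ∃ p ∈ polySubalgebra h ν, r = Tw h ν u * p}

variable {h ν}

theorem mk_fx (k : Fin ν.degree) : mk h ν (fx k) = X h ν k := rfl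

theorem X_mem (k : Fin ν.degree) : X h ν k ∈ polySubalgebra h ν :=
  Algebra.subset_adjoin (Or.inl ⟨k, rfl⟩)

theorem e_mem (i : Seq ν) : e h ν i ∈ polySubalgebra h ν :=
  Algebra.subset_adjoin (Or.inr ⟨i, rfl⟩)

theorem sum_e_eq_one : ∑ i : Seq ν, e h ν i = 1 := by
  have := rel_eq (Rel.sum_e (h := h) (ν := ν))
  simpa only [map_sum, mk_fe, map_one] using this

theorem eq_sum_mul_e (r : R h ν) : r = ∑ i : Seq ν, r * e h ν i := by
  rw [← Finset.mul_sum, sum_e_eq_one, mul_one]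

theorem mem_of_mul_e_mem {S : Submodule ℂ (R h ν)} {r : R h ν} (H : ∀ i, r * e h ν i ∈ S) :
    r ∈ S := by
  rw [eq_sum_mul_e r]
  exact S.sum_mem fun i _ => H i

theorem e_mul_genX (k : Fin ν.degree) (i : Seq ν) :
    e h ν i * gen h ν (Gen.x k i) = gen h ν (Gen.x k i) := by
  have := rel_eq (Rel.e_mul_x (h := h) k i)
  rwa [map_mul, mk_fe] at this

theorem genX_mul_e (k : Fin ν.degree) (i : Seq ν) :
    gen h ν (Gen.x k i) * e h ν i = gen h ν (Gen.x k i) := by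
  have := rel_eq (Rel.x_mul_e (h := h) k i)
  rwa [map_mul, mk_fe] at this

theorem X_eq_sum (k : Fin ν.degree) : X h ν k = ∑ i : Seq ν, gen h ν (Gen.x k i) := by
  rw [X, fx, map_sum]; rfl

theorem X_mul_e (k : Fin ν.degree) (i : Seq ν) : X h ν k * e h ν i = gen h ν (Gen.x k i) := by
  rw [X_eq_sum, Finset.sum_mul, Finset.sum_eq_single i, genX_mul_e]
  · intro j _ hj
    rw [← genX_mul_e, mul_assoc, e_mul_e hj, mul_zero]
  · intro hi; exact absurd (Finset.mem_univ _) hi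

theorem e_mul_X (k : Fin ν.degree) (i : Seq ν) : e h ν i * X h ν k = X h ν k * e h ν i := by
  rw [X_mul_e, X_eq_sum, Finset.mul_sum, Finset.sum_eq_single i, e_mul_genX]
  · intro j _ hj
    rw [← e_mul_genX, ← mul_assoc, e_mul_e hj.symm, zero_mul]
  · intro hi; exact absurd (Finset.mem_univ _) hi

theorem T_of_not_lt {k : ℕ} (hk : ¬ k + 1 < ν.degree) : T h ν k = 0 := dif_neg hk

/-- On `1_i` the difference is `0`, except when `k` exchanges two equal real entries and `j` is `k`
or `k + 1`; there it is `± 1_i`. Together with `T_mul_T_mem` and `T_braid_mem` this says that all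
error terms are free of crossings, so that modulo fewer crossings the relations become homogeneous.
-/
theorem T_mul_X_sub_mem (k : ℕ) (j : Fin ν.degree) :
    T h ν k * X h ν j - X h ν (adjSwap ν k j) * T h ν k ∈ polySubalgebra h ν := by
  by_cases hk : k + 1 < ν.degree
  swap
  · rw [T_of_not_lt hk]; simp
  rw [← Subalgebra.mem_toSubmodule]
  refine mem_of_mul_e_mem fun i => ?_
  rw [Subalgebra.mem_toSubmodule, adjSwap, dif_pos hk]
  by_cases hjk : j.1 = k
  · rw [show j = ⟨k, by omega⟩ from Fin.ext hjk, Equiv.swap_apply_left]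
    by_cases hr : i.1 ⟨k, by omega⟩ = i.1 ⟨k + 1, hk⟩ ∧ h (i.1 ⟨k, by omega⟩) (i.1 ⟨k, by omega⟩) = 0
    · have := rel_eq (Rel.τ_x_real (h := h) k hk i hr)
      simp only [map_mul, map_sub, mk_fe, mk_ft, mk_fx] at this
      rw [this]
      exact e_mem i
    · have := rel_eq (Rel.τ_x_slide (h := h) k hk i hr)
      simp only [map_mul, mk_fe, mk_ft, mk_fx] at this
      rw [sub_mul, this, sub_self]
      exact zero_mem _
  by_cases hjk' : j.1 = k + 1
  · rw [show j = ⟨k + 1, hk⟩ from Fin.ext hjk', Equiv.swap_apply_right]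
    by_cases hr : i.1 ⟨k, by omega⟩ = i.1 ⟨k + 1, hk⟩ ∧ h (i.1 ⟨k, by omega⟩) (i.1 ⟨k, by omega⟩) = 0
    · have := rel_eq (Rel.x_τ_real (h := h) k hk i hr)
      simp only [map_mul, map_sub, mk_fe, mk_ft, mk_fx] at this
      rw [← neg_sub, neg_mul, this]
      exact neg_mem (e_mem i)
    · have := rel_eq (Rel.x_τ_slide (h := h) k hk i hr)
      simp only [map_mul, mk_fe, mk_ft, mk_fx] at this
      rw [sub_mul, this, sub_self]
      exact zero_mem _
  · have := rel_eq (Rel.τ_x_comm (h := h) k hk j hjk hjk')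
    simp only [map_mul, mk_ft, mk_fx] at this
    rw [Equiv.swap_apply_of_ne_of_ne (fun H => hjk (congrArg Fin.val H))
      (fun H => hjk' (congrArg Fin.val H)), this, sub_self, zero_mul]
    exact zero_mem _

theorem T_mul_T_mem (k : ℕ) : T h ν k * T h ν k ∈ polySubalgebra h ν := by
  by_cases hk : k + 1 < ν.degree
  swap
  · rw [T_of_not_lt hk]; simp
  rw [← Subalgebra.mem_toSubmodule]
  refine mem_of_mul_e_mem fun i => ?_
  rw [Subalgebra.mem_toSubmodule]
  by_cases heq : i.1 ⟨k, by omega⟩ = i.1 ⟨k + 1, hk⟩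
  · by_cases hr : h (i.1 ⟨k, by omega⟩) (i.1 ⟨k, by omega⟩) = 0
    · have := rel_eq (Rel.τ_sq_real (h := h) k hk i heq hr)
      simp only [map_mul, mk_fe, mk_ft, map_zero] at this
      rw [this]
      exact zero_mem _
    · have := rel_eq (Rel.τ_sq_imag (h := h) k hk i heq hr)
      simp only [map_mul, mk_fe, mk_ft, Hpoly, map_pow, map_neg, map_one, map_sub, mk_fx] at this
      rw [this]
      exact mul_mem (Hpoly_mem _ _ (X_mem _) (X_mem _)) (e_mem i)
  · have := rel_eq (Rel.τ_sq_ne (h := h) k hk i heq)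
    simp only [map_mul, mk_fe, mk_ft, Qpoly, map_pow, map_neg, map_one, map_sub, mk_fx] at this
    rw [this]
    exact mul_mem (Qpoly_mem _ _ _ (X_mem _) (X_mem _)) (e_mem i)

theorem T_braid_mem (k : ℕ) : T h ν k * T h ν (k + 1) * T h ν k
    - T h ν (k + 1) * T h ν k * T h ν (k + 1) ∈ polySubalgebra h ν := by
  by_cases hk : k + 1 + 1 < ν.degree
  swap
  · rw [T_of_not_lt hk]; simp
  rw [← Subalgebra.mem_toSubmodule]
  refine mem_of_mul_e_mem fun i => ?_
  rw [Subalgebra.mem_toSubmodule]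
  by_cases hr : i.1 ⟨k, by omega⟩ = i.1 ⟨k + 2, hk⟩ ∧ i.1 ⟨k, by omega⟩ ≠ i.1 ⟨k + 1, by omega⟩ ∧
        h (i.1 ⟨k, by omega⟩) (i.1 ⟨k, by omega⟩) = 0 ∧
        cartan h (i.1 ⟨k, by omega⟩) (i.1 ⟨k + 1, by omega⟩) < 0
  · have := rel_eq (Rel.braid_real (h := h) k hk i hr)
    simp only [map_mul, mk_fe, mk_ft, Qquot, map_pow, map_neg, map_one, map_sub, map_sum,
      mk_fx] at this
    rw [this]
    exact mul_mem (Qquot_mem _ _ _ (X_mem _) (X_mem _) (X_mem _)) (e_mem i)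
  · have := rel_eq (Rel.braid (h := h) k hk i hr)
    simp only [map_mul, mk_fe, mk_ft] at this
    rw [sub_mul, this, sub_self]
    exact zero_mem _

theorem T_mul_e_eq (k : ℕ) (i : Seq ν) : T h ν k * e h ν i = e h ν (act k i) * T h ν k := by
  by_cases hk : k + 1 < ν.degree
  · rw [act, dif_pos hk, T_mul_e k hk, e_mul_T k hk]
  · rw [T_of_not_lt hk, zero_mul, mul_zero]

theorem e_mul_T_eq (k : ℕ) (i : Seq ν) : e h ν i * T h ν k = T h ν k * e h ν (act k i) := by
  rw [T_mul_e_eq, act_act]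

/-- The generators pass through `τ_k` up to a crossing-free term, and this property is stable under
sums and products. -/
theorem exists_mul_T {p : R h ν} (hp : p ∈ polySubalgebra h ν) (k : ℕ) :
    ∃ p' ∈ polySubalgebra h ν, ∃ p'' ∈ polySubalgebra h ν, p * T h ν k = T h ν k * p' + p'' := by
  induction hp using Algebra.adjoin_induction with
  | mem x hx =>
    rcases hx with ⟨j, rfl⟩ | ⟨i, rfl⟩
    · refine ⟨X h ν (adjSwap ν k j), X_mem _, _, neg_mem (T_mul_X_sub_mem k (adjSwap ν k j)), ?_⟩
      rw [adjSwap_adjSwap]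
      abel
    · exact ⟨_, e_mem (act k i), 0, zero_mem _, by rw [e_mul_T_eq, add_zero]⟩
  | algebraMap r =>
    exact ⟨_, Subalgebra.algebraMap_mem _ r, 0, zero_mem _, by
      rw [Algebra.commutes, add_zero]⟩
  | add x y _ _ hx hy =>
    obtain ⟨x', hx', x'', hx'', h1⟩ := hx
    obtain ⟨y', hy', y'', hy'', h2⟩ := hy
    refine ⟨_, add_mem hx' hy', _, add_mem hx'' hy'', ?_⟩
    rw [add_mul, h1, h2, mul_add]
    abel
  | mul x y hx _ hx0 hy0 =>
    obtain ⟨x', hx', x'', hx'', h1⟩ := hx0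
    obtain ⟨y', hy', y'', hy'', h2⟩ := hy0
    refine ⟨_, mul_mem hx' hy', _, add_mem (mul_mem hx'' hy') (mul_mem hx hy''), ?_⟩
    rw [mul_assoc, h2, mul_add, ← mul_assoc, h1, add_mul]
    simp only [mul_assoc]
    abel

theorem Tw_nil : Tw h ν [] = 1 := rfl

theorem Tw_cons (k : ℕ) (u : List ℕ) : Tw h ν (k :: u) = T h ν k * Tw h ν u := by simp [Tw]

theorem Tw_append (u v : List ℕ) : Tw h ν (u ++ v) = Tw h ν u * Tw h ν v := by simp [Tw]

theorem Tw_singleton (k : ℕ) : Tw h ν [k] = T h ν k := by simp [Tw]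

theorem Tw_mul_mem {m : ℕ} {u : List ℕ} (hu : u.length < m) {p : R h ν}
    (hp : p ∈ polySubalgebra h ν) : Tw h ν u * p ∈ crossingFiltration h ν m :=
  Submodule.subset_span ⟨u, hu, p, hp, rfl⟩

theorem crossingFiltration_mono : Monotone (crossingFiltration h ν) := fun m m' hm =>
  Submodule.span_mono fun _ ⟨u, hu, hr⟩ => ⟨u, by omega, hr⟩

theorem mem_crossingFiltration_of_mem {m : ℕ} {p : R h ν} (hp : p ∈ polySubalgebra h ν) :
    p ∈ crossingFiltration h ν (m + 1) := by
  simpa [Tw_nil] using Tw_mul_mem (u := []) (m := m + 1) (by simp) hp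

theorem crossingFiltration_mul {m : ℕ} {r p : R h ν} (hr : r ∈ crossingFiltration h ν m)
    (hp : p ∈ polySubalgebra h ν) : r * p ∈ crossingFiltration h ν m := by
  induction hr using Submodule.span_induction with
  | mem x hx =>
    obtain ⟨u, hu, q, hq, rfl⟩ := hx
    rw [mul_assoc]
    exact Tw_mul_mem hu (mul_mem hq hp)
  | zero => rw [zero_mul]; exact zero_mem _
  | add x y _ _ hx hy => rw [add_mul]; exact add_mem hx hy
  | smul c x _ hx => rw [smul_mul_assoc]; exact Submodule.smul_mem _ _ hx

theorem T_mul_crossingFiltration {m : ℕ} {r : R h ν} (k : ℕ)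
    (hr : r ∈ crossingFiltration h ν m) : T h ν k * r ∈ crossingFiltration h ν (m + 1) := by
  induction hr using Submodule.span_induction with
  | mem x hx =>
    obtain ⟨u, hu, q, hq, rfl⟩ := hx
    rw [← mul_assoc, ← Tw_cons]
    exact Tw_mul_mem (by simpa using hu) hq
  | zero => rw [mul_zero]; exact zero_mem _
  | add x y _ _ hx hy => rw [mul_add]; exact add_mem hx hy
  | smul c x _ hx => rw [mul_smul_comm]; exact Submodule.smul_mem _ _ hx

theorem Tw_mul_crossingFiltration {m : ℕ} {r : R h ν} (u : List ℕ)
    (hr : r ∈ crossingFiltration h ν m) :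
    Tw h ν u * r ∈ crossingFiltration h ν (m + u.length) := by
  induction u with
  | nil => simpa [Tw_nil] using hr
  | cons k u ih =>
    rw [Tw_cons, mul_assoc]
    exact T_mul_crossingFiltration k ih

/-- Passing `p` through each letter either keeps that crossing or loses it, so the number of
crossings never exceeds the length of `u`. The index is `u.length + 1` because the filtration is
defined by a strict inequality. -/
theorem mul_Tw_mem {p : R h ν} (hp : p ∈ polySubalgebra h ν) (u : List ℕ) :
    p * Tw h ν u ∈ crossingFiltration h ν (u.length + 1) := by
  induction u generalizing p with
  | nil => simpa [Tw_nil] using mem_crossingFiltration_of_mem (m := 0) hp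
  | cons k u ih =>
    obtain ⟨p', hp', p'', hp'', hpp⟩ := exists_mul_T hp k
    rw [Tw_cons, ← mul_assoc, hpp, add_mul, mul_assoc]
    exact add_mem (T_mul_crossingFiltration k (ih hp'))
      (crossingFiltration_mono (by simp) (ih hp''))

theorem mul_crossingFiltration {m : ℕ} {r p : R h ν} (hp : p ∈ polySubalgebra h ν)
    (hr : r ∈ crossingFiltration h ν m) : p * r ∈ crossingFiltration h ν m := by
  induction hr using Submodule.span_induction with
  | mem x hx =>
    obtain ⟨u, hu, q, hq, rfl⟩ := hx
    rw [← mul_assoc]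
    exact crossingFiltration_mul (crossingFiltration_mono hu (mul_Tw_mem hp u)) hq
  | zero => rw [mul_zero]; exact zero_mem _
  | add x y _ _ hx hy => rw [mul_add]; exact add_mem hx hy
  | smul c x _ hx => rw [mul_smul_comm]; exact Submodule.smul_mem _ _ hx

theorem mul_mem_crossingFiltration {m m' : ℕ} {r s : R h ν} (hr : r ∈ crossingFiltration h ν m)
    (hs : s ∈ crossingFiltration h ν m') : r * s ∈ crossingFiltration h ν (m' + m) := by
  induction hr using Submodule.span_induction with
  | mem x hx =>
    obtain ⟨u, hu, q, hq, rfl⟩ := hx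
    rw [mul_assoc]
    exact crossingFiltration_mono (by omega)
      (Tw_mul_crossingFiltration u (mul_crossingFiltration hq hs))
  | zero => rw [zero_mul]; exact zero_mem _
  | add x y _ _ hx hy => rw [add_mul]; exact add_mem hx hy
  | smul c x _ hx => rw [smul_mul_assoc]; exact Submodule.smul_mem _ _ hx

/-- `R(ν)` is generated by the `1_i`, `x_{k,i}`, `τ_{k,i}`. -/
theorem R_induction {C : R h ν → Prop} (algebraMap : ∀ c : ℂ, C (algebraMap ℂ _ c))
    (gen : ∀ g, C (gen h ν g)) (mul : ∀ a b, C a → C b → C (a * b))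
    (add : ∀ a b, C a → C b → C (a + b)) (r : R h ν) : C r := by
  obtain ⟨r, rfl⟩ := RingQuot.mkAlgHom_surjective ℂ (Rel h ν) r
  change C (mk h ν r)
  induction r using FreeAlgebra.induction with
  | grade0 c => rw [AlgHom.commutes]; exact algebraMap c
  | grade1 g => exact gen g
  | mul a b ha hb => rw [map_mul]; exact mul _ _ ha hb
  | add a b ha hb => rw [map_add]; exact add _ _ ha hb

/-- The filtration is exhaustive, so a functional that kills each of its steps is zero. -/
theorem exists_mem_crossingFiltration (r : R h ν) : ∃ m, r ∈ crossingFiltration h ν m := by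
  induction r using R_induction with
  | algebraMap c => exact ⟨1, mem_crossingFiltration_of_mem (Subalgebra.algebraMap_mem _ c)⟩
  | gen g =>
    cases g with
    | e i => exact ⟨1, mem_crossingFiltration_of_mem (e_mem i)⟩
    | x k i =>
      rw [← X_mul_e]
      exact ⟨1, mem_crossingFiltration_of_mem (mul_mem (X_mem k) (e_mem i))⟩
    | τ k hk i =>
      rw [← T_mul_e, ← Tw_singleton]
      exact ⟨2, Tw_mul_mem (by simp) (e_mem i)⟩
  | mul a b ha hb =>
    obtain ⟨m, ha⟩ := ha
    obtain ⟨m', hb⟩ := hb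
    exact ⟨_, mul_mem_crossingFiltration ha hb⟩
  | add a b ha hb =>
    obtain ⟨m, ha⟩ := ha
    obtain ⟨m', hb⟩ := hb
    exact ⟨max m m', add_mem (crossingFiltration_mono (le_max_left _ _) ha)
      (crossingFiltration_mono (le_max_right _ _) hb)⟩

/-! ### Monomials in the `x_k`, and degrees -/

theorem Xw_nil : Xw h ν [] = 1 := rfl

theorem Xw_cons (k : Fin ν.degree) (l : List (Fin ν.degree)) :
    Xw h ν (k :: l) = X h ν k * Xw h ν l := by simp [Xw]

theorem Xw_mem (l : List (Fin ν.degree)) : Xw h ν l ∈ polySubalgebra h ν := by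
  induction l with
  | nil => exact one_mem _
  | cons k l ih => rw [Xw_cons]; exact mul_mem (X_mem k) ih

theorem e_mul_Xw (i : Seq ν) (l : List (Fin ν.degree)) :
    e h ν i * Xw h ν l = Xw h ν l * e h ν i := by
  induction l with
  | nil => rw [Xw_nil, mul_one, one_mul]
  | cons k l ih => rw [Xw_cons, ← mul_assoc, e_mul_X, mul_assoc, ih, mul_assoc]

theorem mem_span_Xw {p : R h ν} (hp : p ∈ polySubalgebra h ν) :
    p ∈ Submodule.span ℂ {r | ∃ l i, r = Xw h ν l * e h ν i} := by
  -- It suffices that left multiplication by `p` preserves the span, since `p` is the sum of the `p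
  -- 1_i` and each `1_i` lies in the span.
  suffices H : ∀ s ∈ Submodule.span ℂ {r | ∃ l i, r = Xw h ν l * e h ν i},
      p * s ∈ Submodule.span ℂ {r | ∃ l i, r = Xw h ν l * e h ν i} by
    rw [eq_sum_mul_e p]
    exact Submodule.sum_mem _ fun i _ =>
      H _ (Submodule.subset_span ⟨[], i, by rw [Xw_nil, one_mul]⟩)
  induction hp using Algebra.adjoin_induction with
  | mem x hx =>
    intro s hs
    induction hs using Submodule.span_induction with
    | mem s hs =>
      obtain ⟨l, i, rfl⟩ := hs
      rcases hx with ⟨k, rfl⟩ | ⟨j, rfl⟩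
      · exact Submodule.subset_span ⟨k :: l, i, by rw [Xw_cons, mul_assoc]⟩
      · rw [← mul_assoc, e_mul_Xw, mul_assoc]
        by_cases hij : j = i
        · rw [hij, e_mul_self]
          exact Submodule.subset_span ⟨l, i, rfl⟩
        · rw [e_mul_e hij, mul_zero]
          exact zero_mem _
    | zero => rw [mul_zero]; exact zero_mem _
    | add x y _ _ hx hy => rw [mul_add]; exact add_mem hx hy
    | smul c x _ hx => rw [mul_smul_comm]; exact Submodule.smul_mem _ _ hx
  | algebraMap c =>
    intro s hs
    rw [← Algebra.smul_def]
    exact Submodule.smul_mem _ _ hs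
  | add x y _ _ hx hy =>
    intro s hs
    rw [add_mul]
    exact add_mem (hx s hs) (hy s hs)
  | mul x y _ _ hx hy =>
    intro s hs
    rw [mul_assoc]
    exact hx _ (hy s hs)

theorem T_mul_Xw_sub_mem (k : ℕ) (l : List (Fin ν.degree)) :
    T h ν k * Xw h ν l - Xw h ν (l.map (adjSwap ν k)) * T h ν k ∈ polySubalgebra h ν := by
  induction l with
  | nil => rw [List.map_nil, Xw_nil, mul_one, one_mul, sub_self]; exact zero_mem _
  | cons j l ih =>
    rw [List.map_cons, Xw_cons, Xw_cons]
    have : T h ν k * (X h ν j * Xw h ν l) -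
        X h ν (adjSwap ν k j) * Xw h ν (l.map (adjSwap ν k)) * T h ν k =
        (T h ν k * X h ν j - X h ν (adjSwap ν k j) * T h ν k) * Xw h ν l +
        X h ν (adjSwap ν k j) *
          (T h ν k * Xw h ν l - Xw h ν (l.map (adjSwap ν k)) * T h ν k) := by
      noncomm_ring
    rw [this]
    exact add_mem (mul_mem (T_mul_X_sub_mem k j) (Xw_mem l)) (mul_mem (X_mem _) ih)

/-- Letter by letter, a crossing moves the dots to the exchanged strands, and each correction costs
at least one crossing. Hence the error lies strictly below `τ_u` in the filtration. -/
theorem Tw_mul_Xw_sub_mem (u : List ℕ) (l : List (Fin ν.degree)) :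
    Tw h ν u * Xw h ν l - Xw h ν (l.map (wordPerm ν u)) * Tw h ν u ∈
      crossingFiltration h ν u.length := by
  induction u with
  | nil =>
    have : l.map (wordPerm ν []) = l := by simp [wordPerm]
    rw [this, Tw_nil, mul_one, one_mul, sub_self]; exact zero_mem _
  | cons k u ih =>
    have hl : l.map (wordPerm ν (k :: u)) = (l.map (wordPerm ν u)).map (adjSwap ν k) := by
      simp [wordPerm]
    rw [hl, Tw_cons]
    obtain ⟨l', hl'⟩ : ∃ l', l' = l.map (wordPerm ν u) := ⟨_, rfl⟩
    rw [← hl'] at ih ⊢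
    have : T h ν k * Tw h ν u * Xw h ν l - Xw h ν (l'.map (adjSwap ν k)) * (T h ν k * Tw h ν u) =
        T h ν k * (Tw h ν u * Xw h ν l - Xw h ν l' * Tw h ν u) +
        (T h ν k * Xw h ν l' - Xw h ν (l'.map (adjSwap ν k)) * T h ν k) * Tw h ν u := by
      noncomm_ring
    rw [this]
    exact add_mem (T_mul_crossingFiltration k ih) (mul_Tw_mem (T_mul_Xw_sub_mem k l') u)

theorem Tw_mul_e (u : List ℕ) (i : Seq ν) :
    Tw h ν u * e h ν i = e h ν (u.foldr act i) * Tw h ν u := by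
  induction u with
  | nil => rw [Tw_nil, one_mul, mul_one]; rfl
  | cons k u ih =>
    rw [Tw_cons, mul_assoc, ih, ← mul_assoc, T_mul_e_eq, mul_assoc]; rfl

theorem X_mem_grading (k : Fin ν.degree) : X h ν k ∈ grading h ν 2 := by
  rw [X_eq_sum]
  exact Submodule.sum_mem _ fun i _ => gen_mem_grading (Gen.x k i)

theorem one_mem_grading : (1 : R h ν) ∈ grading h ν 0 := Submodule.subset_span ⟨[], by simp, by simp⟩

theorem e_mem_grading (i : Seq ν) : e h ν i ∈ grading h ν 0 := gen_mem_grading (Gen.e i)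

theorem Xw_mem_grading (l : List (Fin ν.degree)) : Xw h ν l ∈ grading h ν (2 * l.length) := by
  induction l with
  | nil => simpa [Xw_nil] using one_mem_grading (h := h) (ν := ν)
  | cons k l ih =>
    rw [Xw_cons]
    have := grading_mul (X_mem_grading (h := h) k) ih
    convert this using 2
    push_cast [List.length_cons]
    ring

/-- Only spanning is required below: the modules carry their own direct sum decompositions, so the
sum here need not be known to be direct. -/
theorem iSup_grading : ⨆ d, grading h ν d = ⊤ := by
  suffices H : ∀ r, r ∈ ⨆ d, grading h ν d from eq_top_iff.2 fun r _ => H r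
  intro r
  induction r using R_induction with
  | algebraMap c =>
    rw [Algebra.algebraMap_eq_smul_one]
    exact Submodule.smul_mem _ _ (Submodule.mem_iSup_of_mem 0 one_mem_grading)
  | gen g => exact Submodule.mem_iSup_of_mem _ (gen_mem_grading g)
  | mul a b ha hb =>
    induction ha using Submodule.iSup_induction' with
    | mem c a ha =>
      induction hb using Submodule.iSup_induction' with
      | mem d b hb => exact Submodule.mem_iSup_of_mem _ (grading_mul ha hb)
      | zero => rw [mul_zero]; exact zero_mem _
      | add x y _ _ hx hy => rw [mul_add]; exact add_mem hx hy
    | zero => rw [zero_mul]; exact zero_mem _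
    | add x y _ _ hx hy => rw [add_mul]; exact add_mem hx hy
  | add a b ha hb => exact add_mem ha hb

end Filtration

/-! ### Sequences fixed by words, and blocks -/

section Blocks

variable {I : Type*} {h : I → I → ℕ} {ν : I →₀ ℕ}

theorem act_eq_self_iff {k : ℕ} (hk : k + 1 < ν.degree) {i : Seq ν} :
    act k i = i ↔ i.1 ⟨k, by omega⟩ = i.1 ⟨k + 1, hk⟩ := by
  rw [act, dif_pos hk]
  refine ⟨fun H => ?_, Seq.swap_eq_self⟩
  have := congrFun (congrArg Subtype.val H) ⟨k + 1, hk⟩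
  simpa [Seq.swap] using this

theorem foldr_act_apply_of_lt (u : List ℕ) (i : Seq ν) (k : Fin ν.degree)
    (hu : ∀ x ∈ u, k.1 < x) : (u.foldr act i).1 k = i.1 k := by
  induction u with
  | nil => rfl
  | cons y u ih =>
    rw [List.foldr_cons, ← ih fun x hx => hu x (by simp [hx])]
    have hy := hu y (by simp)
    unfold act
    split_ifs with hk
    · have h1 : k ≠ ⟨y, by omega⟩ := fun H => by simp [H] at hy
      have h2 : k ≠ ⟨y + 1, hk⟩ := fun H => by simp [H] at hy
      simp [Seq.swap, Equiv.swap_apply_of_ne_of_ne h1 h2]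
    · rfl

/-- The first letter `k` acts last, and the remaining letters exceed `k`, so they leave position `k`
untouched. Then `k` moves the entry `i_k` to position `k + 1`, and invariance gives `i_k = i_{k+1}`.
For words that are not increasing this fails. -/
theorem act_eq_self_of_foldr {u : List ℕ} (hu : u.Pairwise (· < ·)) {i : Seq ν}
    (hi : u.foldr act i = i) : ∀ k ∈ u, act k i = i := by
  induction u with
  | nil => intro k hk; simp at hk
  | cons k u ih =>
    rw [List.pairwise_cons] at hu
    rw [List.foldr_cons] at hi
    have hk : act k i = i := by
      by_cases hk : k + 1 < ν.degree
      · rw [act_eq_self_iff hk, ← foldr_act_apply_of_lt u i ⟨k, by omega⟩ hu.1]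
        have := congrFun (congrArg Subtype.val hi) ⟨k + 1, hk⟩
        rw [← this, act, dif_pos hk]
        simp [Seq.swap]
      · rw [act, dif_neg hk]
    have hi' : u.foldr act i = i := by
      rw [← act_act k (u.foldr act i), hi, hk]
    intro x hx
    rcases List.mem_cons.1 hx with rfl | hx
    exacts [hk, ih hu.2 hi' x hx]

theorem foldr_act_eq_self {u : List ℕ} {i : Seq ν} (hu : ∀ k ∈ u, act k i = i) :
    u.foldr act i = i := by
  induction u with
  | nil => rfl
  | cons k u ih =>
    rw [List.foldr_cons, ih fun k hk => hu k (by simp [hk]), hu k (by simp)]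

/-- A list of vertices, cut into blocks in such a way that `k` and `k + 1` lie in the same block
if and only if `k ∈ K`. -/
theorem exists_blocks (K : ℕ → Prop) (cs : List I) (a : ℕ)
    (hK : ∀ k, K k → a ≤ k → ∃ j, h j j = 1 ∧ cs[k - a]? = some j ∧ cs[k + 1 - a]? = some j) :
    ∃ l : List (ParIndex h), expand l = cs ∧
      ∀ k, InBlock a (l.map fun p => p.1.2) k ↔ K k ∧ a ≤ k := by
  induction cs generalizing a with
  | nil =>
    refine ⟨[], rfl, fun k => ⟨fun H => H.elim, fun ⟨h1, h2⟩ => ?_⟩⟩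
    obtain ⟨j, -, hj, -⟩ := hK k h1 h2
    simp at hj
  | cons x xs ih =>
    obtain ⟨l, hl, hlK⟩ := ih (a + 1) fun k h1 h2 => by
      obtain ⟨j, hj, hj1, hj2⟩ := hK k h1 (by omega)
      refine ⟨j, hj, ?_, ?_⟩
      · rwa [show k - a = (k - (a + 1)) + 1 by omega, List.getElem?_cons_succ] at hj1
      · rwa [show k + 1 - a = (k + 1 - (a + 1)) + 1 by omega, List.getElem?_cons_succ] at hj2
    by_cases ha : K a
    · obtain ⟨j, hj, hj1, hj2⟩ := hK a ha le_rfl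
      rw [Nat.sub_self, List.getElem?_cons_zero, Option.some_inj] at hj1
      rw [Nat.add_sub_cancel_left, List.getElem?_cons_succ] at hj2
      subst hj1
      match l, hl, hlK with
      | [], hl, _ =>
        rw [← hl] at hj2
        simp [expand] at hj2
      | ⟨⟨y, m⟩, hm, hm'⟩ :: l, hl, hlK =>
        simp only at hm hm'
        have hy : y = x := by
          obtain ⟨m', rfl⟩ : ∃ m', m = m' + 1 := ⟨m - 1, by omega⟩
          rw [← hl] at hj2
          simpa [expand, List.replicate_succ] using hj2
        subst hy
        -- When `K a` holds, the first block of the tail starts with the same vertex, which is in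
        -- `I⁰`, so that block can be lengthened by one. Otherwise the head becomes a block of
        -- length `1`.
        refine ⟨⟨⟨y, m + 1⟩, by simp, fun H => absurd hj H⟩ :: l, ?_, fun k => ?_⟩
        · rw [← hl]
          simp [expand, List.replicate_succ]
        · have := hlK k
          simp only [List.map_cons, InBlock] at this ⊢
          rw [show a + (m + 1) = a + 1 + m by omega]
          constructor
          · rintro (⟨h1, h2⟩ | h1)
            · rcases Nat.eq_or_lt_of_le h1 with rfl | h3
              · exact ⟨ha, le_rfl⟩
              · have := this.1 (Or.inl ⟨h3, h2⟩)
                exact ⟨this.1, by omega⟩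
            · have := this.1 (Or.inr h1)
              exact ⟨this.1, by omega⟩
          · rintro ⟨h1, h2⟩
            rcases Nat.eq_or_lt_of_le h2 with rfl | h3
            · exact Or.inl ⟨le_rfl, by omega⟩
            · rcases this.2 ⟨h1, h3⟩ with h4 | h4
              · exact Or.inl ⟨h2, h4.2⟩
              · exact Or.inr h4
    · refine ⟨⟨⟨x, 1⟩, by simp, fun _ => rfl⟩ :: l, ?_, fun k => ?_⟩
      · rw [← hl]
        simp [expand]
      · have := hlK k
        simp only [List.map_cons, InBlock]
        rw [this]
        constructor
        · rintro (⟨h1, h2⟩ | ⟨h1, h2⟩)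
          · omega
          · exact ⟨h1, by omega⟩
        · rintro ⟨h1, h2⟩
          refine Or.inr ⟨h1, ?_⟩
          rcases Nat.eq_or_lt_of_le h2 with rfl | h3
          · exact absurd h1 ha
          · exact h3

/-- Neighbouring blocks may have the same vertex, so a run of an entry from `I⁰` can be cut
anywhere. For `K` the set of letters of a word, the symmetrizer involves exactly these letters. -/
theorem exists_parSeq (K : ℕ → Prop) (i : Seq ν)
    (hK : ∀ k, K k → ∃ hk : k + 1 < ν.degree, i.1 ⟨k, by omega⟩ = i.1 ⟨k + 1, hk⟩ ∧
      h (i.1 ⟨k, by omega⟩) (i.1 ⟨k, by omega⟩) = 1) :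
    ∃ l : ParSeq h ν, l.toSeq = i ∧ ∀ k, InBlock 0 (l.1.map fun p => p.1.2) k ↔ K k := by
  obtain ⟨l, hl, hlK⟩ := exists_blocks (h := h) K (List.ofFn i.1) 0 fun k hk _ => by
    obtain ⟨hk', h1, h2⟩ := hK k hk
    refine ⟨_, h2, ?_, ?_⟩
    · simp [show k < ν.degree by omega]
    · simp [hk', h1]
  refine ⟨⟨l, ?_⟩, ?_, fun k => by rw [hlK]; simp⟩
  · rw [hl, List.map_ofFn, List.sum_ofFn]
    exact i.2
  · apply Subtype.ext
    funext k
    simp [ParSeq.toSeq, hl]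

theorem act_eq_self_of_imag
    {K : ℕ → Prop} {i : Seq ν}
    (hK : ∀ k, K k → ∃ hk : k + 1 < ν.degree, i.1 ⟨k, by omega⟩ = i.1 ⟨k + 1, hk⟩ ∧
      h (i.1 ⟨k, by omega⟩) (i.1 ⟨k, by omega⟩) = 1) {u : List ℕ} (hu : ∀ x ∈ u, K x) :
    ∀ x ∈ u, act x i = i := fun x hx => by
  obtain ⟨hk, h1, -⟩ := hK x (hu x hx)
  exact (act_eq_self_iff hk).2 h1

end Blocks

/-! ### Expansion of the symmetrizers into words -/

section Expansion

variable {A : Type*} [Ring A] [Algebra ℂ A] {t : ℕ → A}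

/-- `z` is a non-zero multiple of a sum of products of the `t_k` along words with letters in `K`,
one of which contains each letter in `D` exactly once and no other letters. -/
def IsWordSum (t : ℕ → A) (K D : ℕ → Prop) (z : A) : Prop :=
  ∃ c : ℂ, c ≠ 0 ∧ ∃ L : List (List ℕ), (∀ u ∈ L, ∀ x ∈ u, K x) ∧
    (∃ u ∈ L, u.Nodup ∧ ∀ x, x ∈ u ↔ D x) ∧ z = c • (L.map fun u => (u.map t).prod).sum

theorem IsWordSum.one (K : ℕ → Prop) {D : ℕ → Prop} (hD : ∀ x, ¬ D x) : IsWordSum t K D 1 :=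
  ⟨1, one_ne_zero, [[]], by simp, ⟨[], by simp, by simp, by simpa using hD⟩, by simp⟩

theorem IsWordSum.mul {K D D' E : ℕ → Prop} {z z' : A} (hz : IsWordSum t K D z)
    (hz' : IsWordSum t K D' z') (hdisj : ∀ x, D x → ¬ D' x) (hE : ∀ x, E x ↔ D x ∨ D' x) :
    IsWordSum t K E (z * z') := by
  obtain ⟨c, hc, L, hL, ⟨u, hu, hun, huD⟩, rfl⟩ := hz
  obtain ⟨c', hc', L', hL', ⟨u', hu', hun', huD'⟩, rfl⟩ := hz'
  refine ⟨c * c', mul_ne_zero hc hc', L.flatMap fun u => L'.map fun u' => u ++ u', ?_,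
    ⟨u ++ u', ?_, ?_, ?_⟩, ?_⟩
  · intro v hv x hx
    simp only [List.mem_flatMap, List.mem_map] at hv
    obtain ⟨v1, hv1, v2, hv2, rfl⟩ := hv
    rcases List.mem_append.1 hx with hx | hx
    exacts [hL _ hv1 _ hx, hL' _ hv2 _ hx]
  · simp only [List.mem_flatMap, List.mem_map]
    exact ⟨u, hu, u', hu', rfl⟩
  · rw [List.nodup_append]
    refine ⟨hun, hun', fun a ha b hb hab => ?_⟩
    exact hdisj a ((huD a).1 ha) ((huD' a).1 (hab ▸ hb))
  · intro x
    rw [List.mem_append, huD, huD', hE]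
  · rw [smul_mul_smul_comm]
    congr 1
    clear hL hu
    induction L with
    | nil => simp
    | cons v L ih =>
      rw [List.flatMap_cons, List.map_append, List.sum_append, ← ih, List.map_cons, List.sum_cons,
        add_mul, List.map_map, ← List.sum_map_mul_left]
      simp [Function.comp_def]

theorem IsWordSum.smul {K D : ℕ → Prop} {z : A} (hz : IsWordSum t K D z) {c : ℂ} (hc : c ≠ 0) :
    IsWordSum t K D (c • z) := by
  obtain ⟨c', hc', L, hL, hu, rfl⟩ := hz
  exact ⟨c * c', mul_ne_zero hc hc', L, hL, hu, by rw [smul_smul]⟩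

theorem isWordSum_cosetSum {K D : ℕ → Prop} {a r : ℕ} (hK : ∀ k, a ≤ k → k < a + r → K k)
    (hD : ∀ x, D x ↔ a ≤ x ∧ x + 1 = a + r) : IsWordSum t K D (cosetSum t a r) := by
  refine ⟨1, one_ne_zero, (List.range (r + 1)).map fun j => List.range' (a + j) (r - j), ?_, ?_, ?_⟩
  · intro u hu x hx
    simp only [List.mem_map, List.mem_range] at hu
    obtain ⟨j, hj, rfl⟩ := hu
    rw [List.mem_range'_1] at hx
    exact hK x (by omega) (by omega)
  -- The summand `j = r - 1` is the single letter `a + r - 1`. For `r = 0` truncated subtraction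
  -- makes it the empty word, as required by an empty `D`.
  · refine ⟨List.range' (a + (r - 1)) (r - (r - 1)), List.mem_map.2 ⟨r - 1, by simp, rfl⟩,
      List.nodup_range', fun x => ?_⟩
    rw [List.mem_range'_1, hD]
    omega
  · rw [one_smul, cosetSum, List.map_map, ← List.toFinset_range, List.sum_toFinset _ List.nodup_range]
    rfl

/-- Taking the one-letter summand from every coset sum yields a Coxeter word of the symmetric group,
with each letter used once. -/
theorem isWordSum_symSum {K D : ℕ → Prop} {a m : ℕ} (hK : ∀ k, a ≤ k → k + 1 < a + m → K k)
    (hD : ∀ x, D x ↔ a ≤ x ∧ x + 1 < a + m) : IsWordSum t K D (symSum t a m) := by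
  induction m generalizing D with
  | zero => exact IsWordSum.one K fun x hx => by have := (hD x).1 hx; omega
  | succ r ih =>
    refine IsWordSum.mul (isWordSum_cosetSum (fun k h1 h2 => hK k h1 (by omega)) fun _ => Iff.rfl)
      (ih (fun k h1 h2 => hK k h1 (by omega)) fun _ => Iff.rfl) (fun x => by omega) fun x => ?_
    rw [hD]
    omega

theorem isWordSum_blockIdem {K D : ℕ → Prop} {a : ℕ} {l : List ℕ} (hK : ∀ k, InBlock a l k → K k)
    (hD : ∀ x, D x ↔ InBlock a l x) : IsWordSum t K D (blockIdem t a l) := by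
  induction l generalizing a D with
  | nil => exact IsWordSum.one K fun x hx => (hD x).1 hx
  | cons m l ih =>
    refine IsWordSum.mul (IsWordSum.smul (isWordSum_symSum (fun k h1 h2 => hK k (Or.inl ⟨h1, h2⟩))
      fun _ => Iff.rfl) (inv_ne_zero (by exact_mod_cast m.factorial_ne_zero)))
      (ih (fun k hk => hK k (Or.inr hk)) fun _ => Iff.rfl) (fun x hx hx' => ?_) hD
    have := hx'.le
    omega

end Expansion

/-! ### Twisted traces -/

section TwistedTrace

variable {I : Type*} [Finite I] {h : I → I → ℕ} {ν : I →₀ ℕ}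

/-- A linear functional `φ` on `R(ν)` with values in `ℂ[q,q⁻¹]` such that `φ(ab) = q^d φ(ba)` for
`a` homogeneous of degree `d`. -/
def IsTwistedTrace (φ : R h ν →ₗ[ℂ] ℂ[T;T⁻¹]) : Prop :=
  ∀ d, ∀ a ∈ grading h ν d, ∀ b, φ (a * b) = LaurentPolynomial.T d * φ (b * a)

/-- The Laurent polynomials form a domain and `1 - q^d` is not zero. The vanishing arguments for
twisted traces end here: cyclic motion returns the same element with a factor `q^d`. -/
theorem eq_zero_of_eq_T_mul {d : ℤ} (hd : d ≠ 0) {f : ℂ[T;T⁻¹]}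
    (hf : f = LaurentPolynomial.T d * f) : f = 0 := by
  have h1 : (1 - LaurentPolynomial.T d) * f = 0 := by rw [sub_mul, one_mul, ← hf, sub_self]
  rcases mul_eq_zero.1 h1 with h2 | h2
  · exfalso
    rw [sub_eq_zero] at h2
    have h3 := congrArg (fun g : ℂ[T;T⁻¹] => g.coeff 0) h2
    rw [← LaurentPolynomial.T_zero] at h3
    simp [LaurentPolynomial.T_apply, hd] at h3
  · exact h2

variable {φ : R h ν →ₗ[ℂ] ℂ[T;T⁻¹]}

/-- The pieces `τ_k 1_i` are homogeneous, so the trace property moves each of them behind `p`.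
Commuting it back in front of `p` replaces `p` by another polynomial and costs a term with fewer
crossings, which `φ` kills. -/
theorem IsTwistedTrace.rotate (hφ : IsTwistedTrace φ) {m : ℕ}
    (hF : ∀ r ∈ crossingFiltration h ν m, φ r = 0) {u : List ℕ} {k : ℕ} (hu : u.length < m)
    (H : ∀ p ∈ polySubalgebra h ν, φ (Tw h ν (u ++ [k]) * p) = 0) {p : R h ν}
    (hp : p ∈ polySubalgebra h ν) : φ (Tw h ν (k :: u) * p) = 0 := by
  by_cases hk : k + 1 < ν.degree
  swap
  · rw [Tw_cons, T_of_not_lt hk, zero_mul, zero_mul, map_zero]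
  rw [Tw_cons, mul_assoc, eq_sum_mul_e (T h ν k), Finset.sum_mul, map_sum]
  refine Finset.sum_eq_zero fun i _ => ?_
  rw [T_mul_e k hk, hφ _ _ (gen_mem_grading _), ← T_mul_e k hk]
  obtain ⟨p', hp', p'', hp'', hpp⟩ := exists_mul_T hp k
  have : Tw h ν u * p * (T h ν k * e h ν i) =
      Tw h ν (u ++ [k]) * (p' * e h ν i) + Tw h ν u * (p'' * e h ν i) := by
    rw [Tw_append, Tw_singleton, mul_assoc, ← mul_assoc p, hpp, add_mul, mul_add]
    simp only [mul_assoc]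
  rw [this, map_add, H _ (mul_mem hp' (e_mem i)),
    hF _ (Tw_mul_mem hu (mul_mem hp'' (e_mem i))), add_zero, mul_zero]

/-- Push the monomial through `τ_u` to the left, modulo fewer crossings, and bring it back by the
trace property. It returns with its positions permuted by `u` and with the factor `q` to the power
of its positive degree. -/
theorem IsTwistedTrace.apply_Xw (hφ : IsTwistedTrace φ) {u : List ℕ}
    (hF : ∀ r ∈ crossingFiltration h ν u.length, φ r = 0) (l : List (Fin ν.degree)) (hl : l ≠ [])
    (i : Seq ν) : φ (Tw h ν u * (Xw h ν l * e h ν i)) = 0 := by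
  have step : ∀ l, φ (Tw h ν u * (Xw h ν l * e h ν i)) = LaurentPolynomial.T (2 * l.length) *
      φ (Tw h ν u * (Xw h ν (l.map (wordPerm ν u)) * e h ν i)) := by
    intro l
    have h1 := hF _ (crossingFiltration_mul (Tw_mul_Xw_sub_mem u l) (e_mem i))
    rw [sub_mul, map_sub, sub_eq_zero, mul_assoc, mul_assoc] at h1
    rw [h1, hφ _ _ (Xw_mem_grading _), mul_assoc, e_mul_Xw, List.length_map]
  have iter : ∀ N : ℕ, φ (Tw h ν u * (Xw h ν l * e h ν i)) =
      LaurentPolynomial.T (2 * l.length * N) *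
        φ (Tw h ν u * (Xw h ν (l.map (wordPerm ν u ^ N)) * e h ν i)) := by
    intro N
    induction N with
    | zero => simp
    | succ N ih =>
      rw [ih, step, List.length_map, ← mul_assoc, ← LaurentPolynomial.T_add, List.map_map,
        ← Equiv.Perm.coe_mul, ← pow_succ']
      congr 2
  -- After as many turns as the order of the permutation, the monomial itself returns.
  have := iter (orderOf (wordPerm ν u))
  rw [pow_orderOf_eq_one, Equiv.Perm.coe_one, List.map_id] at this
  refine eq_zero_of_eq_T_mul ?_ this
  have h1 : 0 < l.length := List.length_pos_iff.2 hl
  have h2 := orderOf_pos (wordPerm ν u)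
  positivity

theorem Tw_eq_filter_mul (p : ℕ → Prop) [DecidablePred p] (u : List ℕ)
    (H : ∀ x ∈ u, ∀ y ∈ u, p x → ¬ p y → Commute (T h ν x) (T h ν y)) :
    Tw h ν u = Tw h ν (u.filter p) * Tw h ν (u.filter fun x => ¬ p x) := by
  induction u with
  | nil => simp [Tw_nil]
  | cons k u ih =>
    have ih' := ih fun x hx y hy => H x (by simp [hx]) y (by simp [hy])
    by_cases hk : p k
    · simp only [List.filter_cons, hk, decide_true, if_true, not_true, decide_false, Tw_cons]
      rw [mul_assoc, ih']
      rfl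
    · simp only [List.filter_cons, hk, decide_true, if_true, not_false_iff, decide_false, Tw_cons]
      have hc : Commute (Tw h ν (u.filter p)) (T h ν k) := by
        refine Commute.list_prod_left _ _ fun x hx => ?_
        simp only [List.mem_map, List.mem_filter, decide_eq_true_eq] at hx
        obtain ⟨x, ⟨hx, hpx⟩, rfl⟩ := hx
        exact H x (by simp [hx]) k (by simp) hpx hk
      simp only [Bool.false_eq_true, if_false]
      rw [ih', ← mul_assoc, ← hc.eq, mul_assoc]

theorem T_commute_of_ne {x y : ℕ} (h1 : x + 1 ≠ y) (h2 : y + 1 ≠ x) :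
    Commute (T h ν x) (T h ν y) := by
  rcases lt_trichotomy x y with H | rfl | H
  · exact T_comm x y (by omega)
  · exact Commute.refl _
  · exact (T_comm y x (by omega)).symm

theorem Tw_commute {u v : List ℕ} (H : ∀ x ∈ u, ∀ y ∈ v, Commute (T h ν x) (T h ν y)) :
    Commute (Tw h ν u) (Tw h ν v) := by
  refine Commute.list_prod_left _ _ fun a ha => Commute.list_prod_right _ _ fun b hb => ?_
  obtain ⟨x, hx, rfl⟩ := List.mem_map.1 ha
  obtain ⟨y, hy, rfl⟩ := List.mem_map.1 hb
  exact H x hx y hy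

theorem Tw_mul_e_of_act {u : List ℕ} {i : Seq ν} (hu : ∀ k ∈ u, act k i = i) :
    Tw h ν u * e h ν i = e h ν i * Tw h ν u := by
  rw [Tw_mul_e, foldr_act_eq_self hu]

/-- All letters exchange entries equal to `c`, so the sequence never changes and each crossing
contributes `-a_cc`. -/
theorem Tw_mul_e_mem_grading {u : List ℕ} {i : Seq ν} {c : I}
    (hu : ∀ k ∈ u, ∃ hk : k + 1 < ν.degree, i.1 ⟨k, by omega⟩ = c ∧ i.1 ⟨k + 1, hk⟩ = c) :
    Tw h ν u * e h ν i ∈ grading h ν (-(u.length * cartan h c c)) := by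
  induction u with
  | nil => simpa [Tw_nil] using e_mem_grading (h := h) i
  | cons k u ih =>
    have hact : ∀ k ∈ u, act k i = i := fun k hk => by
      obtain ⟨hk', h1, h2⟩ := hu k (by simp [hk])
      exact (act_eq_self_iff hk').2 (h1.trans h2.symm)
    obtain ⟨hk, h1, h2⟩ := hu k (by simp)
    have h3 := grading_mul (gen_mem_grading (h := h) (Gen.τ k hk i)) (ih fun k hk => hu k (by simp [hk]))
    rw [← T_mul_e, Gen.deg, h1, h2, Tw_mul_e_of_act hact, mul_assoc, ← mul_assoc (e h ν i),
      e_mul_self, ← Tw_mul_e_of_act hact, ← mul_assoc, ← Tw_cons] at h3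
    convert h3 using 2
    push_cast [List.length_cons]
    ring

/-- If not all letters of the word `u` exchange two equal entries from `I⁰`, the trace vanishes. -/
theorem IsTwistedTrace.apply_Tw_of_ne_one (hφ : IsTwistedTrace φ) {u : List ℕ} {i : Seq ν}
    (hact : ∀ k ∈ u, act k i = i) {k : ℕ} (hku : k ∈ u) (hk : k + 1 < ν.degree)
    (hne : h (i.1 ⟨k, by omega⟩) (i.1 ⟨k, by omega⟩) ≠ 1) : φ (Tw h ν u * e h ν i) = 0 := by
  classical
  by_cases hlt : ∀ k ∈ u, k + 1 < ν.degree
  swap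
  · push Not at hlt
    obtain ⟨x, hx, hx'⟩ := hlt
    have : Tw h ν u = 0 := List.prod_eq_zero (List.mem_map.2 ⟨x, hx, T_of_not_lt (by omega)⟩)
    rw [this, zero_mul, map_zero]
  obtain ⟨c, hc⟩ : ∃ c, c = i.1 ⟨k, by omega⟩ := ⟨_, rfl⟩
  -- Since every letter of `u` exchanges equal entries, `p` agrees at `x` and `x + 1` for each
  -- letter `x`. Hence a letter of colour `c` is never adjacent to one of another colour, and `τ_u`
  -- factors into commuting parts.
  let p : ℕ → Prop := fun x => ∃ hx : x < ν.degree, i.1 ⟨x, hx⟩ = c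
  have hp : ∀ x ∈ u, p x ↔ p (x + 1) := by
    intro x hx
    have hx' := hlt x hx
    have := (act_eq_self_iff hx').1 (hact x hx)
    exact ⟨fun ⟨h1, h2⟩ => ⟨hx', this ▸ h2⟩, fun ⟨h1, h2⟩ => ⟨by omega, this ▸ h2⟩⟩
  have hcomm : ∀ x ∈ u, ∀ y ∈ u, p x → ¬ p y → Commute (T h ν x) (T h ν y) := by
    intro x hx y hy hpx hpy
    refine T_commute_of_ne ?_ ?_
    · rintro rfl
      exact hpy ((hp x hx).1 hpx)
    · rintro rfl
      exact hpy ((hp y hy).2 hpx)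
  obtain ⟨v, hv⟩ : ∃ v, v = u.filter p := ⟨_, rfl⟩
  obtain ⟨v', hv'⟩ : ∃ v', v' = u.filter fun x => ¬ p x := ⟨_, rfl⟩
  have hmv : ∀ x ∈ v, x ∈ u ∧ p x := fun x hx => by simpa [hv, List.mem_filter] using hx
  have hmv' : ∀ x ∈ v', x ∈ u ∧ ¬ p x := fun x hx => by simpa [hv', List.mem_filter] using hx
  have hfac : Tw h ν u = Tw h ν v * Tw h ν v' := by rw [hv, hv']; exact Tw_eq_filter_mul p u hcomm
  have hvv : Commute (Tw h ν v) (Tw h ν v') := Tw_commute fun x hx y hy =>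
    hcomm x (hmv x hx).1 y (hmv' y hy).1 (hmv x hx).2 (hmv' y hy).2
  have hdeg := Tw_mul_e_mem_grading (h := h) (u := v) (i := i) (c := c) fun x hx => by
    obtain ⟨h1, h2⟩ := hmv x hx
    exact ⟨hlt x h1, h2.2, ((hp x h1).1 h2).2⟩
  have e1 := Tw_mul_e_of_act (h := h) fun x hx => hact x (hmv x hx).1
  have e2 := Tw_mul_e_of_act (h := h) fun x hx => hact x (hmv' x hx).1
  -- The colour `c` part has this degree, which is non-zero: `v` contains `k`, and `a_cc = 2 - 2
  -- h_c` vanishes only for `h_c = 1`. Exchanging the two commuting factors inside the trace then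
  -- gives `f = q^d f`.
  refine eq_zero_of_eq_T_mul (d := -(v.length * cartan h c c)) ?_ ?_
  · have h1 : 0 < v.length := by
      rw [List.length_pos_iff]
      intro H
      have : k ∈ v := by rw [hv, List.mem_filter]; exact ⟨hku, by simpa [p] using ⟨by omega, hc.symm⟩⟩
      rw [H] at this
      simp at this
    rw [← hc] at hne
    rw [cartan, if_pos rfl]
    have h2 : (2 - 2 * (h c c : ℤ)) ≠ 0 := by omega
    exact neg_ne_zero.2 (mul_ne_zero (by exact_mod_cast h1.ne') h2)
  · have h1 : Tw h ν u * e h ν i = Tw h ν v * e h ν i * (Tw h ν v' * e h ν i) := by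
      rw [e2, mul_assoc, ← mul_assoc (e h ν i), e_mul_self, ← e2, ← mul_assoc, ← hfac]
    have h2 : Tw h ν v' * e h ν i * (Tw h ν v * e h ν i) = Tw h ν u * e h ν i := by
      rw [e1, mul_assoc, ← mul_assoc (e h ν i), e_mul_self, ← e1, ← mul_assoc, ← hvv.eq, ← hfac]
    conv_lhs => rw [h1, hφ _ _ hdeg, h2]

/-! ### Exact symmetric group relations on equal entries from `I⁰` -/

section Symmetric

variable {K : ℕ → Prop} {i : Seq ν}

/-- A crossing of two equal entries from `I⁰` has degree `0`, so rotation is exact: neither a power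
of `q` nor a term with fewer crossings appears. -/
theorem IsTwistedTrace.rotate_imag (hφ : IsTwistedTrace φ)
    (hK : ∀ k, K k → ∃ hk : k + 1 < ν.degree, i.1 ⟨k, by omega⟩ = i.1 ⟨k + 1, hk⟩ ∧
      h (i.1 ⟨k, by omega⟩) (i.1 ⟨k, by omega⟩) = 1) {u : List ℕ} (hu : ∀ x ∈ u, K x) {k : ℕ}
    (hk : K k) : φ (Tw h ν (u ++ [k]) * e h ν i) = φ (Tw h ν (k :: u) * e h ν i) := by
  have e1 := Tw_mul_e_of_act (h := h) (act_eq_self_of_imag hK hu)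
  obtain ⟨hk', h1, h2⟩ := hK k hk
  have hdeg := gen_mem_grading (h := h) (Gen.τ k hk' i)
  rw [Gen.deg, ← h1, cartan, if_pos rfl, h2] at hdeg
  have h3 : T h ν k * Tw h ν u * e h ν i = gen h ν (Gen.τ k hk' i) * (Tw h ν u) := by
    rw [← T_mul_e, mul_assoc, e1, mul_assoc]
  rw [Tw_append, Tw_singleton, Tw_cons, h3, hφ _ _ hdeg, mul_assoc, T_mul_e k hk']
  simp

theorem Tw_mul_e_congr {u v v' w : List ℕ} (hw : ∀ x ∈ w, act x i = i)
    (H : Tw h ν v * e h ν i = Tw h ν v' * e h ν i) :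
    Tw h ν (u ++ (v ++ w)) * e h ν i = Tw h ν (u ++ (v' ++ w)) * e h ν i := by
  simp only [Tw_append, mul_assoc]
  rw [Tw_mul_e_of_act hw, ← mul_assoc (Tw h ν v), H, mul_assoc]

theorem Tw_braid_imag {k : ℕ} (hk : k + 1 + 1 < ν.degree)
    (himag : h (i.1 ⟨k, by omega⟩) (i.1 ⟨k, by omega⟩) = 1) :
    Tw h ν [k, k + 1, k] * e h ν i = Tw h ν [k + 1, k, k + 1] * e h ν i := by
  have := rel_eq (Rel.braid (h := h) k hk i (fun H => by rw [himag] at H; exact one_ne_zero H.2.2.1))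
  simp only [map_mul, mk_ft, mk_fe] at this
  simpa [Tw, mul_assoc] using this

/-- For `h_i = 1` both exponents in `Hpoly` are `0`, so the crossing is an involution on `1_i`. -/
theorem Tw_sq_imag {k : ℕ} (hk : k + 1 < ν.degree)
    (heq : i.1 ⟨k, by omega⟩ = i.1 ⟨k + 1, hk⟩)
    (himag : h (i.1 ⟨k, by omega⟩) (i.1 ⟨k, by omega⟩) = 1) :
    Tw h ν [k, k] * e h ν i = Tw h ν [] * e h ν i := by
  have := rel_eq (Rel.τ_sq_imag (h := h) k hk i heq (by rw [himag]; norm_num))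
  rw [map_mul, map_mul, mk_ft, mk_fe, Hpoly, himag] at this
  simpa [Tw, mk_fe, mul_assoc] using this

theorem Tw_comm_letters {u v : List ℕ} {k l : ℕ} (hkl : k + 1 < l) :
    Tw h ν (u ++ k :: l :: v) = Tw h ν (u ++ l :: k :: v) := by
  simp only [Tw_append, Tw_cons]
  rw [← mul_assoc (T h ν k), T_comm k l hkl, mul_assoc]

/-- The Coxeter elements on a given set of letters are conjugate. A word without repetitions
contains neither a square nor a braid pattern, so `word_induction` uses only rotations and far
commutations to sort it. -/
theorem IsTwistedTrace.apply_eq_of_perm (hφ : IsTwistedTrace φ)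
    (hK : ∀ k, K k → ∃ hk : k + 1 < ν.degree, i.1 ⟨k, by omega⟩ = i.1 ⟨k + 1, hk⟩ ∧
      h (i.1 ⟨k, by omega⟩) (i.1 ⟨k, by omega⟩) = 1) {u : List ℕ} (hu : ∀ x ∈ u, K x)
    (hs : u.Pairwise (· < ·)) (y : List ℕ) (hy : y.Perm u) :
    φ (Tw h ν y * e h ν i) = φ (Tw h ν u * e h ν i) := by
  have hnd : u.Nodup := hs.imp ne_of_lt
  induction y using word_induction with
  | rot y k H =>
    rw [← H ((List.perm_append_singleton k y).trans hy), hφ.rotate_imag hK (k := k)]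
    · exact fun x hx => hu x (hy.mem_iff.1 (by simp [hx]))
    · exact hu k (hy.mem_iff.1 (by simp))
  | comm u' v k l hkl =>
    rw [Tw_comm_letters hkl,
      show (u' ++ k :: l :: v).Perm u ↔ (u' ++ l :: k :: v).Perm u from
        ⟨((List.Perm.swap _ _ _).append_left u').trans,
          ((List.Perm.swap _ _ _).append_left u').trans⟩]
  | braid u' v k =>
    refine iff_of_true (fun H => ?_) fun H => ?_
    · have := H.nodup_iff.2 hnd
      simp [List.nodup_append] at this
    · have := H.nodup_iff.2 hnd
      simp [List.nodup_append] at this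
  | sq u' v k =>
    have := hy.nodup_iff.2 hnd
    simp [List.nodup_append] at this
  | sorted y hys =>
    rw [List.Perm.eq_of_pairwise (fun a b _ _ h1 h2 => absurd h1 (lt_asymm h2)) hys hs hy]

/-- Rotations, commutations and braid moves preserve the value exactly, and a square cancels, which
shortens the word. An increasing word uses letters of `u` without repetition: if it misses one, it
has too few crossings and is killed by `φ`; otherwise it is `u`. -/
theorem IsTwistedTrace.apply_eq_zero_or_eq (hφ : IsTwistedTrace φ)
    (hK : ∀ k, K k → ∃ hk : k + 1 < ν.degree, i.1 ⟨k, by omega⟩ = i.1 ⟨k + 1, hk⟩ ∧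
      h (i.1 ⟨k, by omega⟩) (i.1 ⟨k, by omega⟩) = 1) {u : List ℕ} (hu : ∀ x, x ∈ u ↔ K x)
    (hs : u.Pairwise (· < ·)) (hF : ∀ r ∈ crossingFiltration h ν u.length, φ r = 0) (y : List ℕ)
    (hy : ∀ x ∈ y, K x) :
    φ (Tw h ν y * e h ν i) = 0 ∨ φ (Tw h ν y * e h ν i) = φ (Tw h ν u * e h ν i) := by
  obtain ⟨n, hn⟩ : ∃ n, n = y.length := ⟨_, rfl⟩
  induction n using Nat.strong_induction_on generalizing y with
  | _ n ihn =>
  induction y using word_induction with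
  | rot y k H =>
    have hyK : ∀ x ∈ y, K x := fun x hx => hy x (by simp [hx])
    have hkK : K k := hy k (by simp)
    rw [← hφ.rotate_imag hK hyK hkK]
    refine H (fun x hx => ?_) (by simpa using hn)
    rcases List.mem_append.1 hx with hx | hx
    · exact hyK x hx
    · rw [List.mem_singleton.1 hx]; exact hkK
  | comm u' v k l hkl =>
    rw [Tw_comm_letters hkl]
    simp only [List.mem_append, List.mem_cons, List.length_append, List.length_cons,
      or_left_comm (b := _ = l)]
  | braid u' v k =>
    have key : (∀ x ∈ u' ++ k :: (k + 1) :: k :: v, K x) →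
        Tw h ν (u' ++ k :: (k + 1) :: k :: v) * e h ν i =
        Tw h ν (u' ++ (k + 1) :: k :: (k + 1) :: v) * e h ν i := by
      intro H
      obtain ⟨hk, h1, h2⟩ := hK k (H k (by simp))
      obtain ⟨hk', -, -⟩ := hK (k + 1) (H (k + 1) (by simp))
      exact Tw_mul_e_congr (v := [k, k + 1, k]) (v' := [k + 1, k, k + 1])
        (act_eq_self_of_imag hK fun x hx => H x (by simp [hx])) (Tw_braid_imag hk' h2)
    have hmem : (∀ x ∈ u' ++ k :: (k + 1) :: k :: v, K x) ↔
        ∀ x ∈ u' ++ (k + 1) :: k :: (k + 1) :: v, K x := by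
      refine forall_congr' fun x => imp_congr_left ?_
      simp only [List.mem_append, List.mem_cons]
      tauto
    constructor
    · intro H hy hn
      rw [← key (hmem.2 hy)]
      exact H (hmem.2 hy) (by simpa using hn)
    · intro H hy hn
      rw [key hy]
      exact H (hmem.1 hy) (by simpa using hn)
  | sq u' v k =>
    obtain ⟨hk, h1, h2⟩ := hK k (hy k (by simp))
    have := Tw_mul_e_congr (h := h) (u := u') (v := [k, k]) (v' := []) (w := v)
      (act_eq_self_of_imag hK fun x hx => hy x (by simp [hx])) (Tw_sq_imag hk h1 h2)
    simp only [List.cons_append, List.nil_append] at this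
    rw [this]
    refine ihn (u' ++ v).length (by rw [hn]; simp) (u' ++ v) (fun x hx => hy x ?_) rfl
    simp only [List.mem_append, List.mem_cons] at hx ⊢
    tauto
  | sorted y hys =>
    have hsub : y.Subperm u := List.subperm_of_subset (hys.imp ne_of_lt) fun x hx => (hu x).2 (hy x hx)
    rcases Nat.lt_or_ge y.length u.length with hlt | hge
    · exact Or.inl (hF _ (Tw_mul_mem hlt (e_mem i)))
    · exact Or.inr (hφ.apply_eq_of_perm hK (fun x hx => (hu x).1 hx) hs y
        (hsub.perm_of_length_le hge))

/-- With blocks cut at the letters of `u`, the value of `φ` at the idempotent is a non-zero multiple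
of `N • φ(τ_u 1_i)` with `N > 0`. All contributions that do not vanish are equal and enter with the
same coefficient, so nothing cancels. -/
theorem IsTwistedTrace.apply_Tw_of_imag (hφ : IsTwistedTrace φ)
    (h0 : ∀ l : ParSeq h ν, φ (parIdem l) = 0) {u : List ℕ}
    (hK : ∀ k ∈ u, ∃ hk : k + 1 < ν.degree, i.1 ⟨k, by omega⟩ = i.1 ⟨k + 1, hk⟩ ∧
      h (i.1 ⟨k, by omega⟩) (i.1 ⟨k, by omega⟩) = 1)
    (hs : u.Pairwise (· < ·)) (hF : ∀ r ∈ crossingFiltration h ν u.length, φ r = 0) :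
    φ (Tw h ν u * e h ν i) = 0 := by
  obtain ⟨l, hl, hlK⟩ := exists_parSeq (· ∈ u) i hK
  obtain ⟨c, hc, L, hL, ⟨u0, hu0, hnd, hmem⟩, hsum⟩ :=
    isWordSum_blockIdem (t := T h ν) (K := (· ∈ u)) (D := (· ∈ u)) (a := 0)
      (l := l.1.map fun p => p.1.2) (fun k hk => (hlK k).1 hk) (fun x => (hlK x).symm)
  have h1 := h0 l
  rw [parIdem, hl, hsum, smul_mul_assoc, map_smul, smul_eq_zero, or_iff_right hc,
    ← List.sum_map_mul_right, map_list_sum, List.map_map] at h1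
  -- Here `N` counts words to which the common value is attributed. The Coxeter word `u0` is always
  -- counted, by `apply_eq_of_perm`, so that `N ≠ 0`.
  have hval : ∀ L' : List (List ℕ), (∀ y ∈ L', ∀ x ∈ y, x ∈ u) → ∃ N : ℕ,
      (L'.map (φ ∘ fun y => (y.map (T h ν)).prod * e h ν i)).sum = N • φ (Tw h ν u * e h ν i) ∧
      (u0 ∈ L' → N ≠ 0) := by
    intro L'
    induction L' with
    | nil => exact fun _ => ⟨0, by simp, by simp⟩
    | cons y L' ih =>
      intro H
      obtain ⟨N, hN, hN0⟩ := ih fun y hy => H y (by simp [hy])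
      rw [List.map_cons, List.sum_cons, hN, Function.comp_apply]
      by_cases hy : y = u0
      · refine ⟨N + 1, ?_, fun _ => by omega⟩
        have : φ ((y.map (T h ν)).prod * e h ν i) = φ (Tw h ν u * e h ν i) :=
          hφ.apply_eq_of_perm hK (fun x hx => hx) hs y
            (hy ▸ (List.perm_ext_iff_of_nodup hnd (hs.imp ne_of_lt)).2 hmem)
        rw [this, add_smul, one_smul, add_comm]
      · rcases hφ.apply_eq_zero_or_eq hK (fun x => Iff.rfl) hs hF y (H y (by simp)) with h2 | h2
        · refine ⟨N, ?_, fun hm => hN0 (by simpa [Ne.symm hy] using hm)⟩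
          change φ ((y.map (T h ν)).prod * e h ν i) = 0 at h2
          rw [h2, zero_add]
        · refine ⟨N + 1, ?_, fun _ => by omega⟩
          change φ ((y.map (T h ν)).prod * e h ν i) = _ at h2
          rw [h2, add_smul, one_smul, add_comm]
  obtain ⟨N, hN, hN0⟩ := hval L hL
  rw [hN, ← Nat.cast_smul_eq_nsmul ℂ, smul_eq_zero, Nat.cast_eq_zero] at h1
  exact h1.resolve_left (hN0 hu0)

end Symmetric

/-- A twisted trace is determined by its values on the idempotents `1_i`, `i ∈ \underline{ν}`. -/
theorem IsTwistedTrace.eq_zero (hφ : IsTwistedTrace φ) (h0 : ∀ l : ParSeq h ν, φ (parIdem l) = 0) :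
    φ = 0 := by
  suffices H : ∀ m, ∀ r ∈ crossingFiltration h ν m, φ r = 0 by
    ext r
    obtain ⟨m, hm⟩ := exists_mem_crossingFiltration r
    rw [H m r hm]
    rfl
  intro m
  induction m with
  | zero =>
    intro r hr
    induction hr using Submodule.span_induction with
    | mem x hx => obtain ⟨u, hu, -⟩ := hx; omega
    | zero => exact map_zero _
    | add x y _ _ hx hy => rw [map_add, hx, hy, add_zero]
    | smul c x _ hx => rw [map_smul, hx, smul_zero]
  | succ m hF =>
  -- The claim concerns all polynomials `p` at once, because rotating a letter changes `p`.
  have main : ∀ u : List ℕ, u.length = m → ∀ p ∈ polySubalgebra h ν, φ (Tw h ν u * p) = 0 := by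
    intro u
    induction u using word_induction with
    | rot u k H =>
      intro hu p hp
      exact hφ.rotate hF (by rw [← hu]; simp) (H (by simpa using hu)) hp
    | comm u v k l hkl =>
      rw [Tw_comm_letters hkl]
      simp only [List.length_append, List.length_cons]
    | braid u v k =>
      have key : ∀ p ∈ polySubalgebra h ν, (u ++ k :: (k + 1) :: k :: v).length = m →
          φ (Tw h ν (u ++ k :: (k + 1) :: k :: v) * p) =
          φ (Tw h ν (u ++ (k + 1) :: k :: (k + 1) :: v) * p) := by
        intro p hp hm
        rw [← sub_eq_zero, ← map_sub, ← sub_mul]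
        have : Tw h ν (u ++ k :: (k + 1) :: k :: v) - Tw h ν (u ++ (k + 1) :: k :: (k + 1) :: v) =
            Tw h ν u * ((T h ν k * T h ν (k + 1) * T h ν k
              - T h ν (k + 1) * T h ν k * T h ν (k + 1)) * Tw h ν v) := by
          simp only [Tw_append, Tw_cons]
          noncomm_ring
        rw [this]
        -- The braid error is free of crossings, so three of the `m` crossings are lost.
        refine hF _ (crossingFiltration_mul (crossingFiltration_mono ?_
          (Tw_mul_crossingFiltration u (mul_Tw_mem (T_braid_mem k) v))) hp)
        simp at hm
        omega
      constructor
      · intro H hu p hp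
        have hu' : (u ++ k :: (k + 1) :: k :: v).length = m := by simpa using hu
        rw [← key p hp hu', H hu' p hp]
      · intro H hu p hp
        rw [key p hp hu, H (by simpa using hu) p hp]
    | sq u v k =>
      intro hu p hp
      have : Tw h ν (u ++ k :: k :: v) = Tw h ν u * (T h ν k * T h ν k * Tw h ν v) := by
        simp only [Tw_append, Tw_cons, mul_assoc]
      rw [this]
      refine hF _ (crossingFiltration_mul (crossingFiltration_mono ?_
        (Tw_mul_crossingFiltration u (mul_Tw_mem (T_mul_T_mem k) v))) hp)
      simp at hu
      omega
    | sorted u hs =>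
      intro hu p hp
      subst hu
      have hp' := mem_span_Xw hp
      clear hp
      induction hp' using Submodule.span_induction with
      | mem x hx =>
        obtain ⟨l, i, rfl⟩ := hx
        by_cases hl : l = []
        swap
        · exact hφ.apply_Xw hF l hl i
        rw [hl, Xw_nil, one_mul]
        by_cases hi : u.foldr act i = i
        swap
        -- The element runs between different idempotents; rotating the left one to the right
        -- produces a product of orthogonal idempotents.
        · have h1 : Tw h ν u * e h ν i = e h ν (u.foldr act i) * (Tw h ν u * e h ν i) := by
            rw [Tw_mul_e, ← mul_assoc, e_mul_self]
          rw [h1, hφ _ _ (e_mem_grading _), mul_assoc, e_mul_e (Ne.symm hi), mul_zero, map_zero,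
            mul_zero]
        have hact := act_eq_self_of_foldr hs hi
        by_cases hlt : ∀ k ∈ u, k + 1 < ν.degree
        swap
        · push Not at hlt
          obtain ⟨x, hx, hx'⟩ := hlt
          have : Tw h ν u = 0 :=
            List.prod_eq_zero (List.mem_map.2 ⟨x, hx, T_of_not_lt (by omega)⟩)
          rw [this, zero_mul, map_zero]
        by_cases himag : ∃ k, ∃ hk : k ∈ u,
            h (i.1 ⟨k, by have := hlt k hk; omega⟩) (i.1 ⟨k, by have := hlt k hk; omega⟩) ≠ 1
        · obtain ⟨k, hk, hne⟩ := himag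
          exact hφ.apply_Tw_of_ne_one hact hk (hlt k hk) hne
        · push Not at himag
          exact hφ.apply_Tw_of_imag h0 (fun k hk => ⟨hlt k hk,
            (act_eq_self_iff (hlt k hk)).1 (hact k hk), himag k hk⟩) hs hF
      | zero => rw [mul_zero, map_zero]
      | add x y _ _ hx hy => rw [mul_add, map_add, hx, hy, add_zero]
      | smul c x _ hx => rw [mul_smul_comm, map_smul, hx, smul_zero]
  intro r hr
  induction hr using Submodule.span_induction with
  | mem x hx =>
    obtain ⟨u, hu, p, hp, rfl⟩ := hx
    rcases Nat.lt_succ_iff_lt_or_eq.1 hu with hu | hu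
    · exact hF _ (Tw_mul_mem hu hp)
    · exact main u hu p hp
  | zero => exact map_zero _
  | add x y _ _ hx hy => rw [map_add, hx, hy, add_zero]
  | smul c x _ hx => rw [map_smul, hx, smul_zero]

end TwistedTrace

/-! ### Graded traces -/

theorem coeff_laurent_mul {k : Type*} [CommRing k] (f g : k[T;T⁻¹]) (n : ℤ) :
    (f * g).coeff n = ∑ d ∈ f.coeff.support, f.coeff d * g.coeff (n - d) := by
  conv_lhs => rw [← AddMonoidAlgebra.sum_coeff_single f, Finsupp.sum, Finset.sum_mul]
  rw [AddMonoidAlgebra.coeff_sum, Finsupp.finsetSum_apply]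
  refine Finset.sum_congr rfl fun d _ => ?_
  rw [AddMonoidAlgebra.coeff_single_mul_apply, neg_add_eq_sub]

theorem coeff_T_mul {k : Type*} [CommRing k] (d : ℤ) (f : k[T;T⁻¹]) (n : ℤ) :
    (LaurentPolynomial.T d * f).coeff n = f.coeff (n - d) := by
  rw [LaurentPolynomial.T, AddMonoidAlgebra.coeff_single_mul_apply, neg_add_eq_sub, one_mul]

section GradedTrace

variable {I : Type u} [Finite I] {h : I → I → ℕ} {ν : I →₀ ℕ}

namespace GrMod

variable (M : GrMod.{u, w} h ν)

/-- The projection to the homogeneous component of degree `n`. -/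
def proj (n : ℤ) : M.carrier →ₗ[ℂ] M.carrier :=
  letI := M.isInternal.chooseDecomposition
  (M.gr n).subtype ∘ₗ DirectSum.component ℂ ℤ (fun n => M.gr n) n ∘ₗ
    (DirectSum.decomposeLinearEquiv M.gr).toLinearMap

variable {M}

theorem proj_of_mem {n : ℤ} {x : M.carrier} (hx : x ∈ M.gr n) : M.proj n x = x := by
  let _ := M.isInternal.chooseDecomposition
  exact DirectSum.decompose_of_mem_same _ hx

theorem proj_of_mem_ne {m n : ℤ} {x : M.carrier} (hx : x ∈ M.gr m) (hmn : m ≠ n) :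
    M.proj n x = 0 := by
  let _ := M.isInternal.chooseDecomposition
  exact DirectSum.decompose_of_mem_ne _ hx hmn

theorem proj_mem (n : ℤ) (x : M.carrier) : M.proj n x ∈ M.gr n := by
  let _ := M.isInternal.chooseDecomposition
  exact SetLike.coe_mem (DirectSum.decompose M.gr x n)

theorem eq_zero_of_proj {x : M.carrier} (hx : ∀ n, M.proj n x = 0) : x = 0 := by
  let _ := M.isInternal.chooseDecomposition
  have : DirectSum.decompose M.gr x = 0 := DFinsupp.ext fun n => Subtype.ext (hx n)
  exact (DirectSum.decompose M.gr).injective (by rw [this, DirectSum.decompose_zero])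

theorem hom_ext {V : Type*} [AddCommGroup V] [Module ℂ V] {f g : M.carrier →ₗ[ℂ] V}
    (H : ∀ n, ∀ x ∈ M.gr n, f x = g x) : f = g := by
  have : ⨆ n, M.gr n ≤ LinearMap.eqLocus f g := iSup_le fun n x hx => H n x hx
  rw [M.isInternal.submodule_iSup_eq_top] at this
  exact LinearMap.ext fun x => this trivial

theorem proj_smul {d : ℤ} {a : R h ν} (ha : a ∈ grading h ν d) (n : ℤ) (x : M.carrier) :
    M.proj n (a • x) = a • M.proj (n - d) x := by
  suffices H : M.proj n ∘ₗ Algebra.lsmul ℂ ℂ M.carrier a =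
      Algebra.lsmul ℂ ℂ M.carrier a ∘ₗ M.proj (n - d) from LinearMap.congr_fun H x
  refine hom_ext fun m x hx => ?_
  change M.proj n (a • x) = a • M.proj (n - d) x
  have h1 := M.smul_mem d m a ha x hx
  by_cases hmn : d + m = n
  · rw [hmn] at h1
    rw [proj_of_mem h1, proj_of_mem (by rwa [← hmn, add_sub_cancel_left])]
  · rw [proj_of_mem_ne h1 hmn, proj_of_mem_ne hx (by omega), smul_zero]

variable (M)

theorem finite_gr_ne_bot : {n | M.gr n ≠ ⊥}.Finite :=
  WellFoundedGT.finite_ne_bot_of_iSupIndep M.isInternal.submodule_iSupIndep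

/-- The trace of an element of `R(ν)`, composed with the projection to degree `n`. -/
def componentTrace (n : ℤ) : R h ν →ₗ[ℂ] ℂ :=
  LinearMap.trace ℂ M.carrier ∘ₗ LinearMap.mulLeft ℂ (M.proj n) ∘ₗ
    (Algebra.lsmul ℂ ℂ M.carrier).toLinearMap

theorem componentTrace_apply (n : ℤ) (r : R h ν) : M.componentTrace n r =
    LinearMap.trace ℂ M.carrier (M.proj n * Algebra.lsmul ℂ ℂ M.carrier r) := rfl

theorem componentTrace_eq_zero {n : ℤ} (hn : M.gr n = ⊥) : M.componentTrace n = 0 := by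
  ext r
  have : M.proj n = 0 := LinearMap.ext fun x => by
    have := proj_mem (M := M) n x
    rwa [hn, Submodule.mem_bot] at this
  rw [componentTrace_apply, this, zero_mul, map_zero, LinearMap.zero_apply]

/-- Multiplication by `a` carries degree `n - d` to degree `n`, so the projection passes through `a`
with its index shifted; the rest is cyclicity of the ordinary trace. On generating functions the
shift of index is the factor `q^d`. -/
theorem componentTrace_mul {d : ℤ} {a : R h ν} (ha : a ∈ grading h ν d) (b : R h ν) (n : ℤ) :
    M.componentTrace n (a * b) = M.componentTrace (n - d) (b * a) := by
  have : M.proj n * Algebra.lsmul ℂ ℂ M.carrier a =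
      Algebra.lsmul ℂ ℂ M.carrier a * M.proj (n - d) :=
    LinearMap.ext fun x => proj_smul ha n x
  rw [componentTrace_apply, componentTrace_apply, map_mul (Algebra.lsmul ℂ ℂ M.carrier),
    map_mul (Algebra.lsmul ℂ ℂ M.carrier), ← mul_assoc, this, mul_assoc,
    LinearMap.trace_mul_comm, mul_assoc]

/-- The graded trace of an element of `R(ν)` on `M`. -/
def gradedTrace : R h ν →ₗ[ℂ] ℂ[T;T⁻¹] :=
  ∑ n ∈ M.finite_gr_ne_bot.toFinset, (M.componentTrace n).smulRight (LaurentPolynomial.T n)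

theorem coeff_gradedTrace (r : R h ν) (n : ℤ) :
    (M.gradedTrace r).coeff n = M.componentTrace n r := by
  rw [gradedTrace, LinearMap.sum_apply, AddMonoidAlgebra.coeff_sum, Finsupp.finsetSum_apply]
  simp only [LinearMap.smulRight_apply, AddMonoidAlgebra.coeff_smul_apply,
    LaurentPolynomial.T_apply, smul_eq_mul, mul_ite, mul_one, mul_zero]
  rw [Finset.sum_ite_eq']
  split_ifs with hn
  · rfl
  · rw [componentTrace_eq_zero M (by simpa using hn), LinearMap.zero_apply]

theorem isTwistedTrace_gradedTrace : IsTwistedTrace M.gradedTrace := by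
  intro d a ha b
  refine AddMonoidAlgebra.ext (Finsupp.ext fun n => ?_)
  rw [coeff_T_mul, coeff_gradedTrace, coeff_gradedTrace, componentTrace_mul M ha]

theorem coeff_char (i : ParSeq h ν) (n : ℤ) :
    (M.char i).coeff n = Module.finrank ℂ ↥(M.idemSpace i ⊓ M.gr n) := by
  rw [GrMod.char, GrMod.gdim, finsum_eq_sum_of_support_subset (s := M.finite_gr_ne_bot.toFinset)]
  · rw [AddMonoidAlgebra.coeff_sum, Finsupp.finsetSum_apply]
    simp only [← LaurentPolynomial.single_eq_C_mul_T, AddMonoidAlgebra.coeff_single]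
    simp only [Finsupp.single_apply]
    rw [Finset.sum_ite_eq']
    split_ifs with hn
    · rfl
    · have : M.gr n = ⊥ := by simpa using hn
      rw [this, inf_bot_eq, finrank_bot, Nat.cast_zero]
  · intro n hn
    simp only [Set.Finite.coe_toFinset, Set.mem_ofPred_eq]
    intro hbot
    apply hn
    simp only
    rw [hbot, inf_bot_eq, finrank_bot, Nat.cast_zero, map_zero, zero_mul]

/-- The composite of `1_i` with the projection to degree `n` is a projection onto `1_i M ∩ M_n`, and
the trace of a projection is its rank. -/
theorem gradedTrace_parIdem (i : ParSeq h ν) : M.gradedTrace (parIdem i) =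
    AddMonoidAlgebra.mapRingHom ℤ (Int.castRingHom ℂ) (M.char i) := by
  refine AddMonoidAlgebra.ext (Finsupp.ext fun n => ?_)
  rw [coeff_gradedTrace, AddMonoidAlgebra.coeff_mapRingHom, coeff_char, componentTrace_apply]
  have hp : LinearMap.IsProj (M.idemSpace i ⊓ M.gr n)
      (M.proj n * Algebra.lsmul ℂ ℂ M.carrier (parIdem i)) := by
    refine ⟨fun x => ⟨?_, proj_mem _ _⟩, fun x hx => ?_⟩
    · change M.proj n (parIdem i • x) ∈ _
      rw [proj_smul (parIdem_mem_and_mul_self i).1]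
      exact ⟨_, rfl⟩
    · change M.proj n (parIdem i • x) = x
      rw [(mem_idemSpace M i).1 hx.1, proj_of_mem hx.2]
  rw [hp.trace]
  simp

end GrMod

/-! ### gr-irreducible modules over the component of degree zero -/

variable (h ν) in
/-- The component of degree `0` of `R(ν)`. -/
def gradingZero : Subalgebra ℂ (R h ν) where
  carrier := grading h ν 0
  mul_mem' ha hb := by simpa using grading_mul ha hb
  one_mem' := one_mem_grading
  add_mem' ha hb := add_mem ha hb
  zero_mem' := zero_mem _
  algebraMap_mem' c := by
    rw [Algebra.algebraMap_eq_smul_one]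
    exact Submodule.smul_mem _ _ one_mem_grading

instance (M : GrMod.{u, w} h ν) (n : ℤ) : Module (gradingZero h ν) (M.gr n) where
  smul r x := ⟨r.1 • x.1, by simpa using M.smul_mem 0 n r.1 r.2 x.1 x.2⟩
  one_smul x := Subtype.ext (one_smul (R h ν) x.1)
  mul_smul r s x := Subtype.ext (mul_smul r.1 s.1 x.1)
  smul_zero r := Subtype.ext (smul_zero r.1)
  smul_add r x y := Subtype.ext (smul_add r.1 x.1 y.1)
  add_smul r s x := Subtype.ext (add_smul r.1 s.1 x.1)
  zero_smul x := Subtype.ext (zero_smul (R h ν) x.1)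

instance (M : GrMod.{u, w} h ν) (n : ℤ) : IsScalarTower ℂ (gradingZero h ν) (M.gr n) where
  smul_assoc c r x := Subtype.ext (smul_assoc c r.1 x.1)

namespace GrMod

variable {M M' : GrMod.{u, w} h ν}

/-- As the sum of the components of `R(ν)` is not known to be direct, the degree `d` part of `r` is
only chosen. One choice must serve both `x` and `y`, so that their annihilators can be compared. -/
theorem exists_proj_smul {n n' : ℤ} {x : M.carrier} (hx : x ∈ M.gr n) {y : M'.carrier}
    (hy : y ∈ M'.gr n') (r : R h ν) (d : ℤ) : ∃ r' ∈ grading h ν d,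
      M.proj (d + n) (r • x) = r' • x ∧ M'.proj (d + n') (r • y) = r' • y := by
  have hr : r ∈ ⨆ d, grading h ν d := by rw [iSup_grading]; trivial
  induction hr using Submodule.iSup_induction' with
  | mem c r hr =>
    by_cases hcd : c = d
    · subst hcd
      exact ⟨r, hr, proj_of_mem (M.smul_mem _ _ _ hr _ hx), proj_of_mem (M'.smul_mem _ _ _ hr _ hy)⟩
    · exact ⟨0, zero_mem _, by rw [proj_of_mem_ne (M.smul_mem _ _ _ hr _ hx) (by omega), zero_smul],
        by rw [proj_of_mem_ne (M'.smul_mem _ _ _ hr _ hy) (by omega), zero_smul]⟩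
  | zero => exact ⟨0, zero_mem _, by simp, by simp⟩
  | add a b _ _ ha hb =>
    obtain ⟨a', ha', h1, h2⟩ := ha
    obtain ⟨b', hb', h3, h4⟩ := hb
    exact ⟨a' + b', add_mem ha' hb', by rw [add_smul, map_add, h1, h3, add_smul],
      by rw [add_smul, map_add, h2, h4, add_smul]⟩

theorem IsGrIrreducible.exists_smul_eq (hM : M.IsGrIrreducible) {n : ℤ} {x : M.carrier}
    (hx : x ∈ M.gr n) (hx0 : x ≠ 0) (z : M.carrier) : ∃ r : R h ν, r • x = z := by
  have hgr : M.IsGraded (Submodule.span (R h ν) {x}) := by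
    refine le_antisymm ?_ (iSup_le fun n => inf_le_left)
    intro y hy
    obtain ⟨r, rfl⟩ := Submodule.mem_span_singleton.1 hy
    have hr : r ∈ ⨆ d, grading h ν d := by rw [iSup_grading]; trivial
    clear hy
    induction hr using Submodule.iSup_induction' with
    | mem c r hr =>
      exact Submodule.mem_iSup_of_mem (c + n)
        ⟨Submodule.mem_span_singleton.2 ⟨r, rfl⟩, M.smul_mem _ _ _ hr _ hx⟩
    | zero => rw [zero_smul]; exact zero_mem _
    | add a b _ _ ha hb => rw [add_smul]; exact add_mem ha hb
  rcases hM.2 _ hgr with H | H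
  · exact absurd (Submodule.span_singleton_eq_bot.1 H) hx0
  · exact Submodule.mem_span_singleton.1 (by rw [H]; trivial)

theorem IsGrIrreducible.exists_homogeneous_smul_eq (hM : M.IsGrIrreducible) {n d : ℤ}
    {x : M.carrier} (hx : x ∈ M.gr n) (hx0 : x ≠ 0) {z : M.carrier} (hz : z ∈ M.gr (d + n)) :
    ∃ r ∈ grading h ν d, r • x = z := by
  obtain ⟨r, hr⟩ := hM.exists_smul_eq hx hx0 z
  obtain ⟨r', hr', h1, -⟩ := exists_proj_smul hx hx r d
  exact ⟨r', hr', by rw [← h1, hr, proj_of_mem hz]⟩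

/-- The degree zero annihilator controls the whole annihilator. If a component `r' y` of `r y` were
non-zero, irreducibility would give `s` of opposite degree with `s r' y = y`; then `s r'` has degree
`0` and kills `x` but not `y`. -/
theorem IsGrIrreducible.smul_eq_zero_of (hM' : M'.IsGrIrreducible) {n n' : ℤ} {x : M.carrier}
    (hx : x ∈ M.gr n) {y : M'.carrier} (hy : y ∈ M'.gr n') (hy0 : y ≠ 0)
    (H : ∀ r ∈ grading h ν 0, r • x = 0 → r • y = 0) {r : R h ν} (hr : r • x = 0) :
    r • y = 0 := by
  refine eq_zero_of_proj fun k => ?_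
  obtain ⟨r', hr', h1, h2⟩ := exists_proj_smul hx hy r (k - n')
  rw [sub_add_cancel] at h2
  rw [hr, map_zero] at h1
  rw [h2]
  by_contra hne
  have hmem := M'.smul_mem _ _ _ hr' _ hy
  obtain ⟨s, hs, hsy⟩ := hM'.exists_homogeneous_smul_eq (d := n' - k) hmem hne (z := y)
    (by rwa [show n' - k + (k - n' + n') = n' by ring])
  apply hy0
  rw [← hsy, smul_smul]
  refine H _ ?_ (by rw [mul_smul, ← h1, smul_zero])
  have := grading_mul hs hr'
  rwa [show n' - k + (k - n') = 0 by ring] at this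

/-- Both modules are cyclic, generated by `x` and `y`, and the two annihilators coincide, so both
are the same quotient of `R(ν)`. The shift accounts for the degrees of the generators. -/
theorem IsGrIrreducible.iso_of (hM : M.IsGrIrreducible) (hM' : M'.IsGrIrreducible) {n n' : ℤ}
    {x : M.carrier} (hx : x ∈ M.gr n) (hx0 : x ≠ 0) {y : M'.carrier} (hy : y ∈ M'.gr n')
    (hy0 : y ≠ 0) (H : ∀ r ∈ grading h ν 0, r • x = 0 ↔ r • y = 0) : M.Iso (M'.shift (n - n')) := by
  have hker : LinearMap.ker (LinearMap.toSpanSingleton (R h ν) M.carrier x) =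
      LinearMap.ker (LinearMap.toSpanSingleton (R h ν) M'.carrier y) := by
    ext r
    exact ⟨fun hr => hM'.smul_eq_zero_of hx hy hy0 (fun r hr => (H r hr).1) hr,
      fun hr => hM.smul_eq_zero_of hy hx hx0 (fun r hr => (H r hr).2) hr⟩
  let F : M.carrier ≃ₗ[R h ν] M'.carrier :=
    (LinearMap.quotKerEquivOfSurjective (LinearMap.toSpanSingleton (R h ν) M.carrier x)
      (hM.exists_smul_eq hx hx0)).symm ≪≫ₗ Submodule.quotEquivOfEq _ _ hker ≪≫ₗ
    LinearMap.quotKerEquivOfSurjective (LinearMap.toSpanSingleton (R h ν) M'.carrier y)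
      (hM'.exists_smul_eq hy hy0)
  have hF : ∀ r : R h ν, F (r • x) = r • y := by
    intro r
    have : (LinearMap.quotKerEquivOfSurjective (LinearMap.toSpanSingleton (R h ν) M.carrier x)
      (hM.exists_smul_eq hx hx0)).symm (r • x) = Submodule.Quotient.mk r := by
      rw [LinearEquiv.symm_apply_eq]; rfl
    simp only [F, LinearEquiv.trans_apply]
    rw [this]
    rfl
  refine ⟨F, fun k z => ⟨fun hz => ?_, fun hz => ?_⟩⟩
  · obtain ⟨r, hr, rfl⟩ := hM.exists_homogeneous_smul_eq (d := k - n) hx hx0 (z := z)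
      (by rwa [sub_add_cancel])
    change F (r • x) ∈ M'.gr (k - (n - n'))
    rw [hF, show k - (n - n') = k - n + n' by ring]
    exact M'.smul_mem _ _ _ hr _ hy
  · change F z ∈ M'.gr (k - (n - n')) at hz
    obtain ⟨r, hr, hrz⟩ := hM'.exists_homogeneous_smul_eq (d := k - n) hy hy0 (z := F z)
      (by rwa [show k - n + n' = k - (n - n') by ring])
    rw [← hF] at hrz
    rw [← F.injective hrz, ← sub_add_cancel k n]
    exact M.smul_mem _ _ _ hr _ hx

/-- If `f x ≠ 0`, then `x` and `f x` have the same degree zero annihilator: when `r x ≠ 0`, some `s`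
of degree `0` returns `r x` to `x`, so `r f(x)` cannot vanish. Then `iso_of` applies. -/
theorem IsGrIrreducible.hom_eq_zero (hM : M.IsGrIrreducible) (hM' : M'.IsGrIrreducible) {n n' : ℤ}
    (hiso : ¬ M.Iso (M'.shift (n - n'))) (f : M.gr n →ₗ[gradingZero h ν] M'.gr n') : f = 0 := by
  by_contra hf
  obtain ⟨x, hx⟩ : ∃ x, f x ≠ 0 := by
    by_contra! H
    exact hf (LinearMap.ext H)
  have hx0 : x.1 ≠ 0 := fun H => hx (by rw [show x = 0 from Subtype.ext H, map_zero])
  have hf : ∀ r (hr : r ∈ grading h ν 0), ∀ z : M.gr n, r • (f z).1 =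
      (f ⟨r • z.1, by simpa using M.smul_mem 0 n r hr z.1 z.2⟩).1 := fun r hr z =>
    (congrArg Subtype.val (f.map_smul (⟨r, hr⟩ : gradingZero h ν) z)).symm
  refine hiso (hM.iso_of hM' x.2 hx0 (f x).2 (fun H => hx (Subtype.ext H)) fun r hr =>
    ⟨fun hrx => ?_, fun hrx => ?_⟩)
  · rw [hf r hr]
    simp only [hrx]
    exact congrArg Subtype.val (map_zero f)
  · by_contra hne
    obtain ⟨s, hs, hsx⟩ := hM.exists_homogeneous_smul_eq (d := 0) (M.smul_mem _ _ _ hr _ x.2) hne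
      (z := x.1) (by rw [zero_add, zero_add]; exact x.2)
    apply hx
    have h1 := hf _ (by simpa using grading_mul hs hr) x
    simp only [mul_smul, hsx, hrx, smul_zero] at h1
    exact Subtype.ext h1.symm

/-- Elements of degree `0` carry any non-zero vector of a component to any other vector of it, so
the component is zero or simple. -/
theorem IsGrIrreducible.isSemisimpleModule (hM : M.IsGrIrreducible) (n : ℤ) :
    IsSemisimpleModule (gradingZero h ν) (M.gr n) := by
  rcases subsingleton_or_nontrivial (M.gr n) with H | H
  · have := (Submodule.subsingleton_iff (gradingZero h ν) (M := M.gr n)).2 H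
    exact { exists_isCompl := fun p =>
      ⟨p, IsCompl.of_eq (Subsingleton.elim _ _) (Subsingleton.elim _ _)⟩ }
  · have : IsSimpleModule (gradingZero h ν) (M.gr n) := by
      refine isSimpleModule_iff_toSpanSingleton_surjective.2 ⟨H, fun x hx z => ?_⟩
      obtain ⟨r, hr, hrx⟩ := hM.exists_homogeneous_smul_eq (d := 0) x.2
        (fun H => hx (Subtype.ext H)) (z := z.1) (by rw [zero_add]; exact z.2)
      exact ⟨⟨r, hr⟩, Subtype.ext hrx⟩
    infer_instance

theorem exists_gr_ne_bot (M : GrMod.{u, w} h ν) [Nontrivial M.carrier] : ∃ n, M.gr n ≠ ⊥ := by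
  by_contra! H
  have := M.isInternal.submodule_iSup_eq_top
  rw [show M.gr = fun _ => ⊥ from funext H, iSup_bot] at this
  exact bot_ne_top this

/-- Iterating such an isomorphism would move a non-zero component through infinitely many degrees.
-/
theorem not_iso_shift_self [Nontrivial M.carrier] {m : ℤ} (hm : m ≠ 0) : ¬ M.Iso (M.shift m) := by
  rintro ⟨F, hF⟩
  obtain ⟨e, he⟩ := M.exists_gr_ne_bot
  have key : ∀ t : ℕ, M.gr (e - t * m) ≠ ⊥ := by
    intro t
    induction t with
    | zero => simpa using he
    | succ t ih =>
      rw [Submodule.ne_bot_iff] at ih ⊢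
      obtain ⟨x, hx, hx0⟩ := ih
      refine ⟨F x, ?_, fun H => hx0 (F.map_eq_zero_iff.1 H)⟩
      have : F x ∈ M.gr (e - t * m - m) := (hF _ x).1 hx
      rwa [show e - t * m - m = e - (t + 1 : ℕ) * m by push_cast; ring] at this
  refine Set.infinite_of_injective_forall_mem (f := fun t : ℕ => e - t * m) ?_ key
    M.finite_gr_ne_bot
  intro t t' htt
  have : (t : ℤ) * m = t' * m := by simpa using htt
  exact_mod_cast mul_right_cancel₀ hm this

end GrMod

/-- An element of an algebra that is the identity on one of finitely many modules and zero on the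
others, if these are semisimple and there are no non-zero maps to and from the given one. -/
theorem exists_smul_eq_self_and_zero {A : Type*} [Ring A] [Algebra ℂ A] {ι : Type*} [Finite ι]
    (N : ι → Type*) [∀ j, AddCommGroup (N j)] [∀ j, Module ℂ (N j)] [∀ j, Module A (N j)]
    [∀ j, IsScalarTower ℂ A (N j)] [∀ j, Module.Finite ℂ (N j)] [∀ j, IsSemisimpleModule A (N j)]
    (j0 : ι) (H1 : ∀ j, j ≠ j0 → ∀ f : N j →ₗ[A] N j0, f = 0)
    (H2 : ∀ j, j ≠ j0 → ∀ f : N j0 →ₗ[A] N j, f = 0) :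
    ∃ a : A, (∀ x : N j0, a • x = x) ∧ ∀ j, j ≠ j0 → ∀ x : N j, a • x = 0 := by
  classical
  have := Fintype.ofFinite ι
  have key1 : ∀ (g : (∀ j, N j) →ₗ[A] (∀ j, N j)) (x : ∀ j, N j),
      g x j0 = g (Pi.single j0 (x j0)) j0 := by
    intro g x
    conv_lhs => rw [← Finset.univ_sum_single x, map_sum, Finset.sum_apply]
    refine Finset.sum_eq_single j0 (fun j _ hj => ?_) fun H => absurd (Finset.mem_univ _) H
    exact LinearMap.congr_fun (H1 j hj (LinearMap.proj j0 ∘ₗ g ∘ₗ LinearMap.single A N j)) (x j)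
  have key2 : ∀ (g : (∀ j, N j) →ₗ[A] (∀ j, N j)) (y : N j0),
      Pi.single j0 (g (Pi.single j0 y) j0) = g (Pi.single j0 y) := by
    intro g y
    funext j
    by_cases hj : j = j0
    · subst hj; simp
    · rw [Pi.single_eq_of_ne hj]
      exact (LinearMap.congr_fun
        (H2 j hj (LinearMap.proj j ∘ₗ g ∘ₗ LinearMap.single A N j0)) y).symm
  -- The projection to the summand `j0` commutes with every `A`-endomorphism, because there are no
  -- maps between this summand and the others. By density some `a` agrees with it on a finite
  -- spanning set over `ℂ`, hence everywhere.
  let f : Module.End (Module.End A (∀ j, N j)) (∀ j, N j) :=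
    { toFun := fun x => Pi.single j0 (x j0)
      map_add' := fun x y => by rw [Pi.add_apply, Pi.single_add]
      map_smul' := fun g x => by
        change Pi.single j0 (g x j0) = g (Pi.single j0 (x j0))
        rw [key1, key2] }
  obtain ⟨s, hs⟩ := (Module.Finite.fg_top : (⊤ : Submodule ℂ (∀ j, N j)).FG)
  obtain ⟨a, ha⟩ := jacobson_density (R := A) f s
  have hext : ∀ x : ∀ j, N j, a • x = Pi.single j0 (x j0) := by
    intro x
    have hx : x ∈ Submodule.span ℂ (s : Set (∀ j, N j)) := by rw [hs]; trivial
    induction hx using Submodule.span_induction with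
    | mem x hx => exact (ha x hx).symm
    | zero => simp
    | add x y _ _ hx hy => rw [smul_add, hx, hy, Pi.add_apply, Pi.single_add]
    | smul c x _ hx => rw [smul_comm, hx, Pi.smul_apply, Pi.single_smul]
  refine ⟨a, fun x => ?_, fun j hj x => ?_⟩
  · have := congrFun (hext (Pi.single j0 x)) j0
    simpa using this
  · have := congrFun (hext (Pi.single j x)) j
    simpa [Pi.single_eq_of_ne hj, Pi.single_eq_of_ne hj.symm] using this

/-! ### Linear independence of graded traces -/

namespace GrMod

variable {M : GrMod.{u, w} h ν}

theorem componentTrace_of_smul_eq_zero {n : ℤ} {r : R h ν} (hr : r ∈ grading h ν 0)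
    (H : ∀ x ∈ M.gr n, r • x = 0) : M.componentTrace n r = 0 := by
  have : M.proj n * Algebra.lsmul ℂ ℂ M.carrier r = 0 := LinearMap.ext fun x => by
    change M.proj n (r • x) = 0
    rw [proj_smul hr, sub_zero, H _ (proj_mem n x)]
  rw [componentTrace_apply, this, map_zero]

theorem componentTrace_of_smul_eq_self {n : ℤ} {r : R h ν} (hr : r ∈ grading h ν 0)
    (H : ∀ x ∈ M.gr n, r • x = x) : M.componentTrace n r = Module.finrank ℂ (M.gr n) := by
  have : M.proj n * Algebra.lsmul ℂ ℂ M.carrier r = M.proj n := LinearMap.ext fun x => by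
    change M.proj n (r • x) = _
    rw [proj_smul hr, sub_zero, H _ (proj_mem n x)]
  have hp : LinearMap.IsProj (M.gr n) (M.proj n) := ⟨proj_mem n, fun x hx => proj_of_mem hx⟩
  rw [componentTrace_apply, this, hp.trace]

/-- The graded traces of gr-irreducible modules which are pairwise non-isomorphic even after a
shift are linearly independent over `ℂ[q,q⁻¹]`. -/
theorem eq_zero_of_sum_gradedTrace {B : Type v} (S : B → GrMod.{u, w} h ν)
    (hS : ∀ b, (S b).IsGrIrreducible)
    (hiso : ∀ b b', b ≠ b' → ∀ m : ℤ, ¬ (S b).Iso ((S b').shift m)) (s : Finset B)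
    (P : B → ℂ[T;T⁻¹]) (H : ∀ r, ∑ b ∈ s, P b * (S b).gradedTrace r = 0) :
    ∀ b ∈ s, P b = 0 := by
  classical
  intro b0 hb0
  refine AddMonoidAlgebra.ext (Finsupp.ext fun d0 => ?_)
  by_contra hne
  have := (hS b0).1
  obtain ⟨e, he⟩ := (S b0).exists_gr_ne_bot
  -- In the coefficient of `q^n`, the term `q^d0` of `P b0` meets the trace on the non-zero
  -- component of degree `e`. Each pair `(b, d)` in `J` contributes the trace on the component of `S
  -- b` of degree `n - d`.
  obtain ⟨n, hn⟩ : ∃ n, n = e + d0 := ⟨_, rfl⟩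
  let J : Finset (Σ _ : B, ℤ) := s.sigma fun b => (P b).coeff.support
  let j0 : J := ⟨⟨b0, d0⟩, Finset.mem_sigma.2 ⟨hb0, Finsupp.mem_support_iff.2 hne⟩⟩
  -- Different `b` are excluded by hypothesis; for the same `b`, different `d` would give an
  -- isomorphism with a non-trivial shift.
  have hnot : ∀ j j' : J, j ≠ j' → ¬ (S j.1.1).Iso ((S j'.1.1).shift
      ((n - j.1.2) - (n - j'.1.2))) := by
    rintro ⟨⟨b, d⟩, hj⟩ ⟨⟨b', d'⟩, hj'⟩ hjj
    by_cases hb : b = b'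
    · subst hb
      have := (hS b).1
      refine not_iso_shift_self ?_
      intro hd
      apply hjj
      have : d = d' := by simp only at hd; omega
      subst this
      rfl
    · exact hiso b b' hb _
  have hss : ∀ j : J, IsSemisimpleModule (gradingZero h ν) ((S j.1.1).gr (n - j.1.2)) :=
    fun j => (hS j.1.1).isSemisimpleModule _
  obtain ⟨r, hr1, hr2⟩ := exists_smul_eq_self_and_zero (A := gradingZero h ν)
    (fun j : J => (S j.1.1).gr (n - j.1.2)) j0
    (fun j hj f => (hS _).hom_eq_zero (hS _) (hnot j j0 hj) f)
    (fun j hj f => (hS _).hom_eq_zero (hS _) (hnot j0 j hj.symm) f)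
  have h1 := congrArg (fun f : ℂ[T;T⁻¹] => f.coeff n) (H r.1)
  simp only [AddMonoidAlgebra.coeff_sum, Finsupp.finsetSum_apply, coeff_laurent_mul,
    coeff_gradedTrace, AddMonoidAlgebra.coeff_zero, Finsupp.zero_apply] at h1
  rw [Finset.sum_sigma', ← Finset.sum_coe_sort, Finset.sum_eq_single_of_mem j0 (Finset.mem_univ _)]
    at h1
  · rw [componentTrace_of_smul_eq_self r.2 fun x hx => congrArg Subtype.val (hr1 ⟨x, hx⟩)] at h1
    rcases mul_eq_zero.1 h1 with h2 | h2
    · exact hne h2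
    · rw [Nat.cast_eq_zero, Submodule.finrank_eq_zero] at h2
      apply he
      rwa [show n - j0.1.2 = e by simp [hn, j0]] at h2
  · intro j _ hj
    rw [componentTrace_of_smul_eq_zero r.2 fun x hx => congrArg Subtype.val (hr2 j hj ⟨x, hx⟩),
      mul_zero]

end GrMod

end GradedTrace

/-! ### Graded submodules and quotients -/

section SubQuotient

variable {I : Type u} [Finite I] {h : I → I → ℕ} {ν : I →₀ ℕ}

namespace GrMod

variable {M : GrMod.{u, w} h ν}

theorem IsGraded.proj_mem {N : Submodule (R h ν) M.carrier} (hN : M.IsGraded N) {x : M.carrier}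
    (hx : x ∈ N) (n : ℤ) : M.proj n x ∈ N := by
  have hx' : x ∈ ⨆ n, N.restrictScalars ℂ ⊓ M.gr n := by
    rw [← hN]; exact hx
  clear hx
  induction hx' using Submodule.iSup_induction' with
  | mem m x hx =>
    by_cases hmn : m = n
    · rw [← hmn, proj_of_mem hx.2]; exact hx.1
    · rw [proj_of_mem_ne hx.2 hmn]; exact zero_mem _
  | zero => rw [map_zero]; exact zero_mem _
  | add x y _ _ hx hy => rw [map_add]; exact add_mem hx hy

theorem proj_eq_zero_of_mem_iSup {n : ℤ} {x : M.carrier} (hx : x ∈ ⨆ m, ⨆ _ : m ≠ n, M.gr m) :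
    M.proj n x = 0 := by
  have : ⨆ m, ⨆ _ : m ≠ n, M.gr m ≤ LinearMap.ker (M.proj n) :=
    iSup₂_le fun m hm x hx => proj_of_mem_ne hx hm
  exact this hx

/-- A graded submodule as a graded module. -/
def sub (M : GrMod.{u, w} h ν) (N : Submodule (R h ν) M.carrier) (hN : M.IsGraded N) :
    GrMod.{u, w} h ν where
  carrier := N
  finite := Module.Finite.of_injective (N.subtype.restrictScalars ℂ) N.injective_subtype
  gr n := (M.gr n).comap (N.subtype.restrictScalars ℂ)
  isInternal := by
    refine (DirectSum.isInternal_submodule_iff_iSupIndep_and_iSup_eq_top _).2 ⟨fun n => ?_, ?_⟩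
    · refine Submodule.disjoint_def.2 fun x hx hx' => Subtype.ext ?_
      rw [← proj_of_mem (show x.1 ∈ M.gr n from hx)]
      refine proj_eq_zero_of_mem_iSup ?_
      have := Submodule.mem_map_of_mem (f := N.subtype.restrictScalars ℂ) hx'
      simp only [Submodule.map_iSup] at this
      exact iSup₂_mono (fun m _ => Submodule.map_comap_le _ _) this
    · refine Submodule.map_injective_of_injective
        (f := N.subtype.restrictScalars ℂ) N.injective_subtype ?_
      simp only [Submodule.map_iSup, Submodule.map_comap_eq]
      rw [Submodule.map_top, LinearMap.range_restrictScalars, Submodule.range_subtype]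
      exact hN.symm
  smul_mem d n r hr x hx := M.smul_mem d n r hr x.1 hx

/-- The quotient by a graded submodule as a graded module. -/
def quotient (M : GrMod.{u, w} h ν) (N : Submodule (R h ν) M.carrier) (hN : M.IsGraded N) :
    GrMod.{u, w} h ν where
  carrier := M.carrier ⧸ N
  finite := Module.Finite.of_surjective (N.mkQ.restrictScalars ℂ) N.mkQ_surjective
  gr n := (M.gr n).map (N.mkQ.restrictScalars ℂ)
  isInternal := by
    refine (DirectSum.isInternal_submodule_iff_iSupIndep_and_iSup_eq_top _).2 ⟨fun n => ?_, ?_⟩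
    · refine Submodule.disjoint_def.2 ?_
      rintro _ ⟨x, hx, rfl⟩ hx'
      simp only [← Submodule.map_iSup] at hx'
      obtain ⟨y, hy, hyx⟩ := hx'
      change N.mkQ y = N.mkQ x at hyx
      change N.mkQ x = 0
      rw [← sub_eq_zero, ← map_sub, Submodule.mkQ_apply, Submodule.Quotient.mk_eq_zero] at hyx
      have := hN.proj_mem hyx n
      rw [map_sub, proj_eq_zero_of_mem_iSup hy, proj_of_mem hx, zero_sub, neg_mem_iff] at this
      rwa [Submodule.mkQ_apply, Submodule.Quotient.mk_eq_zero]
    · rw [← Submodule.map_iSup, M.isInternal.submodule_iSup_eq_top, Submodule.map_top,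
        LinearMap.range_restrictScalars, Submodule.range_mkQ]
      rfl
  smul_mem d n r hr := by
    rintro _ ⟨x, hx, rfl⟩
    exact ⟨r • x, M.smul_mem d n r hr x hx, rfl⟩

theorem shortExact_sub_quotient (M : GrMod.{u, w} h ν) (N : Submodule (R h ν) M.carrier)
    (hN : M.IsGraded N) : (M.sub N hN).ShortExact M (M.quotient N hN) :=
  ⟨N.subtype, N.mkQ, fun _ _ hx => hx, fun _ x hx => ⟨x, hx, rfl⟩, N.injective_subtype,
    LinearMap.exact_subtype_mkQ N, N.mkQ_surjective⟩

theorem isGraded_top : M.IsGraded ⊤ := by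
  rw [IsGraded, Submodule.restrictScalars_top]
  simp only [top_inf_eq]
  exact M.isInternal.submodule_iSup_eq_top.symm

theorem Iso.symm {M M' : GrMod.{u, w} h ν} {m : ℤ} (H : M.Iso (M'.shift m)) :
    M'.Iso (M.shift (-m)) := by
  obtain ⟨F, hF⟩ := H
  refine ⟨F.symm, fun n x => ?_⟩
  have : F.symm x ∈ M.gr (n + m) ↔ F (F.symm x) ∈ M'.gr (n + m - m) := hF _ _
  change x ∈ M'.gr n ↔ F.symm x ∈ M.gr (n - -m)
  have h1 : F (F.symm x) = x := F.apply_symm_apply x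
  rw [h1, add_sub_cancel_right] at this
  rw [sub_neg_eq_add]
  exact this.symm

theorem Iso.trans {M M' M'' : GrMod.{u, w} h ν} {m m' : ℤ} (H : M.Iso (M'.shift m))
    (H' : M'.Iso (M''.shift m')) : M.Iso (M''.shift (m + m')) := by
  obtain ⟨F, hF⟩ := H
  obtain ⟨F', hF'⟩ := H'
  refine ⟨F.trans F', fun n x => ?_⟩
  have h1 : x ∈ M.gr n ↔ F x ∈ M'.gr (n - m) := hF _ _
  have h2 : F x ∈ M'.gr (n - m) ↔ F' (F x) ∈ M''.gr (n - m - m') := hF' _ _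
  change x ∈ M.gr n ↔ F' (F x) ∈ M''.gr (n - (m + m'))
  rw [h1, h2, sub_sub]

theorem iso_shift_zero (M : GrMod.{u, w} h ν) : M.Iso (M.shift 0) :=
  ⟨LinearEquiv.refl _ _, fun n x => by
    change x ∈ M.gr n ↔ x ∈ M.gr (n - 0)
    rw [sub_zero]⟩

/-- Equality up to isomorphism and shift for gr-irreducible modules. -/
def shiftSetoid (h : I → I → ℕ) (ν : I →₀ ℕ) :
    Setoid {M : GrMod.{u, w} h ν // M.IsGrIrreducible} where
  r M M' := ∃ m : ℤ, M.1.Iso (M'.1.shift m)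
  iseqv := ⟨fun M => ⟨0, M.1.iso_shift_zero⟩, fun ⟨m, H⟩ => ⟨-m, H.symm⟩,
    fun ⟨m, H⟩ ⟨m', H'⟩ => ⟨m + m', H.trans H'⟩⟩

end GrMod

/-! ### Generation of the Grothendieck group -/

theorem cls_eq_add {M' M M'' : GrMod.{u, w} h ν} (H : M'.ShortExact M M'') :
    cls M = cls M' + cls M'' := by
  refine (Submodule.Quotient.eq (G0rel.{u, w} h ν)
    (x := Finsupp.single M 1) (y := Finsupp.single M' 1 + Finsupp.single M'' 1)).2 ?_
  rw [← sub_sub]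
  exact Submodule.subset_span (Or.inl ⟨M', M, M'', H, rfl⟩)

theorem cls_shift_one (M : GrMod.{u, w} h ν) :
    cls (M.shift 1) = (LaurentPolynomial.T 1 : ℤ[T;T⁻¹]) • cls M := by
  have h1 : (LaurentPolynomial.T 1 : ℤ[T;T⁻¹]) • cls M = (Submodule.Quotient.mk
      (Finsupp.single M (LaurentPolynomial.T 1)) : (_ ⧸ G0rel.{u, w} h ν)) := by
    change (Submodule.Quotient.mk ((LaurentPolynomial.T 1 : ℤ[T;T⁻¹]) • Finsupp.single M 1) :
      (_ ⧸ G0rel.{u, w} h ν)) = _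
    rw [Finsupp.smul_single, smul_eq_mul, mul_one]
  rw [h1]
  exact (Submodule.Quotient.eq (G0rel.{u, w} h ν)).2 (Submodule.subset_span (Or.inr ⟨M, rfl⟩))

theorem cls_of_subsingleton (M : GrMod.{u, w} h ν) [Subsingleton M.carrier] : cls M = 0 := by
  -- For the zero module this sequence is exact and gives `[M] = [M] + [M]`.
  have : M.ShortExact M M := ⟨0, 0, by simp, by simp, fun x y _ => Subsingleton.elim x y,
    fun x => by simp [Subsingleton.elim x 0], fun x => ⟨0, Subsingleton.elim _ _⟩⟩
  simpa using cls_eq_add this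

theorem cls_eq_of_iso {M M' : GrMod.{u, w} h ν} (H : M.Iso M') : cls M = cls M' := by
  obtain ⟨F, hF⟩ := H
  have : Subsingleton (M'.quotient ⊤ GrMod.isGraded_top).carrier :=
    Submodule.Quotient.subsingleton_iff.2 rfl
  have key : M.ShortExact M' (M'.quotient ⊤ GrMod.isGraded_top) :=
    ⟨F.toLinearMap, 0, fun n x hx => (hF n x).1 hx, fun n x _ => zero_mem _, F.injective,
      fun x => ⟨fun _ => ⟨F.symm x, F.apply_symm_apply x⟩, fun _ => rfl⟩,
      fun x => ⟨0, Subsingleton.elim _ _⟩⟩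
  rw [cls_eq_add key, cls_of_subsingleton (M'.quotient ⊤ GrMod.isGraded_top), add_zero]

theorem cls_shift (M : GrMod.{u, w} h ν) (m : ℤ) :
    cls (M.shift m) = (LaurentPolynomial.T m : ℤ[T;T⁻¹]) • cls M := by
  have step : ∀ m : ℤ, cls (M.shift (m + 1)) =
      (LaurentPolynomial.T 1 : ℤ[T;T⁻¹]) • cls (M.shift m) := by
    intro m
    rw [← cls_shift_one]
    refine cls_eq_of_iso ⟨LinearEquiv.refl _ _, fun n x => ?_⟩
    change x ∈ M.gr (n - (m + 1)) ↔ x ∈ M.gr (n - 1 - m)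
    rw [sub_sub, add_comm]
  induction m with
  | zero => rw [← cls_eq_of_iso M.iso_shift_zero, LaurentPolynomial.T_zero, one_smul]
  | succ m ih => rw [step, ih, smul_smul, ← LaurentPolynomial.T_add, add_comm]
  | pred m ih =>
    have h1 := step (-m - 1)
    rw [sub_add_cancel, ih] at h1
    have h2 := congrArg ((LaurentPolynomial.T (-1) : ℤ[T;T⁻¹]) • ·) h1
    simp only [smul_smul, ← LaurentPolynomial.T_add] at h2
    rw [neg_add_cancel, LaurentPolynomial.T_zero, one_smul] at h2
    rw [← h2]
    congr 2
    ring

/-- Induction on the dimension: a proper non-zero graded submodule splits the class into two of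
smaller dimension, as in a composition series. -/
theorem cls_mem_span (M : GrMod.{u, w} h ν) :
    cls M ∈ Submodule.span ℤ[T;T⁻¹] {x | ∃ S : GrMod.{u, w} h ν, S.IsGrIrreducible ∧ x = cls S} := by
  obtain ⟨n, hn⟩ : ∃ n, n = Module.finrank ℂ M.carrier := ⟨_, rfl⟩
  induction n using Nat.strong_induction_on generalizing M with
  | _ n ih =>
  rcases subsingleton_or_nontrivial M.carrier with H | H
  · rw [cls_of_subsingleton]; exact zero_mem _
  by_cases hM : M.IsGrIrreducible
  · exact Submodule.subset_span ⟨M, hM, rfl⟩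
  have : ∃ N : Submodule (R h ν) M.carrier, M.IsGraded N ∧ N ≠ ⊥ ∧ N ≠ ⊤ := by
    by_contra! H'
    exact hM ⟨H, fun N hN => or_iff_not_imp_left.2 (H' N hN)⟩
  obtain ⟨N, hN, hbot, htop⟩ := this
  have hsum : Module.finrank ℂ (M.quotient N hN).carrier + Module.finrank ℂ (M.sub N hN).carrier =
      Module.finrank ℂ M.carrier := by
    have h1 := LinearMap.finrank_range_add_finrank_ker (N.mkQ.restrictScalars ℂ)
    rw [LinearMap.range_eq_top.2 (show Function.Surjective (N.mkQ.restrictScalars ℂ) from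
      N.mkQ_surjective), finrank_top, LinearMap.ker_restrictScalars, Submodule.ker_mkQ] at h1
    exact h1
  have hpos1 : 0 < Module.finrank ℂ (M.sub N hN).carrier := by
    have : Nontrivial (M.sub N hN).carrier := Submodule.nontrivial_iff_ne_bot.2 hbot
    exact Module.finrank_pos
  have hpos2 : 0 < Module.finrank ℂ (M.quotient N hN).carrier := by
    have : Nontrivial (M.quotient N hN).carrier := Submodule.Quotient.nontrivial_iff.2 htop
    exact Module.finrank_pos
  rw [cls_eq_add (M.shortExact_sub_quotient N hN)]
  exact add_mem (ih _ (by omega) _ rfl) (ih _ (by omega) _ rfl)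

theorem mem_span_cls (g : G0.{u, w} h ν) :
    g ∈ Submodule.span ℤ[T;T⁻¹] {x | ∃ S : GrMod.{u, w} h ν, S.IsGrIrreducible ∧ x = cls S} := by
  obtain ⟨g, rfl⟩ := Submodule.Quotient.mk_surjective (G0rel.{u, w} h ν) g
  induction g using Finsupp.induction_linear with
  | zero => exact zero_mem _
  | add x y hx hy => exact add_mem hx hy
  | single M f =>
    have h1 : (Submodule.Quotient.mk (Finsupp.single M f) : _ ⧸ G0rel.{u, w} h ν) = f • cls M := by
      change _ = (Submodule.Quotient.mk (f • Finsupp.single M 1) : _ ⧸ G0rel.{u, w} h ν)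
      rw [Finsupp.smul_single, smul_eq_mul, mul_one]
    rw [h1]
    exact Submodule.smul_mem _ _ (cls_mem_span M)

end SubQuotient

/-! ### Laurent polynomials and rational functions -/

section RatFunc

/-- `ℚ[q,q⁻¹] ⊆ ℚ(q)`. -/
def laurentToRatFunc : ℚ[T;T⁻¹] →+* RatFunc ℚ :=
  LaurentPolynomial.eval₂ RatFunc.C (Units.mk0 RatFunc.X RatFunc.X_ne_zero)

theorem laurentToRatFunc_toLaurent (p : Polynomial ℚ) :
    laurentToRatFunc (Polynomial.toLaurent p) = algebraMap (Polynomial ℚ) (RatFunc ℚ) p := by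
  rw [laurentToRatFunc, LaurentPolynomial.eval₂_toLaurent, Units.val_mk0]
  induction p using Polynomial.induction_on' with
  | add p q hp hq => rw [Polynomial.eval₂_add, hp, hq, map_add]
  | monomial n a =>
    rw [Polynomial.eval₂_monomial, ← Polynomial.C_mul_X_pow_eq_monomial, map_mul, map_pow,
      RatFunc.algebraMap_X, RatFunc.algebraMap_C]

/-- A power of `q`, which is a unit, turns a Laurent polynomial into a polynomial, and polynomials
embed into rational functions. -/
theorem laurentToRatFunc_injective : Function.Injective laurentToRatFunc := by
  refine (injective_iff_map_eq_zero _).2 fun f hf => ?_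
  obtain ⟨n, p, hp⟩ := f.exists_T_pow
  have h1 := congrArg laurentToRatFunc hp
  rw [laurentToRatFunc_toLaurent, map_mul, hf, zero_mul] at h1
  have h2 : p = 0 := (map_eq_zero_iff _ (RatFunc.algebraMap_injective ℚ)).1 h1
  rw [h2, map_zero] at hp
  exact ((LaurentPolynomial.isUnit_T n).mul_left_eq_zero).1 hp.symm

theorem laurentToRatFunc_map (f : ℤ[T;T⁻¹]) :
    laurentToRatFunc (AddMonoidAlgebra.mapRingHom ℤ (Int.castRingHom ℚ) f) =
      algebraMap ℤ[T;T⁻¹] (RatFunc ℚ) f := by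
  change _ = LaurentPolynomial.eval₂ (Int.castRingHom (RatFunc ℚ))
    (Units.mk0 RatFunc.X RatFunc.X_ne_zero) f
  induction f using LaurentPolynomial.induction_on' with
  | add p q hp hq => rw [map_add, map_add, hp, hq, map_add]
  | C_mul_T n a =>
    rw [← LaurentPolynomial.single_eq_C_mul_T, AddMonoidAlgebra.mapRingHom_single,
      LaurentPolynomial.single_eq_C_mul_T, LaurentPolynomial.single_eq_C_mul_T, laurentToRatFunc,
      LaurentPolynomial.eval₂_C_mul_T, LaurentPolynomial.eval₂_C_mul_T]
    simp

end RatFunc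

/-! ### From traces to the injectivity of the character map -/

section Main

variable {I : Type u} [Finite I] {h : I → I → ℕ} {ν : I →₀ ℕ}

theorem chQ_cls (M : GrMod.{u, w} h ν) (i : ParSeq h ν) :
    chQ.{u, w} h ν (1 ⊗ₜ cls M) i = algebraMap ℤ[T;T⁻¹] (RatFunc ℚ) (M.char i) := by
  rw [chQ, LinearMap.liftBaseChange_tmul, one_smul]
  have : ch.{u, w} h ν (cls M) = M.char := by
    change Finsupp.linearCombination ℤ[T;T⁻¹] GrMod.char (Finsupp.single M 1) = _
    rw [Finsupp.linearCombination_single, one_smul]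
  simp [this]

theorem linearIndependent_char {B : Type v} (S : B → GrMod.{u, w} h ν)
    (hS : ∀ b, (S b).IsGrIrreducible)
    (hiso : ∀ b b', b ≠ b' → ∀ m : ℤ, ¬ (S b).Iso ((S b').shift m)) :
    LinearIndependent (RatFunc ℚ) fun b => chQ.{u, w} h ν (1 ⊗ₜ cls (S b)) := by
  classical
  rw [linearIndependent_iff']
  intro s c hc
  -- A common denominator `D` makes all coefficients polynomials `p b`, so that they can multiply
  -- traces with values in `ℂ[q,q⁻¹]`.
  obtain ⟨D, hD⟩ := IsLocalization.exist_integer_multiples (nonZeroDivisors (Polynomial ℚ)) s c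
  choose! p hp using hD
  have hD0 : algebraMap (Polynomial ℚ) (RatFunc ℚ) D ≠ 0 :=
    (map_ne_zero_iff _ (RatFunc.algebraMap_injective ℚ)).2 (nonZeroDivisors.ne_zero D.2)
  let ι : ℚ[T;T⁻¹] →+* ℂ[T;T⁻¹] := AddMonoidAlgebra.mapRingHom ℤ (algebraMap ℚ ℂ)
  have hsum : ∀ i : ParSeq h ν, ∑ b ∈ s, Polynomial.toLaurent (p b) *
      AddMonoidAlgebra.mapRingHom ℤ (Int.castRingHom ℚ) ((S b).char i) = 0 := by
    intro i
    apply laurentToRatFunc_injective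
    have h1 := congrArg (algebraMap (Polynomial ℚ) (RatFunc ℚ) D * ·) (congrFun hc i)
    simp only [Finset.sum_apply, Pi.smul_apply, Pi.zero_apply, mul_zero, chQ_cls, smul_eq_mul,
      Finset.mul_sum] at h1
    rw [map_zero, map_sum, ← h1]
    refine Finset.sum_congr rfl fun b hb => ?_
    rw [map_mul, laurentToRatFunc_toLaurent, laurentToRatFunc_map, hp b hb, ← mul_assoc]
    congr 1
    rw [Algebra.smul_def]
  let φ : R h ν →ₗ[ℂ] ℂ[T;T⁻¹] :=
    ∑ b ∈ s, LinearMap.mulLeft ℂ (ι (Polynomial.toLaurent (p b))) ∘ₗ (S b).gradedTrace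
  have hφapp : ∀ r, φ r = ∑ b ∈ s, ι (Polynomial.toLaurent (p b)) * (S b).gradedTrace r := by
    intro r
    rw [LinearMap.sum_apply]
    rfl
  -- Coefficients in the commutative ring `ℂ[q,q⁻¹]` do not disturb the trace property.
  have hφ : IsTwistedTrace φ := by
    intro d a ha b
    rw [hφapp, hφapp, Finset.mul_sum]
    refine Finset.sum_congr rfl fun j _ => ?_
    rw [(S j).isTwistedTrace_gradedTrace d a ha b, mul_left_comm]
  have hφ0 : φ = 0 := by
    refine hφ.eq_zero fun i => ?_
    rw [hφapp, ← map_zero ι, ← hsum i, map_sum]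
    refine Finset.sum_congr rfl fun b _ => ?_
    rw [map_mul, GrMod.gradedTrace_parIdem]
    congr 1
    refine AddMonoidAlgebra.ext (Finsupp.ext fun n => ?_)
    simp [ι, AddMonoidAlgebra.coeff_mapRingHom]
  have hP := GrMod.eq_zero_of_sum_gradedTrace S hS hiso s
    (fun b => ι (Polynomial.toLaurent (p b))) fun r => by rw [← hφapp, hφ0, LinearMap.zero_apply]
  intro b hb
  have hpb : p b = 0 := by
    apply Polynomial.toLaurent_injective
    refine AddMonoidAlgebra.ext (Finsupp.ext fun n => ?_)
    have := congrArg (fun f : ℂ[T;T⁻¹] => f.coeff n) (hP b hb)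
    simpa [ι, AddMonoidAlgebra.coeff_mapRingHom] using this
  have h1 := hp b hb
  rw [hpb, map_zero, Algebra.smul_def] at h1
  exact (mul_eq_zero.1 h1.symm).resolve_left hD0

/-- Choose one gr-irreducible module from each class up to isomorphism and shift. A shift multiplies
the class by a power of `q`, so the chosen classes span over `ℚ(q)`, and their images are linearly
independent. -/
theorem chQ_injective (h : I → I → ℕ) (ν : I →₀ ℕ) : Function.Injective (chQ.{u, w} h ν) := by
  let B := Quotient (GrMod.shiftSetoid.{u, w} h ν)
  let S : B → GrMod.{u, w} h ν := fun b => b.out.1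
  have hS : ∀ b, (S b).IsGrIrreducible := fun b => b.out.2
  have hiso : ∀ b b', b ≠ b' → ∀ m : ℤ, ¬ (S b).Iso ((S b').shift m) := by
    intro b b' hbb m H
    apply hbb
    rw [← b.out_eq, ← b'.out_eq]
    exact Quotient.sound ⟨m, H⟩
  have hli := linearIndependent_char S hS hiso
  have hgen : ∀ z : RatFunc ℚ ⊗[ℤ[T;T⁻¹]] G0.{u, w} h ν,
      z ∈ Submodule.span (RatFunc ℚ) (Set.range fun b => (1 : RatFunc ℚ) ⊗ₜ[ℤ[T;T⁻¹]] cls (S b)) := by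
    have hsmul : ∀ (f : ℤ[T;T⁻¹]) (g : G0.{u, w} h ν), (1 : RatFunc ℚ) ⊗ₜ[ℤ[T;T⁻¹]] (f • g) =
        algebraMap ℤ[T;T⁻¹] (RatFunc ℚ) f • ((1 : RatFunc ℚ) ⊗ₜ[ℤ[T;T⁻¹]] g) := by
      intro f g
      rw [← TensorProduct.smul_tmul, TensorProduct.smul_tmul', Algebra.smul_def, smul_eq_mul]
    have hmk : ∀ g : G0.{u, w} h ν, (1 : RatFunc ℚ) ⊗ₜ[ℤ[T;T⁻¹]] g ∈ Submodule.span (RatFunc ℚ)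
        (Set.range fun b => (1 : RatFunc ℚ) ⊗ₜ[ℤ[T;T⁻¹]] cls (S b)) := by
      intro g
      induction mem_span_cls g using Submodule.span_induction with
      | mem x hx =>
        obtain ⟨M, hM, rfl⟩ := hx
        let b : B := Quotient.mk _ ⟨M, hM⟩
        obtain ⟨m, H⟩ : ∃ m : ℤ, M.Iso ((S b).shift m) :=
          Quotient.exact (Quotient.out_eq b).symm
        rw [cls_eq_of_iso H, cls_shift, hsmul]
        exact Submodule.smul_mem _ _ (Submodule.subset_span ⟨b, rfl⟩)
      | zero => rw [TensorProduct.tmul_zero]; exact zero_mem _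
      | add x y _ _ hx hy => rw [TensorProduct.tmul_add]; exact add_mem hx hy
      | smul f x _ hx => rw [hsmul]; exact Submodule.smul_mem _ _ hx
    intro z
    induction z using TensorProduct.induction_on with
    | zero => exact zero_mem _
    | add x y hx hy => exact add_mem hx hy
    | tmul c g =>
      rw [show c ⊗ₜ[ℤ[T;T⁻¹]] g = c • ((1 : RatFunc ℚ) ⊗ₜ[ℤ[T;T⁻¹]] g) by
        rw [TensorProduct.smul_tmul', smul_eq_mul, mul_one]]
      exact Submodule.smul_mem _ _ (hmk g)
  refine (injective_iff_map_eq_zero _).2 fun z hz => ?_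
  obtain ⟨c, rfl⟩ := (Finsupp.mem_span_range_iff_exists_finsupp).1 (hgen z)
  rw [Finsupp.sum, map_sum] at hz
  simp only [map_smul] at hz
  have := linearIndependent_iff'.1 hli c.support c hz
  rw [Finsupp.sum]
  exact Finset.sum_eq_zero fun b hb => by rw [this b hb, zero_smul]

end Main

end KLR

end

theorem mainTheorem4 {I : Type u} [Finite I] (h : I → I → ℕ) (ν : I →₀ ℕ) :
    Function.Injective (KLR.chQ.{u, w} h ν) ∧
    ∀ {B : Type v} (S : B → KLR.GrMod.{u, w} h ν), (∀ b, (S b).IsGrIrreducible) →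
      (∀ b b', b ≠ b' → ∀ m : ℤ, ¬ (S b).Iso ((S b').shift m)) →
      LinearIndependent (RatFunc ℚ) fun b => KLR.chQ.{u, w} h ν (1 ⊗ₜ KLR.cls (S b)) :=
  ⟨KLR.chQ_injective h ν, KLR.linearIndependent_char⟩
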